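/- \textbf{Proposition (Étale descent).}\label{etale descent} Let $k$ be a field. For a commutative $k$-algebra $A$ and a nonzerodivisor $f\in A$, let $HH(A[f^{-1}])$ be the simplicial ring with $n$-th ring $A[f^{-1}]^{\otimes_k n+1}$, with faces $d_i(x_0\otimes\cdots\otimes x_n)=x_0\otimes\cdots\otimes x_ix_{i+1}\otimes\cdots\otimes x_n$ for $i<n$ and $d_n(x_0\otimes\cdots\otimes x_n)=x_nx_0\otimes x_1\otimes\cdots\otimes x_{n-1}$, and with degeneracies $s_i$ inserting $1$ after $x_i$. Let $\underline{P}HH(A,f)\subseteq HH(A[f^{-1}])$ be the simplicial subring whose $n$-th ring consists of the sums of elements $a_0m_0\otimes\cdots\otimes a_nm_n$ with $a_i\in A$, $m_i\in A[f^{-1}]^{*}$ and $m_0\cdots m_n\in A$; it is a simplicial commutative $A$-algebra, $A$ acting through the factor $x_0$. Call $(A,f)$ \emph{strict normal crossing} if $A$ is smooth over $k$, $f$ is a nonzerodivisor, and for every prime ideal $\mathfrak p\ni f$ there are a regular system of parameters $b_1,\dots,b_d$ of the regular local ring $A_{\mathfrak p}$ and integers $r_i\ge 0$ such that $f$ is a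 unit times $b_1^{r_1}\cdots b_d^{r_d}$ in $A_{\mathfrak p}$. Let $(A,f)$ be strict normal crossing and let $A\to B$ be an étale ring homomorphism. Suppose that in $A$, and also in $B$, (the image of) $f$ is up to a unit a (possibly empty) product of prime elements. Then the canonical map of simplicial commutative $B$-algebras \[ \underline{P}HH(A,f)\otimes_A B\longrightarrow \underline{P}HH(B,f),\qquad (x_0\otimes\cdots\otimes x_n)\otimes b\longmapsto b\,x_0\otimes x_1\otimes\cdots\otimes x_n, \] is an equivalence, that is, it induces a quasi-isomorphism of the associated chain complexes of $B$-modules (with differential $\sum_i(-1)^id_i$). -/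

import Mathlib

open CategoryTheory TensorProduct

universe u

noncomputable section

namespace ModulusHochschild

/-! ### The simplicial circle and the cyclic bar construction -/

/-- The map `{0, …, n} → {0, …, m}` induced by a monotone map `θ : [m] → [n]` on the simplices of
the simplicial circle `Δ¹/∂Δ¹`: the index `j` is sent to the number of `l` with `θ l < j`, where
`m + 1` is read as `0`.  See `circleMap_face`, `circleMap_degeneracy` and
`barMap_pureTensor` for the faces and the degeneracies. -/
def circleMap {m n : ℕ} (θ : Fin (m + 1) →o Fin (n + 1)) (j : Fin (n + 1)) : Fin (m + 1) :=
  Fin.ofNat (m + 1) (Finset.univ.filter fun l => θ l < j).card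

lemma circleMap_zero {m n : ℕ} (θ : Fin (m + 1) →o Fin (n + 1)) : circleMap θ 0 = 0 := by
  simp [circleMap]

/-- A finite initial segment of `Fin (m + 1)` is described by its cardinality. -/
lemma lt_card_iff {m n : ℕ} (θ : Fin (m + 1) →o Fin (n + 1)) (j : Fin (n + 1)) (l : Fin (m + 1)) :
    (l : ℕ) < (Finset.univ.filter fun l => θ l < j).card ↔ θ l < j := by
  constructor
  · intro h
    by_contra hl
    have hsub : (Finset.univ.filter fun l => θ l < j) ⊆ Finset.Iio l := by
      intro x hx
      simp only [Finset.mem_filter, Finset.mem_univ, true_and] at hx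
      rw [Finset.mem_Iio]
      by_contra hxl
      exact hl ((θ.monotone (not_lt.mp hxl)).trans_lt hx)
    have := Finset.card_le_card hsub
    rw [Fin.card_Iio] at this
    omega
  · intro h
    have hsub : Finset.Iic l ⊆ (Finset.univ.filter fun l => θ l < j) := by
      intro x hx
      simp only [Finset.mem_filter, Finset.mem_univ, true_and]
      exact (θ.monotone (Finset.mem_Iic.mp hx)).trans_lt h
    have := Finset.card_le_card hsub
    rw [Fin.card_Iic] at this
    omega

lemma circleMap_id {n : ℕ} (j : Fin (n + 1)) : circleMap (OrderHom.id : Fin (n + 1) →o _) j = j := by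
  have : (Finset.univ.filter fun l : Fin (n + 1) => l < j) = Finset.Iio j := by
    ext x; simp
  apply Fin.ext
  simp [circleMap, this]

lemma circleMap_comp {l m n : ℕ} (η : Fin (l + 1) →o Fin (m + 1)) (θ : Fin (m + 1) →o Fin (n + 1))
    (j : Fin (n + 1)) : circleMap (θ.comp η) j = circleMap η (circleMap θ j) := by
  set c := (Finset.univ.filter fun l => θ l < j).card with hc
  have hle : c ≤ m + 1 := by
    simpa using Finset.card_le_univ (Finset.univ.filter fun l => θ l < j)
  rcases hle.lt_or_eq with h | h
  · have hset : (Finset.univ.filter fun x => (θ.comp η) x < j) =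
        (Finset.univ.filter fun x => η x < circleMap θ j) := by
      ext x
      simp only [OrderHom.comp_coe, Function.comp_apply, Finset.mem_filter, Finset.mem_univ,
        true_and]
      rw [← lt_card_iff θ j (η x), ← hc, Fin.lt_def]
      simp [circleMap, ← hc, Nat.mod_eq_of_lt h]
    simp only [circleMap] at hset ⊢
    rw [hset]
  · have h0 : circleMap θ j = 0 := by
      simp [circleMap, ← hc, h]
    have hset : (Finset.univ.filter fun x => (θ.comp η) x < j) = Finset.univ := by
      ext x
      simp only [OrderHom.comp_coe, Function.comp_apply, Finset.mem_filter, Finset.mem_univ,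
        true_and, iff_true]
      rw [← lt_card_iff θ j (η x), ← hc, h]
      exact (η x).2
    rw [h0, circleMap_zero, circleMap, hset]
    simp

/-- The `i`-th face map puts `j ≤ i` at the place `j`, and `j > i` at the place `j - 1`; for the
last face, `i = n`, the index `n` goes to the place `0`. -/
lemma circleMap_face {n : ℕ} (i : Fin (n + 2)) (j : Fin (n + 2)) :
    (circleMap (Fin.succAboveOrderEmb i).toOrderHom j : ℕ) =
      (if j ≤ i then (j : ℕ) else (j : ℕ) - 1) % (n + 1) := by
  have key : ∀ l : Fin (n + 1), ((Fin.succAboveOrderEmb i).toOrderHom l < j ↔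
      (l : ℕ) < if j ≤ i then (j : ℕ) else (j : ℕ) - 1) := by
    intro l
    simp only [Fin.lt_def, Fin.le_def, OrderEmbedding.toOrderHom_coe, Fin.succAboveOrderEmb_apply,
      Fin.succAbove]
    split_ifs <;> simp only [Fin.val_castSucc, Fin.val_succ] at * <;> omega
  simp only [circleMap, Fin.val_ofNat, key]
  congr 1
  set c := if j ≤ i then (j : ℕ) else (j : ℕ) - 1 with hc
  have hcle : c ≤ n + 1 := by rw [hc]; split_ifs <;> omega
  rw [Fin.card_filter_val_lt]
  exact min_eq_right hcle

/-- The `i`-th degeneracy map puts `j ≤ i` at the place `j`, and `j > i` at the place `j + 1`. -/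
lemma circleMap_degeneracy {n : ℕ} (i : Fin (n + 1)) (j : Fin (n + 1)) :
    circleMap ⟨i.predAbove, i.predAbove_right_monotone⟩ j = i.succ.succAbove j := by
  have key : ∀ l : Fin (n + 2), (i.predAbove l < j ↔
      (l : ℕ) < if j ≤ i then (j : ℕ) else (j : ℕ) + 1) := by
    intro l
    have hl := l.2
    simp only [Fin.lt_def, Fin.le_def, Fin.predAbove]
    split_ifs <;> (try simp only [Fin.coe_castPred, Fin.val_pred] at *) <;>
      rw [Fin.val_castSucc] at * <;> omega
  apply Fin.ext
  simp only [circleMap, Fin.val_ofNat, OrderHom.coe_mk, key]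
  rw [Fin.card_filter_val_lt]
  simp only [Fin.succAbove, Fin.lt_def, Fin.le_def, Fin.val_castSucc, Fin.val_succ]
  have hj := j.2
  split_ifs <;> (try simp only [Fin.val_castSucc, Fin.val_succ] at *) <;>
    first
    | omega
    | (rw [min_eq_right (by omega), Nat.mod_eq_of_lt (by omega)])

/-- The `n`-th ring `L ⊗ₖ ⋯ ⊗ₖ L` (with `n + 1` factors) of the simplicial ring `HH(L)`. -/
def CyclicBar (k L : Type u) [CommRing k] [CommRing L] [Algebra k L] (n : ℕ) : Type u :=
  ⨂[k] _ : Fin (n + 1), L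

section Bar

variable (k : Type u) [CommRing k]

instance (L : Type u) [CommRing L] [Algebra k L] (n : ℕ) : CommRing (CyclicBar k L n) :=
  inferInstanceAs (CommRing (⨂[k] _ : Fin (n + 1), L))

/-- The pure tensor `x 0 ⊗ ⋯ ⊗ x n`. -/
def pureTensor {L : Type u} [CommRing L] [Algebra k L] {n : ℕ} (x : Fin (n + 1) → L) :
    CyclicBar k L n :=
  PiTensorProduct.tprod k x

/-- The element `1 ⊗ ⋯ ⊗ a ⊗ ⋯ ⊗ 1` with `a` at the place `i`, as a ring homomorphism in `a`. -/
def place (L : Type u) [CommRing L] [Algebra k L] (n : ℕ) (i : Fin (n + 1)) :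
    L →+* CyclicBar k L n :=
  (PiTensorProduct.singleAlgHom (R := k) (A := fun _ : Fin (n + 1) => L) i).toRingHom

/-- `L^{⊗ n+1}` is an algebra over `L` (and over everything below `L`) through the factor of
index `0`. -/
instance (S L : Type u) [CommRing S] [CommRing L] [Algebra k L] [Algebra S L] (n : ℕ) :
    Algebra S (CyclicBar k L n) :=
  ((place k L n 0).comp (algebraMap S L)).toAlgebra

variable {k}

lemma algebraMap_bar (S L : Type u) [CommRing S] [CommRing L] [Algebra k L] [Algebra S L] (n : ℕ)
    (s : S) : algebraMap S (CyclicBar k L n) s = place k L n 0 (algebraMap S L s) := rfl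

variable {L L' L'' : Type u} [CommRing L] [CommRing L'] [CommRing L'']
  [Algebra k L] [Algebra k L'] [Algebra k L'']

lemma pureTensor_mul {n : ℕ} (x y : Fin (n + 1) → L) :
    pureTensor k x * pureTensor k y = pureTensor k (x * y) :=
  PiTensorProduct.tprod_mul_tprod x y

lemma pureTensor_one {n : ℕ} : pureTensor k (1 : Fin (n + 1) → L) = 1 := rfl

lemma place_eq_pureTensor {n : ℕ} (i : Fin (n + 1)) (a : L) :
    place k L n i a = pureTensor k (Pi.mulSingle i a) := rfl

lemma pureTensor_eq_prod {n : ℕ} (x : Fin (n + 1) → L) :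
    pureTensor k x = ∏ i, place k L n i (x i) := by
  have h := map_prod (PiTensorProduct.tprodMonoidHom k (A := fun _ : Fin (n + 1) => L))
    (fun i => Pi.mulSingle i (x i)) Finset.univ
  rw [Finset.univ_prod_mulSingle] at h
  exact h

/-- For a map `g` of index sets and a `k`-algebra map `φ : L → L'`, the ring homomorphism
`L^{⊗ ι} → L'^{⊗ κ}` which sends `a` placed at `i` to `φ a` placed at `g i`. -/
def piTensorMap {ι κ : Type} [Fintype ι] [DecidableEq κ] (g : ι → κ) (φ : L →ₐ[k] L') :
    (⨂[k] _ : ι, L) →ₐ[k] ⨂[k] _ : κ, L' :=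
  PiTensorProduct.liftAlgHom
    ((MultilinearMap.mkPiAlgebra k ι (⨂[k] _ : κ, L')).compLinearMap
      fun i => ((PiTensorProduct.singleAlgHom (R := k) (A := fun _ : κ => L')
        (g i)).comp φ).toLinearMap)
    (by
      rw [MultilinearMap.compLinearMap_apply, MultilinearMap.mkPiAlgebra_apply]
      refine Finset.prod_eq_one fun i _ => ?_
      exact map_one ((PiTensorProduct.singleAlgHom (R := k) (A := fun _ : κ => L') (g i)).comp φ))
    (by
      intro x y
      simp only [MultilinearMap.compLinearMap_apply, MultilinearMap.mkPiAlgebra_apply,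
        ← Finset.prod_mul_distrib]
      refine Finset.prod_congr rfl fun i _ => ?_
      exact map_mul ((PiTensorProduct.singleAlgHom (R := k) (A := fun _ : κ => L') (g i)).comp φ)
        _ _)

lemma piTensorMap_tprod {ι κ : Type} [Fintype ι] [DecidableEq κ] (g : ι → κ) (φ : L →ₐ[k] L')
    (x : ι → L) :
    piTensorMap g φ (PiTensorProduct.tprod k x) =
      ∏ i, PiTensorProduct.singleAlgHom (R := k) (A := fun _ : κ => L') (g i) (φ (x i)) := by
  refine (PiTensorProduct.lift.tprod _).trans ?_
  rw [MultilinearMap.compLinearMap_apply, MultilinearMap.mkPiAlgebra_apply]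
  rfl

/-- The ring homomorphism `L^{⊗ n+1} → L'^{⊗ m+1}` induced by a map `g` of the places and a
`k`-algebra map `φ : L → L'`. -/
def barMap {n m : ℕ} (g : Fin (n + 1) → Fin (m + 1)) (φ : L →ₐ[k] L') :
    CyclicBar k L n →+* CyclicBar k L' m :=
  (piTensorMap g φ).toRingHom

lemma barMap_pureTensor_eq_prod {n m : ℕ} (g : Fin (n + 1) → Fin (m + 1)) (φ : L →ₐ[k] L')
    (x : Fin (n + 1) → L) : barMap g φ (pureTensor k x) = ∏ i, place k L' m (g i) (φ (x i)) :=
  piTensorMap_tprod g φ x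

/-- `barMap g φ` sends `x 0 ⊗ ⋯ ⊗ x n` to the pure tensor whose factor at the place `j` is the
product of the `φ (x i)` with `g i = j`. -/
lemma barMap_pureTensor {n m : ℕ} (g : Fin (n + 1) → Fin (m + 1)) (φ : L →ₐ[k] L')
    (x : Fin (n + 1) → L) :
    barMap g φ (pureTensor k x) =
      pureTensor k fun j => ∏ i ∈ Finset.univ.filter (fun i => g i = j), φ (x i) := by
  rw [barMap_pureTensor_eq_prod, pureTensor_eq_prod,
    ← Finset.prod_fiberwise Finset.univ g]
  refine Finset.prod_congr rfl fun j _ => ?_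
  rw [map_prod]
  refine Finset.prod_congr rfl fun i hi => ?_
  rw [(Finset.mem_filter.mp hi).2]

lemma barMap_place {n m : ℕ} (g : Fin (n + 1) → Fin (m + 1)) (φ : L →ₐ[k] L')
    (i : Fin (n + 1)) (a : L) : barMap g φ (place k L n i a) = place k L' m (g i) (φ a) := by
  rw [place_eq_pureTensor, barMap_pureTensor_eq_prod, Finset.prod_eq_single i]
  · simp
  · intro j _ hj
    simp [Pi.mulSingle_eq_of_ne hj]
  · simp

lemma bar_ringHom_ext {n : ℕ} {S : Type u} [CommRing S] {F G : CyclicBar k L n →+* S}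
    (h : ∀ i a, F (place k L n i a) = G (place k L n i a)) : F = G := by
  ext x
  have hp : ∀ x : Fin (n + 1) → L, F (pureTensor k x) = G (pureTensor k x) := by
    intro x
    simp only [pureTensor_eq_prod, map_prod, h]
  refine PiTensorProduct.induction_on (motive := fun x => F x = G x) x ?_ ?_
  · intro r x
    have e : (r • PiTensorProduct.tprod k x : ⨂[k] _ : Fin (n + 1), L) =
        (place k L n 0 (algebraMap k L r) * pureTensor k x : CyclicBar k L n) := by
      rw [Algebra.smul_def]
      congr 1
      exact ((PiTensorProduct.singleAlgHom (R := k) (A := fun _ : Fin (n + 1) => L)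
        0).commutes r).symm
    refine (congrArg F e).trans (Eq.trans ?_ (congrArg G e).symm)
    rw [map_mul, map_mul, h, hp]
  · intro x y hx hy
    exact (map_add F _ _).trans ((congrArg₂ (· + ·) hx hy).trans (map_add G _ _).symm)

lemma barMap_id {n : ℕ} : barMap (k := k) (L := L) (n := n) id (AlgHom.id k L) = RingHom.id _ :=
  bar_ringHom_ext fun i a => by rw [barMap_place]; rfl

lemma barMap_barMap {n m l : ℕ} (g : Fin (n + 1) → Fin (m + 1)) (h : Fin (m + 1) → Fin (l + 1))
    (φ : L →ₐ[k] L') (ψ : L' →ₐ[k] L'') (x : CyclicBar k L n) :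
    barMap h ψ (barMap g φ x) = barMap (h ∘ g) (ψ.comp φ) x := by
  have : (barMap h ψ).comp (barMap g φ) = barMap (h ∘ g) (ψ.comp φ) :=
    bar_ringHom_ext fun i a => by simp [barMap_place]
  exact congr($this x)

instance (S S' : Type u) [CommRing S] [CommRing S'] [Algebra S S'] [Algebra S L] [Algebra S' L]
    [IsScalarTower S S' L] (n : ℕ) : IsScalarTower S S' (CyclicBar k L n) :=
  IsScalarTower.of_algebraMap_eq fun s => by
    rw [algebraMap_bar, algebraMap_bar, ← IsScalarTower.algebraMap_apply S S' L]

end Bar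

/-! ### The simplicial ring `P̲HH(A, f)` -/

section PHH

variable (k : Type u) [CommRing k]

/-- The elements `a₀m₀ ⊗ ⋯ ⊗ aₙmₙ` of `A[1/f]^{⊗ n+1}` with `aᵢ ∈ A`, with `mᵢ` a unit of `A[1/f]`,
and with `m₀ ⋯ mₙ ∈ A`. -/
def generators {A : Type u} [CommRing A] [Algebra k A] (f : A) (n : ℕ) :
    Set (CyclicBar k (Localization.Away f) n) :=
  {x | ∃ (a : Fin (n + 1) → A) (m : Fin (n + 1) → (Localization.Away f)ˣ),
    (∏ i, (m i : Localization.Away f)) ∈ (algebraMap A (Localization.Away f)).range ∧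
    x = pureTensor k fun i => algebraMap A (Localization.Away f) (a i) * m i}

section

variable {k} {A : Type u} [CommRing A] [Algebra k A] {f : A} {n : ℕ}

lemma mul_mem_generators {x y : CyclicBar k (Localization.Away f) n} (hx : x ∈ generators k f n)
    (hy : y ∈ generators k f n) : x * y ∈ generators k f n := by
  obtain ⟨a, m, hm, rfl⟩ := hx
  obtain ⟨a', m', hm', rfl⟩ := hy
  refine ⟨a * a', m * m', ?_, ?_⟩
  · simpa [Finset.prod_mul_distrib] using Subring.mul_mem _ hm hm'
  · rw [pureTensor_mul]
    congr 1
    ext i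
    simp only [Pi.mul_apply, map_mul, Units.val_mul]
    ring

lemma algebraMap_mem_generators (a : A) :
    algebraMap A (CyclicBar k (Localization.Away f) n) a ∈ generators k f n := by
  refine ⟨Pi.mulSingle 0 a, 1, by simp, ?_⟩
  rw [algebraMap_bar, place_eq_pureTensor]
  congr 1
  ext i
  by_cases h : i = 0
  · subst h; simp
  · simp [Pi.mulSingle_eq_of_ne h]

end

/-- The `n`-th ring of `P̲HH(A, f)`: the sums of elements of `generators k f n`.  It is an
`A`-subalgebra of `A[1/f]^{⊗ n+1}`, where `A` acts through the factor of index `0`. -/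
def PHHRing {A : Type u} [CommRing A] [Algebra k A] (f : A) (n : ℕ) :
    Subalgebra A (CyclicBar k (Localization.Away f) n) where
  carrier := AddSubmonoid.closure (generators k f n)
  add_mem' := AddSubmonoid.add_mem _
  mul_mem' {x y} hx hy := by
    induction hx using AddSubmonoid.closure_induction with
    | zero => rw [zero_mul]; exact AddSubmonoid.zero_mem _
    | add u v _ _ hu hv => rw [add_mul]; exact AddSubmonoid.add_mem _ hu hv
    | mem u hu =>
      induction hy using AddSubmonoid.closure_induction with
      | zero => rw [mul_zero]; exact AddSubmonoid.zero_mem _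
      | add v w _ _ hv hw => rw [mul_add]; exact AddSubmonoid.add_mem _ hv hw
      | mem v hv => exact AddSubmonoid.subset_closure (mul_mem_generators hu hv)
  algebraMap_mem' a := AddSubmonoid.subset_closure (algebraMap_mem_generators a)

section Maps

variable {k} {A B : Type u} [CommRing A] [CommRing B] [Algebra k A] [Algebra k B] [Algebra A B]
  {f : A} {f' : B}

lemma barMap_mem_PHHRing {n m : ℕ} (g : Fin (n + 1) → Fin (m + 1))
    (φ : Localization.Away f →ₐ[k] Localization.Away f')
    (hφ : ∀ a, φ (algebraMap A _ a) = algebraMap B _ (algebraMap A B a))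
    {x : CyclicBar k (Localization.Away f) n} (hx : x ∈ PHHRing k f n) :
    barMap g φ x ∈ PHHRing k f' m := by
  change x ∈ AddSubmonoid.closure (generators k f n) at hx
  induction hx using AddSubmonoid.closure_induction with
  | zero => rw [map_zero]; exact zero_mem _
  | add u v _ _ hu hv => rw [map_add]; exact add_mem hu hv
  | mem u hu =>
    obtain ⟨a, μ, ⟨c, hc⟩, rfl⟩ := hu
    refine AddSubmonoid.subset_closure
      ⟨fun j => ∏ i ∈ Finset.univ.filter (fun i => g i = j), algebraMap A B (a i),
        fun j => ∏ i ∈ Finset.univ.filter (fun i => g i = j), Units.map (φ : _ →* _) (μ i),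
        ⟨algebraMap A B c, ?_⟩, ?_⟩
    · rw [← hφ, hc, map_prod, ← Finset.prod_fiberwise Finset.univ g]
      simp
    · rw [barMap_pureTensor]
      congr 1
      ext j
      simp [hφ, Finset.prod_mul_distrib]

/-- The map on the rings of `P̲HH` induced by a map of the places which fixes the place `0`, and by
a map of the localizations which extends `A → B`. -/
def PHHMap {n m : ℕ} (g : Fin (n + 1) → Fin (m + 1)) (hg : g 0 = 0)
    (φ : Localization.Away f →ₐ[k] Localization.Away f')
    (hφ : ∀ a, φ (algebraMap A _ a) = algebraMap B _ (algebraMap A B a)) :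
    PHHRing k f n →ₐ[A] PHHRing k f' m where
  toRingHom := (barMap g φ).restrict (PHHRing k f n) (PHHRing k f' m)
    fun _ hx => barMap_mem_PHHRing g φ hφ hx
  commutes' a := by
    apply Subtype.ext
    change barMap g φ (algebraMap A _ a) = algebraMap A _ a
    rw [algebraMap_bar, algebraMap_bar, barMap_place, hg, hφ,
      ← IsScalarTower.algebraMap_apply A B]

end Maps

variable {A : Type u} [CommRing A] [Algebra k A] (f : A)

/-- `P̲HH(A, f)` as a simplicial commutative `A`-algebra: a simplicial subring of `HH(A[1/f])`. -/
def PHH : SimplicialObject (CommAlgCat.{u} A) where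
  obj X := CommAlgCat.of A (PHHRing k f X.unop.len)
  map θ := CommAlgCat.ofHom (PHHMap (circleMap θ.unop.toOrderHom) (circleMap_zero _)
    (AlgHom.id k (Localization.Away f)) fun _ => rfl)
  map_id X := by
    ext x
    change barMap (circleMap OrderHom.id) (AlgHom.id k _) x.1 = x.1
    rw [show circleMap OrderHom.id = id from funext circleMap_id, barMap_id]
    rfl
  map_comp θ η := by
    ext x
    change barMap (circleMap (θ.unop.toOrderHom.comp η.unop.toOrderHom)) (AlgHom.id k _) x.1 =
      barMap (circleMap η.unop.toOrderHom) (AlgHom.id k _)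
        (barMap (circleMap θ.unop.toOrderHom) (AlgHom.id k _) x.1)
    rw [barMap_barMap, AlgHom.id_comp]
    congr 2
    exact funext (circleMap_comp _ _)

/-- The base change `B ⊗_A -` of commutative algebras. -/
def baseChange (A B : Type u) [CommRing A] [CommRing B] [Algebra A B] :
    CommAlgCat.{u} A ⥤ CommAlgCat.{u} B where
  obj X := CommAlgCat.of B (B ⊗[A] X)
  map φ := CommAlgCat.ofHom (Algebra.TensorProduct.map (AlgHom.id B B) φ.hom)
  map_id X := by
    ext : 1
    exact Algebra.TensorProduct.map_id
  map_comp φ ψ := by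
    ext : 1
    apply Algebra.TensorProduct.ext
    · ext
    · ext x
      rfl

variable (B : Type u) [CommRing B] [Algebra k B] [Algebra A B] [IsScalarTower k A B]

/-- The map `A[1/f] → B[1/f]` induced by `A → B`. -/
def awayMap : Localization.Away f →ₐ[k] Localization.Away (algebraMap A B f) :=
  IsLocalization.liftAlgHom (M := Submonoid.powers f)
    (f := (IsScalarTower.toAlgHom k B (Localization.Away (algebraMap A B f))).comp
      (IsScalarTower.toAlgHom k A B))
    (by
      rintro ⟨_, n, rfl⟩
      simpa using (IsLocalization.Away.algebraMap_isUnit (algebraMap A B f)).pow n)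

lemma awayMap_algebraMap (a : A) :
    awayMap k f B (algebraMap A _ a) = algebraMap B _ (algebraMap A B a) := by
  simp [awayMap]

/-- The canonical map in degree `n`,
`b ⊗ (x₀ ⊗ ⋯ ⊗ xₙ) ↦ b x₀ ⊗ x₁ ⊗ ⋯ ⊗ xₙ`. -/
def comparisonRing (n : ℕ) : B ⊗[A] PHHRing k f n →ₐ[B] PHHRing k (algebraMap A B f) n :=
  Algebra.TensorProduct.lift (Algebra.ofId B _)
    (PHHMap (n := n) id rfl (awayMap k f B) (awayMap_algebraMap k f B))
    fun _ _ => Commute.all _ _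

lemma comparisonRing_tmul (n : ℕ) (b : B) (x : PHHRing k f n) :
    ((comparisonRing k f B n (b ⊗ₜ x) : PHHRing k (algebraMap A B f) n) :
      CyclicBar k (Localization.Away (algebraMap A B f)) n) =
      algebraMap B _ b * barMap id (awayMap k f B) x.1 :=
  rfl

lemma comparisonRing_natural {n m : ℕ} (θ : Fin (m + 1) →o Fin (n + 1)) :
    (comparisonRing k f B m).comp (Algebra.TensorProduct.map (AlgHom.id B B)
        (PHHMap (circleMap θ) (circleMap_zero θ) (AlgHom.id k (Localization.Away f))
          fun _ => rfl)) =
      (PHHMap (circleMap θ) (circleMap_zero θ)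
        (AlgHom.id k (Localization.Away (algebraMap A B f))) fun _ => rfl).comp
        (comparisonRing k f B n) := by
  apply Algebra.TensorProduct.ext
  · ext
  · ext x
    change algebraMap B _ 1 * barMap id (awayMap k f B)
        (barMap (circleMap θ) (AlgHom.id k (Localization.Away f)) x.1) =
      barMap (circleMap θ) (AlgHom.id k (Localization.Away (algebraMap A B f)))
        (algebraMap B _ 1 * barMap id (awayMap k f B) x.1)
    rw [map_one, map_one, one_mul, one_mul, barMap_barMap, barMap_barMap]
    rfl

/-- The canonical map of simplicial commutative `B`-algebras
`P̲HH(A, f) ⊗_A B → P̲HH(B, f)`. -/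
def comparison :
    ((SimplicialObject.whiskering _ _).obj (baseChange A B)).obj (PHH k f) ⟶
      PHH k (algebraMap A B f) where
  app X := CommAlgCat.ofHom (comparisonRing k f B X.unop.len)
  naturality X Y θ := by
    ext : 1
    exact comparisonRing_natural k f B θ.unop.toOrderHom

/-- The chain complex of `R`-modules, with differential `∑ (-1)ⁱ dᵢ`, of a simplicial commutative
`R`-algebra. -/
def chains (R : Type u) [CommRing R] :
    SimplicialObject (CommAlgCat.{u} R) ⥤ ChainComplex (ModuleCat.{u} R) ℕ :=
  (SimplicialObject.whiskering _ _).obj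
      (forget₂ (CommAlgCat.{u} R) (AlgCat.{u} R) ⋙ forget₂ (AlgCat.{u} R) (ModuleCat.{u} R)) ⋙
    AlgebraicTopology.alternatingFaceMapComplex (ModuleCat.{u} R)

end PHH

/-! ### Strict normal crossing modulus pairs -/

/-- `b₁, …, b_d` is a regular system of parameters of the local ring `R`: `R` is a regular local
ring of dimension `d` and `b₁, …, b_d` generate its maximal ideal. -/
structure IsRegularSystemOfParameters {R : Type u} [CommRing R] {d : ℕ} (b : Fin d → R) : Prop where
  isRegularLocalRing : IsRegularLocalRing R
  ringKrullDim_eq : ringKrullDim R = d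
  span_eq : Ideal.span (Set.range b) = IsLocalRing.maximalIdeal R

/-- `(Spec A, (f))` is a strict normal crossing modulus pair over `k`: `Spec A` is smooth over `k`,
`(f)` is an effective Cartier divisor, and its support has strict normal crossings, that is, at
each of its points it is given by a product of powers of members of a regular system of
parameters. -/
structure IsStrictNormalCrossing (k : Type u) {A : Type u} [CommRing k] [CommRing A] [Algebra k A]
    (f : A) : Prop where
  smooth : Algebra.Smooth k A
  mem_nonZeroDivisors : f ∈ nonZeroDivisors A
  exists_parameters : ∀ (p : Ideal A) [p.IsPrime], f ∈ p →
    ∃ (d : ℕ) (b : Fin d → Localization.AtPrime p) (r : Fin d → ℕ),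
      IsRegularSystemOfParameters b ∧
        Associated (∏ i, b i ^ r i) (algebraMap A (Localization.AtPrime p) f)

/-- `f` is, up to a unit, a (possibly empty) product of prime elements. -/
def IsProductOfPrimes {R : Type u} [CommRing R] (f : R) : Prop :=
  ∃ s : Multiset R, (∀ p ∈ s, Prime p) ∧ Associated s.prod f

end ModulusHochschild

end

noncomputable section

namespace ModulusHochschild

/-! ### Parameters and unramified extensions -/

/-! In degree `n`, `P̲HH(A, f)` is a module over `A^{⊗ n+2}`, the last factor acting through the
first. Extending scalars in the first factor only, along `A^{⊗ n+2} → A^{⊗ n+2} ⊗_A B`, gives `B ⊗_A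
P̲HH(A, f)`; extending them along `A^{⊗ n+2} → B^{⊗ n+2}` gives a bigger complex. Both have the same
homology (`coneExactAt_tensHom`), because both families of algebras are functors on pointed sets,
are flat over the tensor powers of `A`, and agree at the one-point set. Indeed, for a module `M` on
bipointed sets, the shifted module `M.dec` acquires an extra degeneracy after either extension, so
it resolves a group that depends only on the value at the one-point set; since `M.dec` surjects onto
`M` with kernel `M.omega`, dimension shifting gives the general case.

The bigger complex maps to `E^{⊗ n+1}`, `E = B[1/f]`, by multiplying the last factor into the first
(`wrapTens`). As `A → B` is unramified, `B ⊗_A B` contains the diagonal idempotent; let `e` be its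
action through the first and the last factor. Flatness shows that `e` is zero on the kernel of
`wrapTens`, so `1 - e` is the identity there. But `1 - e` is a difference of two faces of one
element, hence zero on homology (`exists_tensD_eq_smul`). So the kernel is acyclic, and `B ⊗_A
P̲HH(A, f)` computes the homology of the image, the subring of `E^{⊗ n+1}` generated by `B` at all
places and by `P̲HH(A, f)` (`coneExactAt_of_formallyUnramified`). This uses only that the extension
is flat, formally unramified and essentially of finite type, so it applies to `A → B_Q` as well as
to `B → B_Q` for a prime `Q` of `B`.

It remains to see that the subrings generated from `A` and from `B` agree over `B_Q`; this is where
normal crossings and prime factorizations enter. A prime factor `p` of `f` in `A` is not in the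
square of the maximal ideal at a point where it vanishes, and étaleness preserves this; so each
prime factor of `f` in `B` is, at `Q`, a unit or a unit times such a `p`. As `p ⊗ p⁻¹` lies in
`P̲HH(A, f)`, these factors can be moved between the tensor places, and in a generator of `P̲HH(B,
f)` the denominators cancel prime by prime against the numerators (`mem_of_prod_dvd`). Two out of
three gives the claim over each `B_Q`, and exactness of the mapping cone is a local property. -/

lemma IsRegularSystemOfParameters.notMem_sq {R : Type u} [CommRing R] [IsLocalRing R] {d : ℕ}
    {b : Fin d → R} (hb : IsRegularSystemOfParameters b) (i : Fin d) :
    b i ∉ IsLocalRing.maximalIdeal R ^ 2 := by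
  intro hi
  have := hb.isRegularLocalRing
  set m := IsLocalRing.maximalIdeal R with hm
  have hspan : Ideal.span (Set.range b) = m := hb.span_eq
  set s : Set R := b '' {i}ᶜ
  have hfg : m.FG := IsNoetherian.noetherian m
  -- If `b i` were in `m²`, the other `d - 1` parameters would generate `m` by Nakayama, although
  -- `m` needs `dim R = d` generators.
  have hle : m ≤ Ideal.span s := by
    refine Submodule.le_of_le_smul_of_le_jacobson_bot (I := m) hfg
      (IsLocalRing.maximalIdeal_le_jacobson _) ?_
    conv_lhs => rw [← hspan]
    rw [Ideal.span_le]
    rintro _ ⟨j, rfl⟩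
    by_cases h : j = i
    · subst h
      refine (le_sup_right : _ ≤ Ideal.span s ⊔ m • m) ?_
      rwa [smul_eq_mul, ← pow_two]
    · exact (le_sup_left : _ ≤ Ideal.span s ⊔ m • m) (Ideal.subset_span ⟨j, h, rfl⟩)
  have heq : m = Ideal.span s := le_antisymm hle (by
    rw [← hspan]; exact Ideal.span_mono (Set.image_subset_range _ _))
  have h1 : m.spanFinrank ≤ s.ncard := by
    rw [heq]
    exact Submodule.spanFinrank_span_le_ncard_of_finite (Set.toFinite s)
  have h2 : s.ncard ≤ ({i}ᶜ : Set (Fin d)).ncard := Set.ncard_image_le (Set.toFinite _)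
  have h3 : ({i}ᶜ : Set (Fin d)).ncard + 1 = d := by
    have := Set.ncard_add_ncard_compl ({i} : Set (Fin d))
    rw [Set.ncard_singleton, Nat.card_fin] at this
    omega
  have h4 := IsRegularLocalRing.spanFinrank_maximalIdeal (R := R)
  rw [hb.ringKrullDim_eq] at h4
  have h5 : m.spanFinrank = d := by exact_mod_cast h4
  omega

section

variable {k A : Type u} [CommRing k] [CommRing A] [Algebra k A] {f : A}

/-- The ideal of `p` stays prime at `P` and contains a product of powers of parameters. So `p`
divides one parameter, and a parameter is not in the square of the maximal ideal. -/
lemma IsStrictNormalCrossing.notMem_sq (h : IsStrictNormalCrossing k f) {p : A} (hp : Prime p)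
    (hpf : p ∣ f) (P : Ideal A) [P.IsPrime] (hpP : p ∈ P) :
    algebraMap A (Localization.AtPrime P) p ∉
      IsLocalRing.maximalIdeal (Localization.AtPrime P) ^ 2 := by
  obtain ⟨d, b, r, hb, hassoc⟩ := h.exists_parameters P (P.mem_of_dvd hpf hpP)
  have hspan : (Ideal.span {p}).IsPrime := (Ideal.span_singleton_prime hp.ne_zero).mpr hp
  have hprime : (Ideal.span {algebraMap A (Localization.AtPrime P) p}).IsPrime := by
    rw [← Set.image_singleton, ← Ideal.map_span]
    refine IsLocalization.isPrime_of_isPrime_disjoint P.primeCompl _ _ hspan ?_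
    rw [Set.disjoint_left]
    intro x hx hx'
    exact hx ((Ideal.span_singleton_le_iff_mem P).mpr hpP hx')
  have hdvd : algebraMap A (Localization.AtPrime P) p ∣ ∏ i, b i ^ r i :=
    ((algebraMap A (Localization.AtPrime P)).map_dvd hpf).trans hassoc.symm.dvd
  rw [← Ideal.mem_span_singleton] at hdvd
  obtain ⟨i, -, hi⟩ := (Ideal.IsPrime.prod_mem_iff (hp := hprime)).mp hdvd
  have hi' := Ideal.mem_span_singleton.mp (hprime.mem_of_pow_mem _ hi)
  exact fun hp2 => hb.notMem_sq i (Ideal.mem_of_dvd _ hi' hp2)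

/-- If `w` were in `Q` too, `p = q w` would lie in the square of the maximal ideal at `Q`. By
unramifiedness this square is extended from the one at `P`, and by faithful flatness it contracts
back to it, against `notMem_sq`. Hence `q` agrees with `p` up to a unit at `Q`. -/
lemma IsStrictNormalCrossing.notMem_of_mul_eq (h : IsStrictNormalCrossing k f) {B : Type u}
    [CommRing B] [Algebra A B] [Algebra.Etale A B] {p : A} (hp : Prime p) (hpf : p ∣ f)
    (Q : Ideal B) [Q.IsPrime] {q w : B} (hq : q ∈ Q) (hqw : algebraMap A B p = q * w) :
    w ∉ Q := by
  intro hw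
  set P := Q.under A with hP
  have hpP : p ∈ P := by
    rw [hP, Ideal.under_def, Ideal.mem_comap, hqw]; exact Q.mul_mem_right _ hq
  let := Localization.AtPrime.algebraOfLiesOver P Q
  have hflat : Module.Flat (Localization.AtPrime P) (Localization.AtPrime Q) := inferInstance
  have : IsLocalHom (algebraMap (Localization.AtPrime P) (Localization.AtPrime Q)) := inferInstance
  have : Module.FaithfullyFlat (Localization.AtPrime P) (Localization.AtPrime Q) :=
    Module.FaithfullyFlat.of_flat_of_isLocalHom
  have hmap : (IsLocalRing.maximalIdeal (Localization.AtPrime P)).map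
      (algebraMap (Localization.AtPrime P) (Localization.AtPrime Q)) =
      IsLocalRing.maximalIdeal (Localization.AtPrime Q) := by
    rw [← ((Algebra.isUnramifiedAt_iff_map_eq A P Q).mp inferInstance).2,
      ← Localization.AtPrime.map_eq_maximalIdeal, Ideal.map_map, ← IsScalarTower.algebraMap_eq]
  refine h.notMem_sq hp hpf P hpP ?_
  rw [← Ideal.comap_map_eq_self_of_faithfullyFlat (B := Localization.AtPrime Q)
    (IsLocalRing.maximalIdeal (Localization.AtPrime P) ^ 2), Ideal.mem_comap, Ideal.map_pow, hmap,
    ← IsScalarTower.algebraMap_apply A (Localization.AtPrime P),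
    IsScalarTower.algebraMap_apply A B, hqw, map_mul, pow_two]
  refine Ideal.mul_mem_mul ?_ ?_ <;>
    rwa [IsLocalization.AtPrime.to_map_mem_maximal_iff _ Q]

end

/-! ### Alternating sums of faces -/

section AltSum

variable {X Y Z W : Type*} [AddCommGroup X] [AddCommGroup Y] [AddCommGroup Z] [AddCommGroup W]

/-- The alternating sum of a family of homomorphisms. -/
def altSum {n : ℕ} (d : Fin n → X →+ Y) : X →+ Y := ∑ i : Fin n, (-1 : ℤ) ^ (i : ℕ) • d i

lemma altSum_apply {n : ℕ} (d : Fin n → X →+ Y) (x : X) :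
    altSum d x = ∑ i : Fin n, (-1 : ℤ) ^ (i : ℕ) • d i x := by
  simp [altSum, AddMonoidHom.finsetSum_apply]

lemma altSum_natural {n : ℕ} {d : Fin n → X →+ Y} {d' : Fin n → Z →+ W} (φ : X →+ Z) (ψ : Y →+ W)
    (h : ∀ i x, d' i (φ x) = ψ (d i x)) (x : X) : altSum d' (φ x) = ψ (altSum d x) := by
  simp [altSum_apply, h]

lemma altSum_altSum {n : ℕ} {d : Fin (n + 1) → X →+ Y} {d' : Fin (n + 2) → Z →+ X}
    (h : ∀ (i j : Fin (n + 1)), i ≤ j → ∀ z, d i (d' j.succ z) = d j (d' i.castSucc z)) (z : Z) :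
    altSum d (altSum d' z) = 0 := by
  simp only [altSum_apply, map_sum, map_zsmul, Finset.smul_sum, smul_smul, ← pow_add]
  rw [Finset.sum_comm, ← Finset.sum_product']
  let P := Fin (n + 1) × Fin (n + 2)
  let S : Finset P := {ij : P | (ij.2 : ℕ) ≤ (ij.1 : ℕ)}
  rw [Finset.univ_product_univ, ← Finset.sum_add_sum_compl S, ← eq_neg_iff_add_eq_zero,
    ← Finset.sum_neg_distrib]
  -- The term `(i, j)` with `j ≤ i` cancels against `(j, i + 1)`: the simplicial identity makes them
  -- equal, and the signs are opposite.
  let φ : ∀ ij : P, ij ∈ S → P := fun ij hij =>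
    (Fin.castLT ij.2 (lt_of_le_of_lt (Finset.mem_filter.mp hij).right (Fin.is_lt ij.1)),
      ij.1.succ)
  apply Finset.sum_bij φ
  · intro ij hij
    simp only [φ, S, Finset.mem_univ, Finset.compl_filter, Finset.mem_filter, true_and,
      Fin.val_succ, Fin.val_castLT] at hij ⊢
    omega
  · rintro ⟨i, j⟩ hij ⟨i', j'⟩ hij' h
    rw [Prod.mk_inj]
    exact ⟨by simpa [φ] using congr_arg Prod.snd h,
      by simpa [φ, Fin.castLT, Fin.ext_iff] using congr_arg Prod.fst h⟩
  · rintro ⟨i', j'⟩ hij'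
    simp only [S, Finset.compl_filter, Finset.mem_filter, Finset.mem_univ, true_and, not_le]
      at hij'
    refine ⟨(j'.pred ?_, Fin.castSucc i'), ?_, ?_⟩
    · rintro rfl
      simp at hij'
    · simpa [S] using Nat.le_sub_one_of_lt hij'
    · simp [φ]
  · rintro ⟨i, j⟩ hij
    have hij' : (j : ℕ) ≤ i := (Finset.mem_filter.mp hij).2
    dsimp only [φ]
    rw [h _ _ (by rw [Fin.le_def]; exact hij'), Fin.castSucc_castLT, Fin.val_succ, Fin.val_castLT,
      ← neg_smul]
    congr 1
    rw [pow_add, pow_add, pow_succ]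
    ring

/-- An extra degeneracy is a contraction of the alternating sum, up to sign. -/
lemma altSum_extraDegeneracy {n : ℕ} {d : Fin (n + 1) → X →+ Y} {d' : Fin (n + 2) → Z →+ X}
    (s : X →+ Z) (t : Y →+ X) (hl : ∀ x, d' (Fin.last _) (s x) = x)
    (h : ∀ (i : Fin (n + 1)) x, d' i.castSucc (s x) = t (d i x)) (x : X) :
    altSum d' (s x) = t (altSum d x) + (-1 : ℤ) ^ (n + 1) • x := by
  simp [altSum_apply, Fin.sum_univ_castSucc (n := n + 1), h, hl]

end AltSum

/-! ### Exactness of mapping cones -/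

section Cone

/-- `x` is a cycle of the nonnegative chain complex with differential `d`. -/
def IsCycle {C : ℕ → Type*} [∀ n, AddCommGroup (C n)] (d : ∀ n, C (n + 1) →+ C n) :
    ∀ n, C n → Prop
  | 0, _ => True
  | n + 1, x => d n x = 0

/-- The mapping cone of `φ` is exact at the place `C (n - 1) × D n`. -/
def ConeExactAt {C D : ℕ → Type*} [∀ n, AddCommGroup (C n)] [∀ n, AddCommGroup (D n)]
    (dC : ∀ n, C (n + 1) →+ C n) (dD : ∀ n, D (n + 1) →+ D n) (φ : ∀ n, C n →+ D n) : ℕ → Prop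
  | 0 => ∀ y : D 0, ∃ x' y', y = φ 0 x' + dD 0 y'
  | n + 1 => ∀ (x : C n) (y : D (n + 1)), IsCycle dC n x → φ n x = dD n y →
      ∃ x' y', dC n x' = x ∧ y = φ (n + 1) x' + dD (n + 1) y'

variable {C D C₁ D₁ C₂ D₂ E : ℕ → Type*} [∀ n, AddCommGroup (C n)] [∀ n, AddCommGroup (D n)]
  [∀ n, AddCommGroup (C₁ n)] [∀ n, AddCommGroup (D₁ n)]
  [∀ n, AddCommGroup (C₂ n)] [∀ n, AddCommGroup (D₂ n)] [∀ n, AddCommGroup (E n)]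
  {dC : ∀ n, C (n + 1) →+ C n} {dD : ∀ n, D (n + 1) →+ D n} {φ : ∀ n, C n →+ D n}
  {dC₁ : ∀ n, C₁ (n + 1) →+ C₁ n} {dD₁ : ∀ n, D₁ (n + 1) →+ D₁ n} {φ₁ : ∀ n, C₁ n →+ D₁ n}
  {dC₂ : ∀ n, C₂ (n + 1) →+ C₂ n} {dD₂ : ∀ n, D₂ (n + 1) →+ D₂ n} {φ₂ : ∀ n, C₂ n →+ D₂ n}
  {dE : ∀ n, E (n + 1) →+ E n}

lemma IsCycle.of_injective {i : ∀ n, C₁ n →+ C n} (hi : ∀ n, Function.Injective (i n))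
    (h : ∀ n x, i n (dC₁ n x) = dC n (i (n + 1) x)) {n : ℕ} {x : C₁ n}
    (hx : IsCycle dC n (i n x)) : IsCycle dC₁ n x := by
  cases n with
  | zero => trivial
  | succ n => exact hi _ (by rw [h, hx, map_zero])

lemma IsCycle.map {i : ∀ n, C₁ n →+ C n}
    (h : ∀ n x, i n (dC₁ n x) = dC n (i (n + 1) x)) {n : ℕ} {x : C₁ n}
    (hx : IsCycle dC₁ n x) : IsCycle dC n (i n x) := by
  cases n with
  | zero => trivial
  | succ n => exact (h n x).symm.trans (by rw [show dC₁ n x = 0 from hx, map_zero])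

lemma isCycle_boundary (hd : ∀ n x, dC n (dC (n + 1) x) = 0) {n : ℕ} (x : C (n + 1)) :
    IsCycle dC n (dC n x) := by
  cases n with
  | zero => trivial
  | succ n => exact hd n x

lemma IsCycle.sub {n : ℕ} {x y : C n} (hx : IsCycle dC n x) (hy : IsCycle dC n y) :
    IsCycle dC n (x - y) := by
  cases n with
  | zero => trivial
  | succ n => exact (map_sub _ _ _).trans (by rw [show dC n x = 0 from hx, show dC n y = 0 from hy,
      sub_zero])

/-- The cone of a map between two resolutions of the same group is exact. -/
lemma coneExactAt_of_augmented {G G' : Type*} [AddCommGroup G] [AddCommGroup G']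
    (hφ : ∀ n x, φ n (dC n x) = dD n (φ (n + 1) x))
    (εC : C 0 →+ G) (εD : D 0 →+ G') (γ : G →+ G') (hγ : Function.Bijective γ)
    (hε : ∀ x, γ (εC x) = εD (φ 0 x)) (hεC : Function.Surjective εC)
    (hεD : ∀ y, εD (dD 0 y) = 0)
    (hC₀ : ∀ x, εC x = 0 → ∃ x', dC 0 x' = x) (hC : ∀ n x, dC n x = 0 → ∃ x', dC (n + 1) x' = x)
    (hD₀ : ∀ x, εD x = 0 → ∃ x', dD 0 x' = x) (hD : ∀ n x, dD n x = 0 → ∃ x', dD (n + 1) x' = x)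
    (n : ℕ) : ConeExactAt dC dD φ n := by
  cases n with
  | zero =>
    intro y
    obtain ⟨g, hg⟩ := hγ.2 (εD y)
    obtain ⟨x, rfl⟩ := hεC g
    obtain ⟨z, hz⟩ := hD₀ (y - φ 0 x) (by rw [map_sub, ← hε, hg, sub_self])
    exact ⟨x, z, by rw [hz]; abel⟩
  | succ n =>
    intro x y hx hxy
    obtain ⟨x', rfl⟩ : ∃ x', dC n x' = x := by
      cases n with
      | zero => exact hC₀ x (hγ.1 (by rw [hε, hxy, hεD, map_zero]))
      | succ n => exact hC n x hx
    obtain ⟨z, hz⟩ := hD n (y - φ _ x') (by rw [map_sub, ← hφ, hxy, sub_self])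
    exact ⟨x', z, rfl, by rw [hz]; abel⟩

/-- Dimension shifting for cones. -/
lemma coneExactAt_succ_of_shortExact
    (hdC : ∀ n x, dC n (dC (n + 1) x) = 0) (hdD : ∀ n x, dD n (dD (n + 1) x) = 0)
    (hφ : ∀ n x, φ n (dC n x) = dD n (φ (n + 1) x))
    {iC : ∀ n, C₁ n →+ C n} {iD : ∀ n, D₁ n →+ D n} {jC : ∀ n, C n →+ C₂ n} {jD : ∀ n, D n →+ D₂ n}
    (hiC : ∀ n x, iC n (dC₁ n x) = dC n (iC (n + 1) x))
    (hiD : ∀ n x, iD n (dD₁ n x) = dD n (iD (n + 1) x))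
    (hjC : ∀ n x, jC n (dC n x) = dC₂ n (jC (n + 1) x))
    (hjD : ∀ n x, jD n (dD n x) = dD₂ n (jD (n + 1) x))
    (hiφ : ∀ n x, iD n (φ₁ n x) = φ n (iC n x)) (hjφ : ∀ n x, jD n (φ n x) = φ₂ n (jC n x))
    (iC_inj : ∀ n, Function.Injective (iC n)) (iD_inj : ∀ n, Function.Injective (iD n))
    (jC_surj : ∀ n, Function.Surjective (jC n)) (jD_surj : ∀ n, Function.Surjective (jD n))
    (hC : ∀ n, Function.Exact (iC n) (jC n)) (hD : ∀ n, Function.Exact (iD n) (jD n))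
    {n : ℕ} (h : ConeExactAt dC dD φ (n + 1)) (h₁ : ConeExactAt dC₁ dD₁ φ₁ n) :
    ConeExactAt dC₂ dD₂ φ₂ (n + 1) := by
  intro x y hx hxy
  obtain ⟨x, rfl⟩ := jC_surj _ x
  obtain ⟨y, rfl⟩ := jD_surj _ y
  -- The lifted pair `(x, y)` fails to be a cycle of the middle cone only by a cycle of the cone of
  -- `φ₁`, one degree lower. That one bounds by `h₁`, and a bounding pair `(a', b')` corrects the
  -- lift to a cycle.
  obtain ⟨b, hb⟩ := (hD n (φ n x - dD n y)).mp (by rw [map_sub, hjφ, hxy, hjD, sub_self])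
  obtain ⟨a', b', ha', hb'⟩ : ∃ a' b', IsCycle dC n (x - iC n a') ∧ b = φ₁ n a' + dD₁ n b' := by
    cases n with
    | zero =>
      obtain ⟨a', b', hab⟩ := h₁ b
      exact ⟨a', b', trivial, hab⟩
    | succ n =>
      obtain ⟨a, ha⟩ := (hC n (dC n x)).mp (by rw [hjC]; exact hx)
      obtain ⟨a', b', hab, hab'⟩ := h₁ a b
        (.of_injective iC_inj hiC (by rw [ha]; exact isCycle_boundary hdC x))
        (iD_inj _ (by rw [hiφ, ha, hiD, hb, map_sub, hdD, hφ, sub_zero]))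
      refine ⟨a', b', ?_, hab'⟩
      change dC n (x - iC (n + 1) a') = 0
      rw [map_sub, ← hiC, hab, ha, sub_self]
  obtain ⟨x', y', hx', hy'⟩ := h (x - iC n a') (y + iD _ b') ha' (by
    rw [map_add, map_sub, ← hiD, ← hiφ, ← sub_eq_zero]
    have : iD n b = iD n (φ₁ n a') + iD n (dD₁ n b') := by rw [hb', map_add]
    rw [hb] at this
    rw [eq_comm, ← sub_eq_zero] at this
    rw [← neg_eq_zero, ← this]
    abel)
  refine ⟨jC _ x', jD _ y', ?_, ?_⟩
  · rw [← hjC, hx', map_sub, (hC n _).mpr ⟨a', rfl⟩, sub_zero]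
  · rw [← hjD, ← hjφ, ← map_add, ← hy', map_add, (hD _ _).mpr ⟨b', rfl⟩, add_zero]

lemma coneExactAt_zero_of_surjective {jC : ∀ n, C n →+ C₂ n} {jD : ∀ n, D n →+ D₂ n}
    (hjD : ∀ n x, jD n (dD n x) = dD₂ n (jD (n + 1) x))
    (hjφ : ∀ n x, jD n (φ n x) = φ₂ n (jC n x)) (jD_surj : ∀ n, Function.Surjective (jD n))
    (h : ConeExactAt dC dD φ 0) : ConeExactAt dC₂ dD₂ φ₂ 0 := by
  intro y
  obtain ⟨y, rfl⟩ := jD_surj _ y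
  obtain ⟨x', y', rfl⟩ := h y
  exact ⟨jC _ x', jD _ y', by rw [map_add, hjφ, hjD]⟩

/-- Composing with a surjection whose kernel is exact keeps the cone exact. -/
lemma ConeExactAt.comp_surjective (hdD : ∀ n x, dD n (dD (n + 1) x) = 0)
    (hφ : ∀ n x, φ n (dC n x) = dD n (φ (n + 1) x))
    {π : ∀ n, D n →+ E n} (hπ : ∀ n x, π n (dD n x) = dE n (π (n + 1) x))
    (π_surj : ∀ n, Function.Surjective (π n))
    (hker : ∀ n x, IsCycle dD n x → π n x = 0 → ∃ y, π (n + 1) y = 0 ∧ dD n y = x)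
    (h : ∀ n, ConeExactAt dC dD φ n) (n : ℕ) :
    ConeExactAt dC dE (fun n => (π n).comp (φ n)) n := by
  cases n with
  | zero =>
    exact coneExactAt_zero_of_surjective (jC := fun n => AddMonoidHom.id (C n)) hπ
      (fun _ _ => rfl) π_surj (h 0)
  | succ n =>
    intro x q hx hq
    obtain ⟨y, rfl⟩ := π_surj _ q
    -- The defect `φ x - d y` is a cycle in the kernel of `π`, so it bounds there; `y + z` is then a
    -- lift of the same element for which `(x, y + z)` is a cycle.
    obtain ⟨z, hz, hz'⟩ := hker n (φ n x - dD n y) ((hx.map hφ).sub (isCycle_boundary hdD y))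
      (by rw [map_sub, hπ, ← hq]; exact sub_self _)
    obtain ⟨x', y', hx', hy'⟩ := h (n + 1) x (y + z) hx (by rw [map_add, hz']; abel)
    refine ⟨x', π _ y', hx', ?_⟩
    rw [← hπ, AddMonoidHom.comp_apply, ← map_add, ← hy', map_add, hz, add_zero]

/-- Two out of three. -/
lemma coneExactAt_of_comp {ψ : ∀ n, D n →+ E n}
    (hφ : ∀ n x, φ n (dC n x) = dD n (φ (n + 1) x))
    (hψ : ∀ n x, ψ n (dD n x) = dE n (ψ (n + 1) x))
    (h₁ : ∀ n, ConeExactAt dD dE ψ n) (h₂ : ∀ n, ConeExactAt dC dE (fun n => (ψ n).comp (φ n)) n)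
    (n : ℕ) : ConeExactAt dC dD φ n := by
  cases n with
  | zero =>
    intro y
    obtain ⟨x', e, he⟩ := h₂ 0 (ψ 0 y)
    -- The pair `(y - φ x', e)` is a cycle in the cone of `ψ`. Exactness one degree higher gives, in
    -- its first component, a `z` that bounds `y - φ x'`.
    obtain ⟨z, -, hz, -⟩ := h₁ 1 (y - φ 0 x') e trivial
      (by rw [map_sub, he, AddMonoidHom.comp_apply]; abel)
    exact ⟨x', z, by rw [hz]; abel⟩
  | succ n =>
    intro x y hx hxy
    obtain ⟨x', e, hx', he⟩ := h₂ (n + 1) x (ψ _ y) hx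
      (by rw [AddMonoidHom.comp_apply, hxy, hψ])
    obtain ⟨z, -, hz, -⟩ := h₁ (n + 2) (y - φ _ x') e
      (by change dD n _ = 0; rw [map_sub, ← hφ, hx', hxy, sub_self])
      (by rw [map_sub, he, AddMonoidHom.comp_apply]; abel)
    exact ⟨x', z, hx', by rw [hz]; abel⟩

end Cone

/-! ### Maps of pointed and bipointed finite sets -/

lemma coe_predAbove {n : ℕ} (i : Fin (n + 1)) (j : Fin (n + 2)) :
    (i.predAbove j : ℕ) = if (i : ℕ) < j then (j : ℕ) - 1 else j := by
  simp only [Fin.predAbove, Fin.lt_def, Fin.val_castSucc]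
  split_ifs <;> simp

lemma predAbove_zero' {n : ℕ} (i : Fin (n + 1)) : i.predAbove 0 = 0 := by
  apply Fin.ext; rw [coe_predAbove]; simp

lemma predAbove_last' {n : ℕ} (i : Fin (n + 1)) : i.predAbove (Fin.last (n + 1)) = Fin.last n := by
  apply Fin.ext; rw [coe_predAbove]; simp [i.2]

lemma predAbove_predAbove {n : ℕ} (i j : Fin (n + 1)) (h : i ≤ j) (l : Fin (n + 3)) :
    i.predAbove (j.succ.predAbove l) = j.predAbove (i.castSucc.predAbove l) := by
  rw [Fin.le_def] at h
  apply Fin.ext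
  simp only [coe_predAbove, Fin.val_succ, Fin.val_castSucc]
  split_ifs <;> omega

lemma predAbove_last_castSucc {n : ℕ} (j : Fin (n + 1)) :
    (Fin.last n).predAbove j.castSucc = j := by
  apply Fin.ext; rw [coe_predAbove]; simp; omega

lemma predAbove_castSucc_castSucc {n : ℕ} (i : Fin (n + 1)) (j : Fin (n + 2)) :
    i.castSucc.predAbove j.castSucc = (i.predAbove j).castSucc := by
  apply Fin.ext; simp [coe_predAbove]

/-- Adding a new last element to the source and the target of a map. -/
def addTop {n m : ℕ} (g : Fin n → Fin m) : Fin (n + 1) → Fin (m + 1) :=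
  Fin.lastCases (Fin.last m) fun j => (g j).castSucc

@[simp] lemma addTop_castSucc {n m : ℕ} (g : Fin n → Fin m) (j : Fin n) :
    addTop g j.castSucc = (g j).castSucc := by simp [addTop]

@[simp] lemma addTop_last {n m : ℕ} (g : Fin n → Fin m) : addTop g (Fin.last n) = Fin.last m := by
  simp [addTop]

lemma addTop_zero {n m : ℕ} {g : Fin (n + 1) → Fin (m + 1)} (h : g 0 = 0) : addTop g 0 = 0 := by
  rw [← Fin.castSucc_zero, addTop_castSucc, h]
  simp

lemma addTop_comp {n m l : ℕ} {g : Fin n → Fin m} {h : Fin m → Fin l} {k : Fin n → Fin l}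
    (hk : ∀ i, h (g i) = k i) (i : Fin (n + 1)) : addTop h (addTop g i) = addTop k i := by
  induction i using Fin.lastCases with
  | last => simp
  | cast i => simp [hk]

/-- Identifying the last two elements. -/
def mergeTop {n : ℕ} : Fin (n + 2) → Fin (n + 1) := (Fin.last n).predAbove

lemma mergeTop_zero {n : ℕ} : mergeTop (0 : Fin (n + 2)) = 0 := predAbove_zero' _

lemma mergeTop_last {n : ℕ} : mergeTop (Fin.last (n + 1)) = Fin.last n := predAbove_last' _

lemma mergeTop_castSucc {n : ℕ} (i : Fin (n + 1)) : mergeTop i.castSucc = i :=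
  predAbove_last_castSucc i

lemma mergeTop_addTop {n m : ℕ} {g : Fin (n + 1) → Fin (m + 1)} (h : g (Fin.last n) = Fin.last m)
    (i : Fin (n + 2)) : mergeTop (addTop g i) = g (mergeTop i) := by
  induction i using Fin.lastCases with
  | last => rw [addTop_last, mergeTop_last, mergeTop_last, h]
  | cast i => rw [addTop_castSucc, mergeTop_castSucc, mergeTop_castSucc]

/-! ### Simplicial modules over functors on pointed sets -/

/-- A functor from the pointed finite sets `{0, …, n}` to commutative rings. -/
structure PtRing : Type (u + 1) where
  obj : ℕ → Type u
  [commRing : ∀ n, CommRing (obj n)]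
  map : ∀ {n m : ℕ} (g : Fin (n + 1) → Fin (m + 1)), g 0 = 0 → (obj n →+* obj m)
  map_id : ∀ (n : ℕ) (x : obj n), map id rfl x = x
  map_comp : ∀ {n m l : ℕ} (g : Fin (n + 1) → Fin (m + 1)) (h : Fin (m + 1) → Fin (l + 1))
    (hg : g 0 = 0) (hh : h 0 = 0) (x : obj n),
    map h hh (map g hg x) = map (h ∘ g) (by simp [hg, hh]) x

attribute [instance] PtRing.commRing

lemma PtRing.map_map (V : PtRing.{u}) {n m l : ℕ} {g : Fin (n + 1) → Fin (m + 1)}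
    {h : Fin (m + 1) → Fin (l + 1)} {k : Fin (n + 1) → Fin (l + 1)} (hg : g 0 = 0) (hh : h 0 = 0)
    (hk : k 0 = 0) (e : ∀ i, h (g i) = k i) (x : V.obj n) :
    V.map h hh (V.map g hg x) = V.map k hk x := by
  obtain rfl : h ∘ g = k := funext e
  exact V.map_comp ..

lemma PtRing.map_eq_self (V : PtRing.{u}) {n : ℕ} {g : Fin (n + 1) → Fin (n + 1)} (hg : g 0 = 0)
    (e : ∀ i, g i = i) (x : V.obj n) : V.map g hg x = x := by
  obtain rfl : g = id := funext e
  exact V.map_id ..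

/-- An algebra over a functor from pointed finite sets to commutative rings. -/
structure PtAlg (V : PtRing.{u}) extends PtRing.{u} where
  [algebra : ∀ n, Algebra (V.obj n) (obj n)]
  map_algebraMap : ∀ {n m : ℕ} (g : Fin (n + 1) → Fin (m + 1)) (hg : g 0 = 0) (v : V.obj n),
    map g hg (algebraMap (V.obj n) (obj n) v) = algebraMap (V.obj m) (obj m) (V.map g hg v)

attribute [instance] PtAlg.algebra

/-- A functor `M` from the bipointed sets `({0, …, n + 1}, 0, n + 1)` to abelian groups, with
actions of the rings `V.obj (n + 1)`.  The identifications of neighbours are the faces of a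
simplicial module. -/
structure BipMod (V : PtRing.{u}) : Type (u + 1) where
  obj : ℕ → Type u
  [addCommGroup : ∀ n, AddCommGroup (obj n)]
  [module : ∀ n, Module (V.obj (n + 1)) (obj n)]
  map : ∀ {n m : ℕ} (g : Fin (n + 2) → Fin (m + 2)) (h₀ : g 0 = 0),
    g (Fin.last _) = Fin.last _ → (obj n →ₛₗ[V.map g h₀] obj m)
  map_id : ∀ (n : ℕ) (x : obj n), map id rfl rfl x = x
  map_comp : ∀ {n m l : ℕ} (g : Fin (n + 2) → Fin (m + 2)) (h : Fin (m + 2) → Fin (l + 2))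
    (g₀ : g 0 = 0) (h₀ : h 0 = 0) (gl : g (Fin.last _) = Fin.last _)
    (hl : h (Fin.last _) = Fin.last _) (x : obj n),
    map h h₀ hl (map g g₀ gl x) = map (h ∘ g) (by simp [g₀, h₀]) (by simp [gl, hl]) x

attribute [instance] BipMod.addCommGroup BipMod.module

variable {V : PtRing.{u}}

/-- The semilinear map induced by a pointed map. -/
def PtAlg.mapₛₗ (F : PtAlg V) {n m : ℕ} (g : Fin (n + 1) → Fin (m + 1)) (hg : g 0 = 0) :
    F.obj n →ₛₗ[V.map g hg] F.obj m where
  toFun := F.map g hg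
  map_add' := map_add _
  map_smul' v x := by
    rw [Algebra.smul_def, map_mul, F.map_algebraMap, ← Algebra.smul_def]

namespace BipMod

variable (M : BipMod V)

lemma map_map {n m l : ℕ} {g : Fin (n + 2) → Fin (m + 2)} {h : Fin (m + 2) → Fin (l + 2)}
    {k : Fin (n + 2) → Fin (l + 2)} (g₀ : g 0 = 0) (h₀ : h 0 = 0) (k₀ : k 0 = 0)
    (gl : g (Fin.last _) = Fin.last _) (hl : h (Fin.last _) = Fin.last _)
    (kl : k (Fin.last _) = Fin.last _) (e : ∀ i, h (g i) = k i) (x : M.obj n) :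
    M.map h h₀ hl (M.map g g₀ gl x) = M.map k k₀ kl x := by
  obtain rfl : h ∘ g = k := funext e
  exact M.map_comp ..

lemma map_eq_self {n : ℕ} {g : Fin (n + 2) → Fin (n + 2)} (g₀ : g 0 = 0)
    (gl : g (Fin.last _) = Fin.last _) (e : ∀ i, g i = i) (x : M.obj n) : M.map g g₀ gl x = x := by
  obtain rfl : g = id := funext e
  exact M.map_id ..

/-- The group `M.obj n` with the action of `V.obj n` through the elements below the last one. -/
def Sh (n : ℕ) : Type u := M.obj n

instance (n : ℕ) : AddCommGroup (M.Sh n) := inferInstanceAs (AddCommGroup (M.obj n))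

/-- The map `castSucc` misses the last point. This is why `V` has to be a functor on pointed sets,
not only on bipointed ones. -/
instance (n : ℕ) : Module (V.obj n) (M.Sh n) :=
  Module.compHom (M.obj n) (V.map (Fin.castSucc : Fin (n + 1) → Fin (n + 2)) Fin.castSucc_zero)

/-- The functoriality of `M.Sh` for pointed maps. -/
def shMap {n m : ℕ} (g : Fin (n + 1) → Fin (m + 1)) (hg : g 0 = 0) :
    M.Sh n →ₛₗ[V.map g hg] M.Sh m where
  toFun := M.map (addTop g) (addTop_zero hg) (addTop_last g)
  map_add' := map_add (M.map (addTop g) (addTop_zero hg) (addTop_last g))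
  map_smul' v x := by
    refine ((M.map (addTop g) (addTop_zero hg) (addTop_last g)).map_smulₛₗ
      (V.map Fin.castSucc Fin.castSucc_zero v) x).trans ?_
    refine congrArg (· • _) ?_
    have hk : (fun i => (g i).castSucc) 0 = 0 := by simp [hg]
    exact (V.map_map _ _ hk (by simp) v).trans (V.map_map _ _ hk (fun _ => rfl) v).symm

lemma shMap_shMap {n m l : ℕ} {g : Fin (n + 1) → Fin (m + 1)} {h : Fin (m + 1) → Fin (l + 1)}
    {k : Fin (n + 1) → Fin (l + 1)} (hg : g 0 = 0) (hh : h 0 = 0) (hk : k 0 = 0)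
    (e : ∀ i, h (g i) = k i) (x : M.Sh n) :
    M.shMap h hh (M.shMap g hg x) = M.shMap k hk x :=
  M.map_map _ _ _ _ _ _ (addTop_comp e) x

lemma shMap_id {n : ℕ} (x : M.Sh n) : M.shMap id rfl x = x :=
  M.map_eq_self _ _ (fun i => by induction i using Fin.lastCases <;> simp) x

/-- The shifted module: the last element becomes an inner one, and a new last element is added. -/
def dec : BipMod V where
  obj n := M.Sh (n + 1)
  map g h₀ _ := M.shMap g h₀
  map_id _ x := M.shMap_id x
  map_comp _ _ _ _ _ _ x := M.shMap_shMap _ _ _ (fun _ => rfl) x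

/-- The identification of the last two elements. -/
def decMap (n : ℕ) : M.dec.obj n →ₗ[V.obj (n + 1)] M.obj n where
  toFun x := M.map (n := n + 1) mergeTop mergeTop_zero mergeTop_last x
  map_add' := map_add (M.map (n := n + 1) mergeTop mergeTop_zero mergeTop_last)
  map_smul' v x := by
    refine ((M.map (n := n + 1) mergeTop mergeTop_zero mergeTop_last).map_smulₛₗ
      (V.map Fin.castSucc Fin.castSucc_zero v) x).trans ?_
    refine congrArg (· • _) ?_
    exact (V.map_map _ _ (k := id) rfl mergeTop_castSucc v).trans (V.map_id _ v)

lemma decMap_map {n m : ℕ} (g : Fin (n + 2) → Fin (m + 2)) (h₀ : g 0 = 0)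
    (hl : g (Fin.last _) = Fin.last _) (x : M.dec.obj n) :
    M.decMap m (M.dec.map g h₀ hl x) = M.map g h₀ hl (M.decMap n x) := by
  refine (M.map_map (k := fun i => g (mergeTop i)) _ _ ?_ _ _ ?_ (mergeTop_addTop hl) x).trans
    (M.map_map _ _ _ _ _ _ (fun _ => rfl) x).symm
  · rw [mergeTop_zero, h₀]
  · rw [mergeTop_last, hl]

/-- A set-theoretic section inserts a new point just before the last one. It need not be linear, as
the action of the old last point is not the action of the inserted one. -/
lemma decMap_surjective (n : ℕ) : Function.Surjective (M.decMap n) := by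
  intro x
  refine ⟨M.shMap Fin.castSucc Fin.castSucc_zero x, (M.map_map _ _ _ _ _ _ (k := id) ?_ x).trans
    (M.map_id n x)⟩
  intro i
  induction i using Fin.lastCases with
  | last => rw [addTop_last, mergeTop_last]; rfl
  | cast i => rw [addTop_castSucc, mergeTop_castSucc]; rfl

/-- The kernel of `decMap`. -/
def omega : BipMod V where
  obj n := LinearMap.ker (M.decMap n)
  map {n m} g h₀ hl :=
    { toFun := fun x => ⟨M.dec.map g h₀ hl x.1, by
        rw [LinearMap.mem_ker, decMap_map, LinearMap.mem_ker.mp x.2, map_zero]⟩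
      map_add' := fun x y => Subtype.ext (map_add (M.dec.map g h₀ hl) x.1 y.1)
      map_smul' := fun v x => Subtype.ext ((M.dec.map g h₀ hl).map_smulₛₗ v x.1) }
  map_id n x := Subtype.ext (M.dec.map_id n x.1)
  map_comp g h g₀ h₀ gl hl x := Subtype.ext (M.dec.map_comp g h g₀ h₀ gl hl x.1)

end BipMod

/-! ### Base change of simplicial modules -/

variable {V : PtRing.{u}} (F F' : PtAlg V) (M : BipMod V)

/-- The base change of `M` to `F`. -/
abbrev tens (n : ℕ) : Type u := F.obj (n + 1) ⊗[V.obj (n + 1)] M.obj n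

/-- The functoriality of the base change. -/
def tensMap {n m : ℕ} (g : Fin (n + 2) → Fin (m + 2)) (h₀ : g 0 = 0)
    (hl : g (Fin.last _) = Fin.last _) : tens F M n →+ tens F M m :=
  (TensorProduct.map (F.mapₛₗ g h₀) (M.map g h₀ hl)).toAddMonoidHom

lemma tensMap_tmul {n m : ℕ} (g : Fin (n + 2) → Fin (m + 2)) (h₀ : g 0 = 0)
    (hl : g (Fin.last _) = Fin.last _) (v : F.obj (n + 1)) (x : M.obj n) :
    tensMap F M g h₀ hl (v ⊗ₜ x) = F.map g h₀ v ⊗ₜ M.map g h₀ hl x := rfl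

lemma tensMap_tensMap {n m l : ℕ} {g : Fin (n + 2) → Fin (m + 2)} {h : Fin (m + 2) → Fin (l + 2)}
    {k : Fin (n + 2) → Fin (l + 2)} (g₀ : g 0 = 0) (h₀ : h 0 = 0) (k₀ : k 0 = 0)
    (gl : g (Fin.last _) = Fin.last _) (hl : h (Fin.last _) = Fin.last _)
    (kl : k (Fin.last _) = Fin.last _) (e : ∀ i, h (g i) = k i) (x : tens F M n) :
    tensMap F M h h₀ hl (tensMap F M g g₀ gl x) = tensMap F M k k₀ kl x := by
  induction x using TensorProduct.induction_on with
  | zero => simp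
  | add x y hx hy => simp only [map_add, hx, hy]
  | tmul v x =>
    rw [tensMap_tmul, tensMap_tmul, tensMap_tmul, M.map_map _ _ k₀ _ _ kl e, F.map_map _ _ k₀ e]

/-- The faces of the base change. -/
def tensFace (n : ℕ) (i : Fin (n + 2)) : tens F M (n + 1) →+ tens F M n :=
  tensMap F M i.predAbove (predAbove_zero' i) (predAbove_last' i)

/-- The differential of the base change. -/
def tensD (n : ℕ) : tens F M (n + 1) →+ tens F M n := altSum (tensFace F M n)

lemma tensD_tensD (n : ℕ) (x : tens F M (n + 2)) : tensD F M n (tensD F M (n + 1) x) = 0 := by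
  refine altSum_altSum (fun i j hij x => ?_) x
  have h₀ : i.predAbove (j.succ.predAbove 0) = 0 := by simp only [predAbove_zero']
  have hl : i.predAbove (j.succ.predAbove (Fin.last (n + 3))) = Fin.last (n + 1) := by
    rw [predAbove_last', predAbove_last']
  exact (tensMap_tensMap F M _ _ h₀ _ _ hl (fun _ => rfl) x).trans
    (tensMap_tensMap F M _ _ h₀ _ _ hl (fun l => (predAbove_predAbove i j hij l).symm) x).symm

/-- The base change of `M.Sh` to `F`. -/
abbrev shTens (n : ℕ) : Type u := F.obj n ⊗[V.obj n] M.Sh n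

/-- The functoriality of `shTens`. -/
def shTensMap {n m : ℕ} (g : Fin (n + 1) → Fin (m + 1)) (h₀ : g 0 = 0) :
    shTens F M n →+ shTens F M m :=
  (TensorProduct.map (F.mapₛₗ g h₀) (M.shMap g h₀)).toAddMonoidHom

lemma shTensMap_tmul {n m : ℕ} (g : Fin (n + 1) → Fin (m + 1)) (h₀ : g 0 = 0) (v : F.obj n)
    (x : M.Sh n) : shTensMap F M g h₀ (v ⊗ₜ x) = F.map g h₀ v ⊗ₜ M.shMap g h₀ x := rfl

lemma shTensMap_shTensMap {n m l : ℕ} {g : Fin (n + 1) → Fin (m + 1)}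
    {h : Fin (m + 1) → Fin (l + 1)} {k : Fin (n + 1) → Fin (l + 1)} (g₀ : g 0 = 0) (h₀ : h 0 = 0)
    (k₀ : k 0 = 0) (e : ∀ i, h (g i) = k i) (x : shTens F M n) :
    shTensMap F M h h₀ (shTensMap F M g g₀ x) = shTensMap F M k k₀ x := by
  induction x using TensorProduct.induction_on with
  | zero => simp
  | add x y hx hy => simp only [map_add, hx, hy]
  | tmul v x =>
    rw [shTensMap_tmul, shTensMap_tmul, shTensMap_tmul, M.shMap_shMap _ _ k₀ e,
      F.map_map _ _ k₀ e]

lemma shTensMap_eq_self {n : ℕ} {g : Fin (n + 1) → Fin (n + 1)} (h₀ : g 0 = 0)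
    (e : ∀ i, g i = i) (x : shTens F M n) : shTensMap F M g h₀ x = x := by
  obtain rfl : g = id := funext e
  induction x using TensorProduct.induction_on with
  | zero => simp
  | add x y hx hy => simp only [map_add, hx, hy]
  | tmul v x => rw [shTensMap_tmul, M.shMap_id, F.map_id]

/-- The differential of the base change of `M.dec`, with an augmentation in degree `0`. -/
def shTensD (n : ℕ) : shTens F M (n + 1) →+ shTens F M n :=
  altSum fun i : Fin (n + 1) => shTensMap F M i.predAbove (predAbove_zero' i)

lemma shTensD_shTensD (n : ℕ) (x : shTens F M (n + 2)) :
    shTensD F M n (shTensD F M (n + 1) x) = 0 := by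
  refine altSum_altSum (fun i j hij x => ?_) x
  have h₀ : i.predAbove (j.succ.predAbove 0) = 0 := by simp only [predAbove_zero']
  exact (shTensMap_shTensMap F M _ _ h₀ (fun _ => rfl) x).trans
    (shTensMap_shTensMap F M _ _ h₀ (fun l => (predAbove_predAbove i j hij l).symm) x).symm

/-- In `shTens` only the base point has to be preserved, so a new top point can be added along
`castSucc`. This is an extra degeneracy, and it contracts the complex up to sign. -/
lemma exists_shTensD_eq {n : ℕ} {x : shTens F M (n + 1)} (hx : shTensD F M n x = 0) :
    ∃ y, shTensD F M (n + 1) y = x := by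
  have key := altSum_extraDegeneracy
    (d := fun i : Fin (n + 1) => shTensMap F M i.predAbove (predAbove_zero' i))
    (d' := fun i : Fin (n + 2) => shTensMap F M i.predAbove (predAbove_zero' i))
    (shTensMap F M (Fin.castSucc (n := n + 2)) Fin.castSucc_zero)
    (shTensMap F M (Fin.castSucc (n := n + 1)) Fin.castSucc_zero)
    (fun x => (shTensMap_shTensMap F M _ _ (k := id) rfl predAbove_last_castSucc x).trans
      (shTensMap_eq_self F M _ (fun _ => rfl) x))
    (fun i x => by
      have h₀ : (i.predAbove (0 : Fin (n + 2))).castSucc = 0 := by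
        rw [predAbove_zero', Fin.castSucc_zero]
      exact (shTensMap_shTensMap F M _ _ h₀ (predAbove_castSucc_castSucc i) x).trans
        (shTensMap_shTensMap F M _ _ h₀ (fun _ => rfl) x).symm) x
  rw [show altSum _ x = shTensD F M n x from rfl, hx, map_zero, zero_add] at key
  refine ⟨(-1 : ℤ) ^ (n + 1) • shTensMap F M Fin.castSucc Fin.castSucc_zero x, ?_⟩
  rw [map_zsmul]
  refine (congrArg _ key).trans ?_
  rw [smul_smul, ← mul_pow]
  simp

lemma shTensD_zero_surjective : Function.Surjective (shTensD F M 0) := by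
  intro x
  refine ⟨shTensMap F M Fin.castSucc Fin.castSucc_zero x, ?_⟩
  refine (altSum_apply _ _).trans ((Fin.sum_univ_one _).trans ((one_smul ℤ _).trans ?_))
  exact (shTensMap_shTensMap F M _ _ (k := id) rfl predAbove_last_castSucc x).trans
      (shTensMap_eq_self F M _ (fun _ => rfl) x)

/-! #### The change of the algebra -/

variable {F F'}

/-- A homomorphism of algebras over a functor from pointed finite sets to rings. -/
structure PtAlgHom (F F' : PtAlg V) where
  app : ∀ n, F.obj n →ₐ[V.obj n] F'.obj n
  app_map : ∀ {n m : ℕ} (g : Fin (n + 1) → Fin (m + 1)) (hg : g 0 = 0) (x : F.obj n),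
    app m (F.map g hg x) = F'.map g hg (app n x)

variable (a : PtAlgHom F F')

/-- The map of base changes induced by a homomorphism of algebras. -/
def tensHom (n : ℕ) : tens F M n →+ tens F' M n :=
  ((a.app (n + 1)).toLinearMap.rTensor (M.obj n)).toAddMonoidHom

lemma tensHom_tmul (n : ℕ) (v : F.obj (n + 1)) (x : M.obj n) :
    tensHom M a n (v ⊗ₜ x) = a.app (n + 1) v ⊗ₜ x := rfl

lemma tensHom_tensD (n : ℕ) (x : tens F M (n + 1)) :
    tensHom M a n (tensD F M n x) = tensD F' M n (tensHom M a (n + 1) x) := by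
  refine (altSum_natural (d := tensFace F M n) (d' := tensFace F' M n) (tensHom M a (n + 1))
    (tensHom M a n) (fun i x => ?_) x).symm
  induction x using TensorProduct.induction_on with
  | zero => simp
  | add x y hx hy => simp only [map_add, hx, hy]
  | tmul v x =>
    simp only [tensFace, tensMap_tmul, tensHom_tmul, a.app_map]

variable (F) in
/-- The map of base changes induced by `M.dec → M`. -/
def tensDecMap (n : ℕ) : tens F M.dec n →+ tens F M n :=
  ((M.decMap n).lTensor (F.obj (n + 1))).toAddMonoidHom

variable (F) in
/-- The map of base changes induced by `M.omega → M.dec`. -/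
def tensOmegaMap (n : ℕ) : tens F M.omega n →+ tens F M.dec n :=
  ((LinearMap.ker (M.decMap n)).subtype.lTensor (F.obj (n + 1))).toAddMonoidHom

variable (F) in
lemma tensDecMap_surjective (n : ℕ) : Function.Surjective (tensDecMap F M n) :=
  LinearMap.lTensor_surjective _ (M.decMap_surjective n)

variable (F) in
lemma tensOmegaMap_exact (n : ℕ) : Function.Exact (tensOmegaMap F M n) (tensDecMap F M n) :=
  lTensor_exact (F.obj (n + 1)) (LinearMap.exact_subtype_ker_map _) (M.decMap_surjective n)

variable (F) in
-- Flatness enters here: it keeps `M.omega → M.dec → M` short exact after base change, as dimension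
-- shifting needs.
lemma tensOmegaMap_injective (n : ℕ) [Module.Flat (V.obj (n + 1)) (F.obj (n + 1))] :
    Function.Injective (tensOmegaMap F M n) :=
  Module.Flat.lTensor_preserves_injective_linearMap _ (Submodule.subtype_injective _)

variable (F) in
lemma tensDecMap_tensD (n : ℕ) (x : tens F M.dec (n + 1)) :
    tensDecMap F M n (tensD F M.dec n x) = tensD F M n (tensDecMap F M (n + 1) x) := by
  refine (altSum_natural (d := tensFace F M.dec n) (d' := tensFace F M n) (tensDecMap F M (n + 1))
    (tensDecMap F M n) (fun i x => ?_) x).symm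
  induction x using TensorProduct.induction_on with
  | zero => simp
  | add x y hx hy => simp only [map_add, hx, hy]
  | tmul v x => exact congrArg (_ ⊗ₜ ·) (M.decMap_map _ _ _ x).symm

variable (F) in
lemma tensOmegaMap_tensD (n : ℕ) (x : tens F M.omega (n + 1)) :
    tensOmegaMap F M n (tensD F M.omega n x) = tensD F M.dec n (tensOmegaMap F M (n + 1) x) := by
  refine (altSum_natural (d := tensFace F M.omega n) (d' := tensFace F M.dec n)
    (tensOmegaMap F M (n + 1)) (tensOmegaMap F M n) (fun i x => ?_) x).symm
  induction x using TensorProduct.induction_on with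
  | zero => simp
  | add x y hx hy => simp only [map_add, hx, hy]
  | tmul v x => rfl

lemma tensDecMap_tensHom (n : ℕ) (x : tens F M.dec n) :
    tensDecMap F' M n (tensHom M.dec a n x) = tensHom M a n (tensDecMap F M n x) := by
  induction x using TensorProduct.induction_on with
  | zero => simp
  | add x y hx hy => simp only [map_add, hx, hy]
  | tmul v x => rfl

lemma tensOmegaMap_tensHom (n : ℕ) (x : tens F M.omega n) :
    tensOmegaMap F' M n (tensHom M.omega a n x) = tensHom M.dec a n (tensOmegaMap F M n x) := by
  induction x using TensorProduct.induction_on with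
  | zero => simp
  | add x y hx hy => simp only [map_add, hx, hy]
  | tmul v x => rfl

/-- By the extra degeneracy, the base change of `M.dec` to `F` is a resolution of `F.obj 0 ⊗ M.Sh
0`, which sees only the value of `F` at the one-point set. In degree `n` the base change is `shTens
(n + 1)`, so `shTensD F M 0` is the augmentation. -/
lemma coneExactAt_dec (h₀ : Function.Bijective (a.app 0)) (n : ℕ) :
    ConeExactAt (tensD F M.dec) (tensD F' M.dec) (tensHom M.dec a) n := by
  let e : F.obj 0 ≃ₗ[V.obj 0] F'.obj 0 := LinearEquiv.ofBijective (a.app 0).toLinearMap h₀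
  refine coneExactAt_of_augmented (tensHom_tensD M.dec a) (shTensD F M 0) (shTensD F' M 0)
    (e.rTensor (M.Sh 0)).toLinearMap.toAddMonoidHom (e.rTensor (M.Sh 0)).bijective (fun x => ?_)
    (shTensD_zero_surjective F M) (fun y => shTensD_shTensD F' M 0 y)
    (fun x hx => exists_shTensD_eq F M hx) (fun n x hx => exists_shTensD_eq F M hx)
    (fun x hx => exists_shTensD_eq F' M hx) (fun n x hx => exists_shTensD_eq F' M hx) n
  refine (altSum_natural (d := fun i : Fin 1 => shTensMap F M i.predAbove (predAbove_zero' i))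
    (d' := fun i : Fin 1 => shTensMap F' M i.predAbove (predAbove_zero' i))
    ((a.app 1).toLinearMap.rTensor (M.Sh 1)).toAddMonoidHom
    (e.rTensor (M.Sh 0)).toLinearMap.toAddMonoidHom (fun i x => ?_) x).symm
  induction x using TensorProduct.induction_on with
  | zero => simp
  | add x y hx hy => simp only [map_add, hx, hy]
  | tmul v x => exact congrArg (· ⊗ₜ _) (a.app_map _ _ v).symm

/-- Base change along flat algebras with the same value at the one point set. -/
theorem coneExactAt_tensHom [∀ n, Module.Flat (V.obj n) (F.obj n)]
    [∀ n, Module.Flat (V.obj n) (F'.obj n)] (h₀ : Function.Bijective (a.app 0)) (n : ℕ) :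
    ConeExactAt (tensD F M) (tensD F' M) (tensHom M a) n := by
  -- `M` varies in the induction, since `M.omega` takes its place one degree lower.
  induction n generalizing M with
  | zero =>
    exact coneExactAt_zero_of_surjective (tensDecMap_tensD F' M) (tensDecMap_tensHom M a)
      (tensDecMap_surjective F' M) (coneExactAt_dec M a h₀ 0)
  | succ n ih =>
    exact coneExactAt_succ_of_shortExact (tensD_tensD F M.dec) (tensD_tensD F' M.dec)
      (tensHom_tensD M.dec a) (tensOmegaMap_tensD F M) (tensOmegaMap_tensD F' M)
      (tensDecMap_tensD F M) (tensDecMap_tensD F' M) (tensOmegaMap_tensHom M a)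
      (tensDecMap_tensHom M a) (fun n => tensOmegaMap_injective F M n)
      (fun n => tensOmegaMap_injective F' M n)
      (tensDecMap_surjective F M) (tensDecMap_surjective F' M) (tensOmegaMap_exact F M)
      (tensOmegaMap_exact F' M) (coneExactAt_dec M a h₀ (n + 1)) (ih M.omega)

/-! ### Elements of the algebra that act as zero on homology -/

section NullHomotopic

variable {V : PtRing.{u}} (F : PtAlg V) (M : BipMod V)

lemma tensMap_smul {n m : ℕ} (g : Fin (n + 2) → Fin (m + 2)) (h₀ : g 0 = 0)
    (hl : g (Fin.last _) = Fin.last _) (v : F.obj (n + 1)) (x : tens F M n) :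
    tensMap F M g h₀ hl (v • x) = F.map g h₀ v • tensMap F M g h₀ hl x := by
  induction x using TensorProduct.induction_on with
  | zero => simp
  | add x y hx hy => simp only [map_add, smul_add, hx, hy]
  | tmul w x => simp only [TensorProduct.smul_tmul', smul_eq_mul, tensMap_tmul, map_mul]

lemma tensD_smul {δ : ∀ n, F.obj (n + 1)}
    (hδ : ∀ n (i : Fin (n + 2)), F.map i.predAbove (predAbove_zero' i) (δ (n + 1)) = δ n) (n : ℕ)
    (x : tens F M (n + 1)) : tensD F M n (δ (n + 1) • x) = δ n • tensD F M n x := by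
  refine altSum_natural (d := tensFace F M n) (d' := tensFace F M n)
    (DistribSMul.toAddMonoidHom _ (δ (n + 1))) (DistribSMul.toAddMonoidHom _ (δ n))
    (fun i x => ?_) x
  exact (tensMap_smul ..).trans (by rw [hδ]; rfl)

/-- The action of the difference of the two faces of an element `w` on the homology of a base
change is trivial. -/
lemma exists_tensD_eq_smul [∀ n, Module.Flat (V.obj n) (F.obj n)] {δ : ∀ n, F.obj (n + 1)}
    (hδ : ∀ n (i : Fin (n + 2)), F.map i.predAbove (predAbove_zero' i) (δ (n + 1)) = δ n)
    (w : F.obj 2) (hw : δ 0 = F.map (Fin.predAbove (0 : Fin 2)) (predAbove_zero' _) w -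
      F.map (Fin.predAbove (1 : Fin 2)) (predAbove_zero' _) w) (n : ℕ) (y : tens F M n)
    (hy : IsCycle (tensD F M) n y) : ∃ z, tensD F M n z = δ n • y := by
  induction n generalizing M with
  | zero =>
    -- A point is inserted between the two points of `y`. Either face removes it again, so the
    -- `i`-th face of the witness is the `i`-th face of `w` acting on `y`.
    refine ⟨w • tensMap F M (addTop (Fin.castSucc (n := 1))) rfl rfl y, ?_⟩
    have h : ∀ (i : Fin 2), tensFace F M 0 i
        (w • tensMap F M (addTop (Fin.castSucc (n := 1))) rfl rfl y) =
        F.map i.predAbove (predAbove_zero' i) w • y := by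
      intro i
      have hid : tensMap F M (id : Fin 2 → Fin 2) rfl rfl y = y := by
        clear hy
        induction y using TensorProduct.induction_on with
        | zero => simp
        | add x y hx hy => rw [map_add, hx, hy]
        | tmul v x => rw [tensMap_tmul, F.map_id, M.map_id]
      refine (tensMap_smul ..).trans (congrArg _ ((tensMap_tensMap F M (k := id) _ _ rfl _ _ rfl
        (fun l => ?_) y).trans hid))
      fin_cases i <;> fin_cases l <;> rfl
    refine (altSum_apply _ _).trans ((Fin.sum_univ_two _).trans ?_)
    rw [h, h, hw, Fin.val_zero, pow_zero, one_smul, Fin.val_one, pow_one, neg_smul, one_smul,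
      ← sub_eq_add_neg]
    exact (sub_smul _ _ _).symm
  | succ n ih =>
    -- Dimension shifting: for a lift `x` of `y` to `M.dec`, the boundary of `x` is a cycle `v` of
    -- `M.omega`, and `δ v` bounds some `v'` by induction. Then `δ x - v'` is a cycle of the base
    -- change of `M.dec`, hence bounds, and its image in that of `M` is `δ y`.
    obtain ⟨x, rfl⟩ := tensDecMap_surjective F M _ y
    obtain ⟨v, hv⟩ := (tensOmegaMap_exact F M n (tensD F M.dec n x)).mp
      (by rw [tensDecMap_tensD]; exact hy)
    obtain ⟨v', hv'⟩ := ih M.omega v (.of_injective (fun n => tensOmegaMap_injective F M n)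
      (tensOmegaMap_tensD F M) (by rw [hv]; exact isCycle_boundary (tensD_tensD F M.dec) x))
    obtain ⟨z, hz⟩ : ∃ z, tensD F M.dec (n + 1) z =
        δ (n + 1) • x - tensOmegaMap F M (n + 1) v' := by
      refine exists_shTensD_eq F M (n := n + 1) (?_ : tensD F M.dec n _ = 0)
      have hs : tensOmegaMap F M n (δ n • v) = δ n • tensOmegaMap F M n v :=
        (TensorProduct.AlgebraTensorModule.lTensor (F.obj (n + 1)) (F.obj (n + 1))
          (LinearMap.ker (M.decMap n)).subtype).map_smul (δ n) v
      rw [map_sub, tensD_smul F M.dec hδ, ← tensOmegaMap_tensD, hv', hs, hv, sub_self]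
    refine ⟨tensDecMap F M _ z, ?_⟩
    have hs : tensDecMap F M (n + 1) (δ (n + 1) • x) = δ (n + 1) • tensDecMap F M (n + 1) x :=
      (TensorProduct.AlgebraTensorModule.lTensor (F.obj (n + 2)) (F.obj (n + 2))
        (M.decMap (n + 1))).map_smul (δ (n + 1)) x
    rw [← tensDecMap_tensD, hz, map_sub, hs, (tensOmegaMap_exact F M _ _).mpr ⟨v', rfl⟩, sub_zero]

end NullHomotopic

/-! ### Tensor powers of algebras -/

section TensorPower

variable {k L L' S : Type u} [CommRing k] [CommRing L] [CommRing L'] [CommRing S] [Algebra k L]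
  [Algebra k L'] [Algebra k S]

/-- The homomorphism from a tensor power given by homomorphisms from the factors. -/
def piTensorLift {ι : Type} [Fintype ι] (ψ : ι → L →ₐ[k] S) : (⨂[k] _ : ι, L) →ₐ[k] S :=
  PiTensorProduct.liftAlgHom
    ((MultilinearMap.mkPiAlgebra k ι S).compLinearMap fun i => (ψ i).toLinearMap)
    (by simp) (by simp [Finset.prod_mul_distrib])

lemma piTensorLift_single {ι : Type} [Fintype ι] [DecidableEq ι] (ψ : ι → L →ₐ[k] S) (i : ι)
    (x : L) : piTensorLift ψ (PiTensorProduct.singleAlgHom (R := k) (A := fun _ : ι => L) i x) =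
      ψ i x := by
  refine (PiTensorProduct.lift.tprod _).trans ?_
  rw [MultilinearMap.compLinearMap_apply, MultilinearMap.mkPiAlgebra_apply,
    Finset.prod_eq_single i]
  · simp
  · intro j _ hj
    simp [Pi.mulSingle_eq_of_ne hj]
  · simp

lemma piTensorMap_single {ι κ : Type} [Fintype ι] [DecidableEq ι] [DecidableEq κ] (g : ι → κ)
    (φ : L →ₐ[k] L') (i : ι) (x : L) :
    piTensorMap g φ (PiTensorProduct.singleAlgHom (R := k) (A := fun _ : ι => L) i x) =
      PiTensorProduct.singleAlgHom (R := k) (A := fun _ : κ => L') (g i) (φ x) :=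
  piTensorLift_single (fun i => (PiTensorProduct.singleAlgHom (R := k) (A := fun _ : κ => L')
    (g i)).comp φ) i x

variable (k L) in
/-- Splitting off the first factor of a tensor power. -/
def tensorPowerSucc (n : ℕ) :
    (L ⊗[k] (⨂[k] _ : Fin n, L)) ≃ₐ[k] (⨂[k] _ : Fin (n + 1), L) :=
  AlgEquiv.ofAlgHom
    (Algebra.TensorProduct.lift
      (PiTensorProduct.singleAlgHom (R := k) (A := fun _ : Fin (n + 1) => L) 0)
      (piTensorMap Fin.succ (AlgHom.id k L)) fun _ _ => Commute.all _ _)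
    (piTensorLift (Fin.cases Algebra.TensorProduct.includeLeft fun i =>
      (Algebra.TensorProduct.includeRight).comp
        (PiTensorProduct.singleAlgHom (R := k) (A := fun _ : Fin n => L) i)))
    (by
      refine PiTensorProduct.algHom_ext fun i => AlgHom.ext fun x => ?_
      induction i using Fin.cases with
      | zero => simp [-PiTensorProduct.singleAlgHom_apply, piTensorLift_single]
      | succ i => simp [-PiTensorProduct.singleAlgHom_apply, piTensorLift_single, piTensorMap_single])
    (by
      apply Algebra.TensorProduct.ext
      · ext x
        simp [-PiTensorProduct.singleAlgHom_apply, piTensorLift_single]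
      · refine PiTensorProduct.algHom_ext fun i => AlgHom.ext fun x => ?_
        simp [-PiTensorProduct.singleAlgHom_apply, piTensorLift_single, piTensorMap_single])

/-- Induction on the number of factors: a tensor product of flat homomorphisms is flat, and both
empty tensor powers are `k`. -/
lemma flat_piTensorMap {φ : L →ₐ[k] L'} (hφ : φ.toRingHom.Flat) (n : ℕ) :
    (piTensorMap (id : Fin n → Fin n) φ).toRingHom.Flat := by
  induction n with
  | zero =>
    have h : ∀ (K : Type u) [CommRing K] [Algebra k K],
        Function.Bijective (algebraMap k (⨂[k] _ : Fin 0, K)) := by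
      intro K _ _
      have e : ⇑(algebraMap k (⨂[k] _ : Fin 0, K)) =
          (PiTensorProduct.isEmptyEquiv (R := k) (s := fun _ : Fin 0 => K) (Fin 0)).symm := by
        funext r
        rw [Algebra.algebraMap_eq_smul_one]
        exact congrArg (fun v => r • PiTensorProduct.tprod k v) (Subsingleton.elim _ _)
      rw [e]
      exact LinearEquiv.bijective _
    refine .of_bijective ?_
    have := h L'
    rw [← (piTensorMap (id : Fin 0 → Fin 0) φ).comp_algebraMap] at this
    exact (Function.Bijective.of_comp_iff _ (h L)).mp this
  | succ n ih =>
    have e : (piTensorMap (id : Fin (n + 1) → Fin (n + 1)) φ).comp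
        (tensorPowerSucc k L n).toAlgHom = (tensorPowerSucc k L' n).toAlgHom.comp
          (Algebra.TensorProduct.map φ (piTensorMap id φ)) := by
      apply Algebra.TensorProduct.ext
      · ext x
        simp [-PiTensorProduct.singleAlgHom_apply, tensorPowerSucc, piTensorMap_single]
      · refine PiTensorProduct.algHom_ext fun i => AlgHom.ext fun x => ?_
        simp [-PiTensorProduct.singleAlgHom_apply, tensorPowerSucc, piTensorMap_single]
    have e' : piTensorMap (id : Fin (n + 1) → Fin (n + 1)) φ =
        ((tensorPowerSucc k L' n).toAlgHom.comp
          (Algebra.TensorProduct.map φ (piTensorMap id φ))).comp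
            (tensorPowerSucc k L n).symm.toAlgHom := by
      rw [← e]
      ext x
      simp
    rw [e']
    exact (RingHom.Flat.of_bijective (tensorPowerSucc k L n).symm.bijective).comp
      ((RingHom.Flat.tensorProductMap hφ ih).comp
        (.of_bijective (tensorPowerSucc k L' n).bijective))

lemma flat_barMap {φ : L →ₐ[k] L'} (hφ : φ.toRingHom.Flat) (n : ℕ) :
    (barMap (k := k) (id : Fin (n + 1) → Fin (n + 1)) φ).Flat :=
  flat_piTensorMap hφ (n + 1)

lemma place_zero_bijective : Function.Bijective (place k L 0 0) := by
  have e : ⇑(place k L 0 0) =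
      (PiTensorProduct.subsingletonEquiv (R := k) (s := fun _ : Fin 1 => L) 0).symm := by
    funext x
    refine (place_eq_pureTensor _ _).trans ?_
    exact congrArg (pureTensor k) (funext fun i => by
      obtain rfl := Subsingleton.elim (α := Fin 1) i 0
      simp)
  rw [e]
  exact LinearEquiv.bijective _

end TensorPower

/-! ### The tensor powers as functors on pointed sets -/

section BarFunctors

variable (k A B : Type u) [CommRing k] [CommRing A] [CommRing B] [Algebra k A] [Algebra A B]

/-- The tensor powers of `A`. -/
def barPt : PtRing.{u} where
  obj n := CyclicBar k A n
  map g _ := barMap g (AlgHom.id k A)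
  map_id n x := by rw [barMap_id]; rfl
  map_comp g h _ _ x := barMap_barMap g h _ _ x

variable {k A B}

/-- `barMap` for a pointed map, as a homomorphism of algebras. -/
def barMapₐ {n m : ℕ} (g : Fin (n + 1) → Fin (m + 1)) (hg : g 0 = 0) :
    CyclicBar k A n →ₐ[A] CyclicBar k A m where
  toRingHom := barMap g (AlgHom.id k A)
  commutes' a := by
    change barMap g (AlgHom.id k A) (place k A n 0 a) = place k A m 0 a
    rw [barMap_place, hg]
    rfl

/-- The functoriality of the tensor powers of `A` with the first factor extended to `B`. -/
def pointMap {n m : ℕ} (g : Fin (n + 1) → Fin (m + 1)) (hg : g 0 = 0) :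
    CyclicBar k A n ⊗[A] B →+* CyclicBar k A m ⊗[A] B :=
  (Algebra.TensorProduct.map (barMapₐ g hg) (AlgHom.id A B)).toRingHom

lemma pointMap_tmul {n m : ℕ} (g : Fin (n + 1) → Fin (m + 1)) (hg : g 0 = 0)
    (v : CyclicBar k A n) (b : B) : pointMap g hg (v ⊗ₜ[A] b) = barMap g (AlgHom.id k A) v ⊗ₜ b :=
  rfl

variable (k A B) in
/-- The tensor powers of `A` with the first factor extended to `B`. -/
def pointAlg : PtAlg (barPt k A) where
  obj n := CyclicBar k A n ⊗[A] B
  map g hg := pointMap g hg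
  map_id n x := by
    induction x using TensorProduct.induction_on with
    | zero => simp
    | add x y hx hy => simp only [map_add, hx, hy]
    | tmul v b => rw [pointMap_tmul, barMap_id, RingHom.id_apply]
  map_comp g h hg hh x := by
    induction x using TensorProduct.induction_on with
    | zero => simp
    | add x y hx hy => simp only [map_add, hx, hy]
    | tmul v b => rw [pointMap_tmul, pointMap_tmul, pointMap_tmul, barMap_barMap]; rfl
  algebra n := inferInstanceAs (Algebra (CyclicBar k A n) (CyclicBar k A n ⊗[A] B))
  map_algebraMap g hg v := rfl

lemma pointAlg_flat [Module.Flat A B] (n : ℕ) :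
    Module.Flat ((barPt k A).obj n) ((pointAlg k A B).obj n) :=
  inferInstanceAs (Module.Flat (CyclicBar k A n) (CyclicBar k A n ⊗[A] B))

variable [Algebra k B] [IsScalarTower k A B]

variable (k A B) in
/-- The tensor powers of `B` as algebras over those of `A`. -/
def barAlg : PtAlg (barPt k A) where
  toPtRing := barPt k B
  algebra n := (barMap (n := n) (m := n) id (IsScalarTower.toAlgHom k A B)).toAlgebra
  map_algebraMap g _ v := (barMap_barMap id g _ _ v).trans
    (barMap_barMap g id (AlgHom.id k A) (IsScalarTower.toAlgHom k A B) v).symm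

lemma barAlg_flat [Module.Flat A B] (n : ℕ) :
    Module.Flat ((barPt k A).obj n) ((barAlg k A B).obj n) := by
  have h : (IsScalarTower.toAlgHom k A B).toRingHom.Flat := by
    change (algebraMap A B).Flat
    rwa [RingHom.flat_algebraMap_iff]
  exact flat_barMap h n

variable (k A B) in
/-- The inclusion of the first factor. -/
def pointHomApp (n : ℕ) : CyclicBar k A n ⊗[A] B →+* CyclicBar k B n :=
  (Algebra.TensorProduct.lift
    ({ toRingHom := barMap id (IsScalarTower.toAlgHom k A B)
       commutes' := fun _ => barMap_place _ _ _ _ } : CyclicBar k A n →ₐ[A] CyclicBar k B n)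
    (IsScalarTower.toAlgHom A B (CyclicBar k B n)) fun _ _ => Commute.all _ _).toRingHom

lemma pointHomApp_tmul (n : ℕ) (v : CyclicBar k A n) (b : B) :
    pointHomApp k A B n (v ⊗ₜ b) =
      barMap id (IsScalarTower.toAlgHom k A B) v * place k B n 0 b := rfl

lemma pointHomApp_tmul_one (n : ℕ) (v : CyclicBar k A n) :
    pointHomApp k A B n (v ⊗ₜ 1) = barMap id (IsScalarTower.toAlgHom k A B) v := by
  rw [pointHomApp_tmul, map_one, mul_one]

lemma pointHomApp_pointMap {n m : ℕ} (g : Fin (n + 1) → Fin (m + 1)) (hg : g 0 = 0)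
    (x : CyclicBar k A n ⊗[A] B) :
    pointHomApp k A B m (pointMap g hg x) = barMap g (AlgHom.id k B) (pointHomApp k A B n x) := by
  induction x using TensorProduct.induction_on with
  | zero => simp
  | add x y hx hy => simp only [map_add, hx, hy]
  | tmul v b =>
    rw [pointMap_tmul, pointHomApp_tmul, pointHomApp_tmul, map_mul, barMap_place, hg,
      barMap_barMap, barMap_barMap]
    rfl

variable (k A B) in
/-- The inclusion of the first factor, as a homomorphism of algebras. -/
def pointHom : PtAlgHom (pointAlg k A B) (barAlg k A B) where
  app n :=
    { toRingHom := pointHomApp k A B n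
      commutes' := pointHomApp_tmul_one n }
  app_map g hg x := pointHomApp_pointMap g hg x

/-- At the one-point set both algebras are `B`, which is the condition under which
`coneExactAt_tensHom` compares them. -/
lemma pointHom_app_zero_bijective : Function.Bijective ((pointHom k A B).app 0) := by
  have hs : Function.Surjective fun b : B => (1 : CyclicBar k A 0) ⊗ₜ[A] b := by
    intro x
    induction x using TensorProduct.induction_on with
    | zero => exact ⟨0, TensorProduct.tmul_zero _ _⟩
    | add x y hx hy =>
      obtain ⟨b, rfl⟩ := hx
      obtain ⟨c, rfl⟩ := hy
      exact ⟨b + c, TensorProduct.tmul_add _ _ _⟩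
    | tmul v b =>
      obtain ⟨a, rfl⟩ := (place_zero_bijective (k := k) (L := A)).2 v
      refine ⟨a • b, ?_⟩
      dsimp only
      rw [← TensorProduct.smul_tmul, Algebra.smul_def, mul_one]
      rfl
  have hb : Function.Bijective fun b : B => (pointHom k A B).app 0 ((1 : CyclicBar k A 0) ⊗ₜ b) := by
    have : (fun b : B => (pointHom k A B).app 0 ((1 : CyclicBar k A 0) ⊗ₜ b)) = place k B 0 0 := by
      funext b
      refine (pointHomApp_tmul 0 _ b).trans ?_
      rw [map_one, one_mul]
    rw [this]
    exact place_zero_bijective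
  refine ⟨fun x y hxy => ?_, fun z => ?_⟩
  · obtain ⟨b, rfl⟩ := hs x
    obtain ⟨c, rfl⟩ := hs y
    rw [hb.1 hxy]
  · obtain ⟨b, hb⟩ := hb.2 z
    exact ⟨_, hb⟩

end BarFunctors

/-! ### `P̲HH` as a simplicial module over the tensor powers -/

section PHHModule

/-- The identification of the last point with the base point. -/
def wrap {n : ℕ} : Fin (n + 2) → Fin (n + 1) := Fin.lastCases 0 id

@[simp] lemma wrap_last {n : ℕ} : wrap (Fin.last (n + 1)) = 0 := by simp [wrap]

@[simp] lemma wrap_castSucc {n : ℕ} (i : Fin (n + 1)) : wrap i.castSucc = i := by simp [wrap]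

lemma wrap_zero {n : ℕ} : wrap (0 : Fin (n + 2)) = 0 := by
  rw [← Fin.castSucc_zero, wrap_castSucc]

/-- The map of circles induced by a map of intervals. -/
def circ {n m : ℕ} (g : Fin (n + 2) → Fin (m + 2)) (i : Fin (n + 1)) : Fin (m + 1) :=
  wrap (g i.castSucc)

lemma circ_zero {n m : ℕ} {g : Fin (n + 2) → Fin (m + 2)} (h₀ : g 0 = 0) : circ g 0 = 0 := by
  rw [circ, Fin.castSucc_zero, h₀, wrap_zero]

lemma circ_wrap {n m : ℕ} {g : Fin (n + 2) → Fin (m + 2)} (h₀ : g 0 = 0)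
    (hl : g (Fin.last _) = Fin.last _) (i : Fin (n + 2)) : circ g (wrap i) = wrap (g i) := by
  induction i using Fin.lastCases with
  | last => rw [wrap_last, circ_zero h₀, hl, wrap_last]
  | cast i => rw [wrap_castSucc, circ]

variable {k A : Type u} [CommRing k] [CommRing A] [Algebra k A] {f : A}

lemma barMap_circ_wrap {n m : ℕ} {g : Fin (n + 2) → Fin (m + 2)} (h₀ : g 0 = 0)
    (hl : g (Fin.last _) = Fin.last _) (v : CyclicBar k A (n + 1)) :
    barMap (circ g) (AlgHom.id k A) (barMap wrap (AlgHom.id k A) v) =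
      barMap wrap (AlgHom.id k A) (barMap g (AlgHom.id k A) v) := by
  rw [barMap_barMap, barMap_barMap]
  exact congrArg (fun h => barMap h _ v) (funext fun i => circ_wrap h₀ hl i)

lemma place_mem_PHHRing (n : ℕ) (i : Fin (n + 1)) (a : A) :
    place k (Localization.Away f) n i (algebraMap A _ a) ∈ PHHRing k f n := by
  refine AddSubmonoid.subset_closure ⟨Pi.mulSingle i a, 1, by simp, ?_⟩
  rw [place_eq_pureTensor]
  congr 1
  ext j
  by_cases h : j = i
  · subst h; simp
  · simp [Pi.mulSingle_eq_of_ne h]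

/-- Every element of a tensor power is obtained from the elements of the factors. -/
lemma bar_subring_eq_top {L : Type u} [CommRing L] [Algebra k L] {n : ℕ}
    {S : Subring (CyclicBar k L n)} (h : ∀ i a, place k L n i a ∈ S) (x : CyclicBar k L n) :
    x ∈ S := by
  have hp : ∀ x : Fin (n + 1) → L, pureTensor k x ∈ S := fun x => by
    rw [pureTensor_eq_prod]
    exact Subring.prod_mem _ fun i _ => h i _
  refine PiTensorProduct.induction_on (motive := fun x : CyclicBar k L n => x ∈ S) x ?_ ?_
  · intro r x
    have e : (r • PiTensorProduct.tprod k x : ⨂[k] _ : Fin (n + 1), L) =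
        (place k L n 0 (algebraMap k L r) * pureTensor k x : CyclicBar k L n) := by
      rw [Algebra.smul_def]
      congr 1
      exact ((PiTensorProduct.singleAlgHom (R := k) (A := fun _ : Fin (n + 1) => L)
        0).commutes r).symm
    exact (congrArg (· ∈ S) e).mpr (S.mul_mem (h _ _) (hp _))
  · intro x y hx hy
    exact S.add_mem hx hy

variable (k f) in
/-- The homomorphism from the tensor powers of `A` to `P̲HH(A, f)`. -/
def barToPHH (n : ℕ) : CyclicBar k A n →+* PHHRing k f n :=
  (barMap id (IsScalarTower.toAlgHom k A (Localization.Away f))).codRestrict (PHHRing k f n)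
    fun x => bar_subring_eq_top (S := (PHHRing k f n).toSubring.comap
      (barMap id (IsScalarTower.toAlgHom k A (Localization.Away f))))
      (fun i a => by
        rw [Subring.mem_comap, barMap_place]
        exact place_mem_PHHRing n i a) x

lemma barToPHH_barMap {n m : ℕ} (g : Fin (n + 1) → Fin (m + 1)) (hg : g 0 = 0)
    (x : CyclicBar k A n) : PHHMap g hg (AlgHom.id k (Localization.Away f)) (fun _ => rfl)
      (barToPHH k f n x) = barToPHH k f m (barMap g (AlgHom.id k A) x) :=
  Subtype.ext ((barMap_barMap id g _ _ x).trans
    (barMap_barMap g id (AlgHom.id k A) (IsScalarTower.toAlgHom k A (Localization.Away f)) x).symm)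

/-- The circle is an interval with its ends glued: of the `n + 2` points of the interval, the last
acts at the place `0`. -/
instance (n : ℕ) : Module ((barPt k A).obj (n + 1)) (PHHRing k f n) :=
  ((barToPHH k f n).comp (barMap wrap (AlgHom.id k A))).toAlgebra.toModule

variable (k f) in
/-- `P̲HH(A, f)` as a functor on bipointed sets. -/
def phhMod : BipMod (barPt k A) where
  obj n := PHHRing k f n
  map {n m} g h₀ hl :=
    { toFun := PHHMap (circ g) (circ_zero h₀) (AlgHom.id k (Localization.Away f)) fun _ => rfl
      map_add' := map_add _
      map_smul' := fun v x => by
        change PHHMap _ _ _ _ (barToPHH k f n (barMap wrap (AlgHom.id k A) v) * x) =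
          barToPHH k f m (barMap wrap (AlgHom.id k A) (barMap g (AlgHom.id k A) v)) *
            PHHMap _ _ _ _ x
        rw [map_mul, barToPHH_barMap]
        exact congrArg (fun w => barToPHH k f m w * _) (barMap_circ_wrap h₀ hl v) }
  map_id n x := Subtype.ext <| by
    change barMap (circ id) (AlgHom.id k _) x.1 = x.1
    rw [show circ (id : Fin (n + 2) → _) = id from funext wrap_castSucc, barMap_id]
    rfl
  map_comp g h g₀ h₀ gl hl x := Subtype.ext <| by
    change barMap (circ h) (AlgHom.id k _) (barMap (circ g) (AlgHom.id k _) x.1) =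
      barMap (circ (h ∘ g)) (AlgHom.id k _) x.1
    rw [barMap_barMap, AlgHom.id_comp]
    congr 2
    exact funext fun i => circ_wrap h₀ hl _

lemma phhMod_smul (n : ℕ) (v : (barPt k A).obj (n + 1)) (x : PHHRing k f n) :
    v • x = barToPHH k f n (barMap wrap (AlgHom.id k A) v) * x := rfl

end PHHModule

/-! ### Tensor products of rings and modules mapping to a ring -/

section MulTens

variable {R S U : Type u} {N : Type u} [CommRing R] [CommRing S] [CommRing U] [Algebra R S]
  [AddCommGroup N] [Module R N]

/-- The homomorphism `s ⊗ x ↦ i s * j x`. -/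
def mulTens (i : S →+* U) (j : N →+ U) (h : ∀ r x, j (r • x) = i (algebraMap R S r) * j x) :
    S ⊗[R] N →+ U :=
  TensorProduct.liftAddHom
    { toFun := fun s => (AddMonoidHom.mulLeft (i s)).comp j
      map_zero' := by ext; simp
      map_add' := fun s t => by ext; simp [add_mul] }
    fun r s x => by simp [h, Algebra.smul_def]; ring

lemma mulTens_tmul (i : S →+* U) (j : N →+ U)
    (h : ∀ r x, j (r • x) = i (algebraMap R S r) * j x) (s : S) (x : N) :
    mulTens i j h (s ⊗ₜ x) = i s * j x := rfl

lemma mulTens_smul (i : S →+* U) (j : N →+ U)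
    (h : ∀ r x, j (r • x) = i (algebraMap R S r) * j x) (s : S) (y : S ⊗[R] N) :
    mulTens i j h (s • y) = i s * mulTens i j h y := by
  induction y using TensorProduct.induction_on with
  | zero => simp
  | add x y hx hy => simp only [map_add, smul_add, mul_add, hx, hy]
  | tmul t x => rw [TensorProduct.smul_tmul', mulTens_tmul, mulTens_tmul, smul_eq_mul, map_mul,
      mul_assoc]

/-- If `U` is the pushout of `S` and `T` and `S` is flat, then `S ⊗ N` embeds into `U` for every
submodule `N` of `T`. -/
lemma mulTens_injective {T : Type u} [CommRing T] [Algebra R T] [Module.Flat R S] (i : S →+* U)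
    (j : T →+* U) (l : N →ₗ[R] T) (hl : Function.Injective l)
    (h : ∀ r x, j.toAddMonoidHom.comp l.toAddMonoidHom (r • x) =
      i (algebraMap R S r) * j.toAddMonoidHom.comp l.toAddMonoidHom x)
    (H : U →+* S ⊗[R] T) (hi : ∀ s, H (i s) = s ⊗ₜ 1) (hj : ∀ t, H (j t) = 1 ⊗ₜ t) :
    Function.Injective (mulTens i (j.toAddMonoidHom.comp l.toAddMonoidHom) h) := by
  -- Only the map `H` towards the pushout is needed: composing with it gives `l.lTensor S`, which is
  -- injective by flatness.
  have key : ∀ y, H (mulTens i (j.toAddMonoidHom.comp l.toAddMonoidHom) h y) = l.lTensor S y := by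
    intro y
    induction y using TensorProduct.induction_on with
    | zero => simp
    | add x y hx hy => simp only [map_add, hx, hy]
    | tmul s x =>
      rw [mulTens_tmul, map_mul, hi]
      change s ⊗ₜ 1 * H (j (l x)) = s ⊗ₜ l x
      rw [hj, Algebra.TensorProduct.tmul_mul_tmul, mul_one, one_mul]
  intro x y hxy
  refine Module.Flat.lTensor_preserves_injective_linearMap (M := S) l hl ?_
  rw [← key, ← key, hxy]

/-- `(R ⊗ B) ⊗ N = B ⊗ N` for an `R`-module `N`. -/
def cancelEquiv (A R B N : Type u) [CommRing A] [CommRing R] [CommRing B] [Algebra A R]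
    [Algebra A B] [AddCommGroup N] [Module A N] [Module R N] [IsScalarTower A R N] :
    (R ⊗[A] B) ⊗[R] N ≃+ B ⊗[A] N :=
  ((TensorProduct.comm R (R ⊗[A] B) N).toAddEquiv.trans
    (TensorProduct.AlgebraTensorModule.cancelBaseChange A R R N B).toAddEquiv).trans
      (TensorProduct.comm A N B).toAddEquiv

lemma cancelEquiv_tmul {A R B N : Type u} [CommRing A] [CommRing R] [CommRing B] [Algebra A R]
    [Algebra A B] [AddCommGroup N] [Module A N] [Module R N] [IsScalarTower A R N] (r : R) (b : B)
    (x : N) : cancelEquiv A R B N ((r ⊗ₜ b) ⊗ₜ x) = b ⊗ₜ (r • x) := by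
  simp [cancelEquiv]

lemma cancelEquiv_symm_tmul {A R B N : Type u} [CommRing A] [CommRing R] [CommRing B] [Algebra A R]
    [Algebra A B] [AddCommGroup N] [Module A N] [Module R N] [IsScalarTower A R N] (b : B)
    (x : N) : (cancelEquiv A R B N).symm (b ⊗ₜ x) = (1 ⊗ₜ b) ⊗ₜ x := by
  rw [AddEquiv.symm_apply_eq, cancelEquiv_tmul, one_smul]

lemma algebraMap_tmul_one (R S T : Type u) [CommRing R] [CommRing S] [CommRing T] [Algebra R S]
    [Algebra R T] (r : R) : algebraMap R S r ⊗ₜ[R] (1 : T) = (1 : S) ⊗ₜ[R] algebraMap R T r := by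
  rw [Algebra.algebraMap_eq_smul_one, Algebra.algebraMap_eq_smul_one, TensorProduct.smul_tmul]

end MulTens

lemma ConeExactAt.congr_source {C D C₁ : ℕ → Type*} [∀ n, AddCommGroup (C n)]
    [∀ n, AddCommGroup (D n)] [∀ n, AddCommGroup (C₁ n)] {dC : ∀ n, C (n + 1) →+ C n}
    {dD : ∀ n, D (n + 1) →+ D n} {φ : ∀ n, C n →+ D n} {dC₁ : ∀ n, C₁ (n + 1) →+ C₁ n}
    {φ₁ : ∀ n, C₁ n →+ D n} (e : ∀ n, C₁ n ≃+ C n)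
    (he : ∀ n x, e n (dC₁ n x) = dC n (e (n + 1) x)) (hφ : ∀ n x, φ n (e n x) = φ₁ n x) {n : ℕ}
    (h : ConeExactAt dC dD φ n) : ConeExactAt dC₁ dD φ₁ n := by
  cases n with
  | zero =>
    intro y
    obtain ⟨x', y', rfl⟩ := h y
    exact ⟨(e 0).symm x', y', by rw [← hφ, AddEquiv.apply_symm_apply]⟩
  | succ n =>
    intro x y hx hxy
    obtain ⟨x', y', hx', rfl⟩ := h (e n x) y (hx.map (i := fun n => (e n).toAddMonoidHom) he)
      (by rw [hφ, hxy])
    refine ⟨(e _).symm x', y', (e n).injective ?_, ?_⟩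
    · rw [he, AddEquiv.apply_symm_apply, hx']
    · rw [← hφ, AddEquiv.apply_symm_apply]

/-! ### Étale base change in the tensor powers -/

section Etale

variable {k A B E : Type u} [CommRing k] [CommRing A] [CommRing B] [CommRing E] [Algebra k A]
  [Algebra k B] [Algebra A B] [IsScalarTower k A B] [Algebra k E] [Algebra B E]
  [IsScalarTower k B E] {f : A} (φ : Localization.Away f →ₐ[k] E)
  (hφ : ∀ a, φ (algebraMap A _ a) = algebraMap B E (algebraMap A B a))

/-- The action of the `n + 1` factors at their own places, in contrast to that of `n + 2` factors
through `wrap`. -/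
instance (n : ℕ) : Module ((barPt k A).obj n) (PHHRing k f n) :=
  (barToPHH k f n).toAlgebra.toModule

lemma barMap_barToPHH (n : ℕ) (v : CyclicBar k A n) :
    barMap id φ (barToPHH k f n v : CyclicBar k _ n) =
      barMap id (φ.comp (IsScalarTower.toAlgHom k A _)) v := barMap_barMap id id _ _ v

/-- The map `P̲HH(A, f) → E^{⊗ n+1}`. -/
def phhTo (n : ℕ) : PHHRing k f n →+ CyclicBar k E n :=
  (barMap id φ).toAddMonoidHom.comp (PHHRing k f n).subtype.toAddMonoidHom

lemma phhTo_apply (n : ℕ) (x : PHHRing k f n) : phhTo φ n x = barMap id φ x.1 := rfl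

lemma phhTo_barToPHH_mul (hφ : ∀ a, φ (algebraMap A _ a) = algebraMap B E (algebraMap A B a))
    (n : ℕ) (v : CyclicBar k A n) (x : PHHRing k f n) :
    phhTo φ n (barToPHH k f n v * x) = barMap id (IsScalarTower.toAlgHom k B E)
      (barMap id (IsScalarTower.toAlgHom k A B) v) * phhTo φ n x := by
  have h : φ.comp (IsScalarTower.toAlgHom k A (Localization.Away f)) =
      (IsScalarTower.toAlgHom k B E).comp (IsScalarTower.toAlgHom k A B) := AlgHom.ext hφ
  rw [barMap_barMap, ← h]
  refine (map_mul (barMap id φ) _ _).trans ?_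
  rw [barMap_barToPHH]
  rfl

/-- The map from `B^{⊗ n+2} ⊗ P̲HH(A, f)` to `E^{⊗ n+1}` which multiplies the last factor into the
first. -/
def wrapTens (hφ : ∀ a, φ (algebraMap A _ a) = algebraMap B E (algebraMap A B a)) (n : ℕ) :
    tens (barAlg k A B) (phhMod k f) n →+ CyclicBar k E n :=
  mulTens (S := (barAlg k A B).obj (n + 1)) (N := (phhMod k f).obj n)
    (barMap wrap (IsScalarTower.toAlgHom k B E)) (phhTo φ n)
    fun v x => (phhTo_barToPHH_mul φ hφ n _ x).trans (congrArg (· * phhTo φ n x) (by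
      refine (congrArg _ (barMap_barMap wrap id _ _ v)).trans ?_
      exact (barMap_barMap (n := n + 1) wrap id (IsScalarTower.toAlgHom k A B) _ v).trans
        (barMap_barMap (n := n + 1) id wrap (IsScalarTower.toAlgHom k A B) _ v).symm))

lemma wrapTens_tmul (hφ : ∀ a, φ (algebraMap A _ a) = algebraMap B E (algebraMap A B a)) (n : ℕ)
    (v : (barAlg k A B).obj (n + 1)) (x : (phhMod k f).obj n) :
    wrapTens φ hφ n (v ⊗ₜ x) = barMap wrap (IsScalarTower.toAlgHom k B E) v * phhTo φ n x := rfl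

lemma wrapTens_smul (hφ : ∀ a, φ (algebraMap A _ a) = algebraMap B E (algebraMap A B a)) (n : ℕ)
    (v : (barAlg k A B).obj (n + 1)) (y : tens (barAlg k A B) (phhMod k f) n) :
    wrapTens φ hφ n (v • y) =
      barMap wrap (IsScalarTower.toAlgHom k B E) v * wrapTens φ hφ n y := mulTens_smul _ _ _ _ _

lemma wrapTens_tensMap (hφ : ∀ a, φ (algebraMap A _ a) = algebraMap B E (algebraMap A B a))
    {n m : ℕ} (g : Fin (n + 2) → Fin (m + 2)) (h₀ : g 0 = 0) (hl : g (Fin.last _) = Fin.last _)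
    (y : tens (barAlg k A B) (phhMod k f) n) :
    wrapTens φ hφ m (tensMap (barAlg k A B) (phhMod k f) g h₀ hl y) =
      barMap (circ g) (AlgHom.id k E) (wrapTens φ hφ n y) := by
  induction y using TensorProduct.induction_on with
  | zero => simp
  | add x y hx hy => simp only [map_add, hx, hy]
  | tmul v x =>
    rw [tensMap_tmul, wrapTens_tmul, wrapTens_tmul, map_mul]
    refine congrArg₂ (· * ·) ?_ ?_
    · refine (barMap_barMap (n := n + 1) g wrap (AlgHom.id k B) _ v).trans ?_
      refine Eq.trans ?_ (barMap_barMap (n := n + 1) wrap (circ g) _ _ v).symm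
      exact congrArg (fun h => barMap (n := n + 1) h (IsScalarTower.toAlgHom k B E) v)
        (funext fun i => (circ_wrap h₀ hl i).symm)
    · exact (barMap_barMap (circ g) id (AlgHom.id k _) φ x.1).trans
        (barMap_barMap id (circ g) φ (AlgHom.id k E) x.1).symm

/-- The map from `B^{⊗ n+1} ⊗ P̲HH(A, f)` to `E^{⊗ n+1}`. -/
def idTens (hφ : ∀ a, φ (algebraMap A _ a) = algebraMap B E (algebraMap A B a)) (n : ℕ) :
    (barAlg k A B).obj n ⊗[(barPt k A).obj n] PHHRing k f n →+ CyclicBar k E n :=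
  mulTens (S := (barAlg k A B).obj n) (barMap id (IsScalarTower.toAlgHom k B E)) (phhTo φ n)
    fun v x => phhTo_barToPHH_mul φ hφ n v x

/-- The pushout of `B^{⊗ n+1}` and `A[1/f]^{⊗ n+1}` receives a map from `B[1/f]^{⊗ n+1}`. -/
lemma exists_pushout_section (hφ : ∀ a, φ (algebraMap A _ a) = algebraMap B E (algebraMap A B a))
    [IsLocalization.Away (algebraMap A B f) E] (n : ℕ) {T : Type u} [CommRing T]
    (i : CyclicBar k B n →+* T) (j : CyclicBar k (Localization.Away f) n →+* T)
    (hij : ∀ v : CyclicBar k A n, i (barMap id (IsScalarTower.toAlgHom k A B) v) =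
      j (barMap id (IsScalarTower.toAlgHom k A (Localization.Away f)) v)) :
    ∃ H : CyclicBar k E n →+* T, (∀ v, H (barMap id (IsScalarTower.toAlgHom k B E) v) = i v) ∧
      ∀ v, H (barMap id φ v) = j v := by
  let : Algebra k T := (i.comp (algebraMap k (CyclicBar k B n))).toAlgebra
  have hk : ∀ (l : Fin (n + 1)) (r : k), i (place k B n l (algebraMap k B r)) = algebraMap k T r := by
    intro l r
    have : ∀ l, place k B n l (algebraMap k B r) = algebraMap k (⨂[k] _ : Fin (n + 1), B) r :=
      fun l => (PiTensorProduct.singleAlgHom (R := k) (A := fun _ : Fin (n + 1) => B) l).commutes r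
    change _ = i (place k B n 0 (algebraMap k B r))
    rw [this, this]
  let ψ₀ : Fin (n + 1) → B →ₐ[k] T := fun l =>
    { toRingHom := i.comp (place k B n l)
      commutes' := hk l }
  -- By `hij`, the element `f` at a place of `B^{⊗ n+1}` becomes in `T` the image of `f` at that
  -- place of `A[1/f]^{⊗ n+1}`, where it is invertible.
  have hu : ∀ l (y : Submonoid.powers (algebraMap A B f)), IsUnit (ψ₀ l y) := by
    rintro l ⟨_, r, rfl⟩
    change IsUnit (i (place k B n l (algebraMap A B f ^ r)))
    rw [map_pow, map_pow]
    refine IsUnit.pow _ ?_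
    have h1 : place k B n l (algebraMap A B f) =
        barMap id (IsScalarTower.toAlgHom k A B) (place k A n l f) :=
      (barMap_place id (IsScalarTower.toAlgHom k A B) l f).symm
    rw [h1, hij, barMap_place]
    exact ((IsLocalization.Away.algebraMap_isUnit f).map (place k _ n l)).map j
  let ψ : Fin (n + 1) → E →ₐ[k] T := fun l =>
    IsLocalization.liftAlgHom (M := Submonoid.powers (algebraMap A B f)) (f := ψ₀ l) (hu l)
  have hψ : ∀ l b, ψ l (algebraMap B E b) = i (place k B n l b) := fun l b =>
    IsLocalization.lift_eq (M := Submonoid.powers (algebraMap A B f)) (g := (ψ₀ l : B →+* T))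
      (hu l) b
  let H : CyclicBar k E n →+* T := (piTensorLift ψ).toRingHom
  have hH : ∀ l x, H (place k E n l x) = ψ l x := piTensorLift_single ψ
  refine ⟨H, fun v => ?_, fun v => ?_⟩
  · have : H.comp (barMap id (IsScalarTower.toAlgHom k B E)) = i :=
      bar_ringHom_ext fun l b => by
        rw [RingHom.comp_apply, barMap_place, hH]
        exact hψ l b
    exact congr($this v)
  · have : H.comp (barMap id φ) = j := by
      refine bar_ringHom_ext fun l x => ?_
      have : (H.comp (barMap id φ)).comp (place k _ n l) = j.comp (place k _ n l) := by
        refine IsLocalization.ringHom_ext (Submonoid.powers f) (RingHom.ext fun a => ?_)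
        simp only [RingHom.comp_apply]
        rw [barMap_place, hH, hφ, hψ]
        have h1 : place k B n l (algebraMap A B a) =
          barMap id (IsScalarTower.toAlgHom k A B) (place k A n l a) :=
            (barMap_place id (IsScalarTower.toAlgHom k A B) l a).symm
        refine (congrArg i h1).trans ?_
        rw [hij, barMap_place]
        rfl
      exact congr($this x)
    exact congr($this v)

/-- `B^{⊗ n+1}` is flat over `A^{⊗ n+1}`, so tensoring keeps the inclusion of `P̲HH(A, f)` into
`A[1/f]^{⊗ n+1}` injective, and `E^{⊗ n+1}` maps to the resulting pushout. -/
lemma idTens_injective (hφ : ∀ a, φ (algebraMap A _ a) = algebraMap B E (algebraMap A B a))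
    [IsLocalization.Away (algebraMap A B f) E] [Module.Flat A B] (n : ℕ) :
    Function.Injective (idTens φ hφ n) := by
  let : Algebra ((barPt k A).obj n) (CyclicBar k (Localization.Away f) n) :=
    (barMap id (IsScalarTower.toAlgHom k A (Localization.Away f))).toAlgebra
  have := barAlg_flat (k := k) (A := A) (B := B) n
  let l : PHHRing k f n →ₗ[(barPt k A).obj n] CyclicBar k (Localization.Away f) n :=
    { toFun := fun x => x.1
      map_add' := fun _ _ => rfl
      map_smul' := fun _ _ => rfl }
  obtain ⟨H, hi, hj⟩ := exists_pushout_section φ hφ n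
    (T := (barAlg k A B).obj n ⊗[(barPt k A).obj n] CyclicBar k (Localization.Away f) n)
    (Algebra.TensorProduct.includeLeftRingHom (R := (barPt k A).obj n)
      (A := (barAlg k A B).obj n))
    (Algebra.TensorProduct.includeRight (R := (barPt k A).obj n)
      (A := (barAlg k A B).obj n)).toRingHom
    (algebraMap_tmul_one ((barPt k A).obj n) ((barAlg k A B).obj n)
      (CyclicBar k (Localization.Away f) n))
  exact mulTens_injective (S := (barAlg k A B).obj n) (barMap id (IsScalarTower.toAlgHom k B E))
    (barMap id φ) l Subtype.val_injective _ H hi hj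

end Etale

/-! ### The diagonal idempotent and the kernel of `wrapTens` -/

section Etale

variable {k A B E : Type u} [CommRing k] [CommRing A] [CommRing B] [CommRing E] [Algebra k A]
  [Algebra k B] [Algebra A B] [IsScalarTower k A B] [Algebra k E] [Algebra B E]
  [IsScalarTower k B E] {f : A}

variable (k) in
/-- The element `∑ bᵢ ⊗ 1 ⊗ ⋯ ⊗ 1 ⊗ cᵢ`. -/
def endsSum (T : Finset (B × B)) (n : ℕ) : CyclicBar k B (n + 1) :=
  ∑ i ∈ T, place k B (n + 1) 0 i.1 * place k B (n + 1) (Fin.last _) i.2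

lemma barMap_endsSum (T : Finset (B × B)) {n m : ℕ} (g : Fin (n + 2) → Fin (m + 2)) (h₀ : g 0 = 0)
    (hl : g (Fin.last _) = Fin.last _) :
    barMap g (AlgHom.id k B) (endsSum k T n) = endsSum k T m := by
  rw [endsSum, map_sum]
  refine Finset.sum_congr rfl fun i _ => ?_
  rw [map_mul, barMap_place, barMap_place, h₀, hl]
  rfl

lemma barMap_wrap_endsSum (T : Finset (B × B)) (hT : ∑ i ∈ T, i.1 * i.2 = 1) (n : ℕ) :
    barMap wrap (IsScalarTower.toAlgHom k B E) (endsSum k T n) = 1 := by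
  rw [endsSum, map_sum]
  have : ∀ i ∈ T, barMap wrap (IsScalarTower.toAlgHom k B E)
      (place k B (n + 1) 0 i.1 * place k B (n + 1) (Fin.last _) i.2) =
      place k E n 0 (algebraMap B E (i.1 * i.2)) := fun i _ => by
    rw [map_mul, barMap_place, barMap_place, wrap_zero, wrap_last, ← map_mul, ← map_mul]
    rfl
  rw [Finset.sum_congr rfl this, ← map_sum, ← map_sum, hT, map_one, map_one]

variable (k A B f) in
/-- The action of `B^{⊗ n+2}` on the base change of `P̲HH`. -/
def tensAct (n : ℕ) :
    CyclicBar k B (n + 1) →+* AddMonoid.End (tens (barAlg k A B) (phhMod k f) n) :=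
  Module.toAddMonoidEnd ((barAlg k A B).obj (n + 1)) (tens (barAlg k A B) (phhMod k f) n)

lemma tensAct_tmul (n : ℕ) (v : CyclicBar k B (n + 1)) (s : (barAlg k A B).obj (n + 1))
    (x : (phhMod k f).obj n) : tensAct k A B f n v (s ⊗ₜ x) =
      (show (barAlg k A B).obj (n + 1) from
        (v * (show CyclicBar k B (n + 1) from s) : CyclicBar k B (n + 1))) ⊗ₜ x := rfl

/-- The difference comes from `A^{⊗ n+2}`, where `wrap` kills it; so it acts as zero on `P̲HH(A,
f)`. Hence the actions of `B` at the two ends combine to an action of `B ⊗_A B`. -/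
lemma place_last_sub_mem_ker_tensAct (n : ℕ) (a : A) :
    place k B (n + 1) (Fin.last _) (algebraMap A B a) - place k B (n + 1) 0 (algebraMap A B a) ∈
      RingHom.ker (tensAct k A B f n) := by
  rw [RingHom.mem_ker]
  ext y
  have h : ∀ v : (barPt k A).obj (n + 1), barMap wrap (AlgHom.id k A) v = 0 →
      algebraMap ((barPt k A).obj (n + 1)) ((barAlg k A B).obj (n + 1)) v • y = 0 := by
    intro v hv
    rw [algebraMap_smul]
    induction y using TensorProduct.induction_on with
    | zero => simp
    | add x y hx hy => rw [smul_add, hx, hy, add_zero]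
    | tmul s x =>
      have : v • x = 0 := (phhMod_smul n v x).trans (by
        rw [hv, map_zero]
        exact zero_mul (show PHHRing k f n from x))
      rw [← TensorProduct.tmul_smul, this, TensorProduct.tmul_zero]
  have h1 := h (place k A (n + 1) (Fin.last _) a - place k A (n + 1) 0 a :
    CyclicBar k A (n + 1)) (by
      rw [map_sub, barMap_place, barMap_place, wrap_last, wrap_zero, sub_self])
  have h2 : barMap id (IsScalarTower.toAlgHom k A B)
      (place k A (n + 1) (Fin.last _) a - place k A (n + 1) 0 a) =
      place k B (n + 1) (Fin.last _) (algebraMap A B a) -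
        place k B (n + 1) 0 (algebraMap A B a) := by
    rw [map_sub, barMap_place, barMap_place]
    rfl
  rw [← h2]
  exact h1

/-- The element of `B^{⊗ n+2}` given by the diagonal idempotent of `B ⊗ B` identifies the actions of
the first and the last factor. -/
lemma place_last_sub_mul_endsSum_mem [Algebra.FormallyUnramified A B] [Algebra.EssFiniteType A B]
    {T : Finset (B × B)} (hT : Algebra.FormallyUnramified.elem A B = ∑ i ∈ T, i.1 ⊗ₜ i.2) (n : ℕ)
    (b : B) : (place k B (n + 1) (Fin.last _) b - place k B (n + 1) 0 b) * endsSum k T n ∈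
      RingHom.ker (tensAct k A B f n) := by
  let mk := Ideal.Quotient.mk (RingHom.ker (tensAct k A B f n))
  -- Placing the two factors at the ends is `A`-balanced modulo the elements that act as zero. So
  -- the identity satisfied by the idempotent in `B ⊗_A B` can be transported along `Θ`.
  let Θ : B ⊗[A] B →ₐ[A] CyclicBar k B (n + 1) ⧸ RingHom.ker (tensAct k A B f n) :=
    Algebra.TensorProduct.lift
      ((Ideal.Quotient.mkₐ A _).comp (IsScalarTower.toAlgHom A B (CyclicBar k B (n + 1))))
      { toRingHom := mk.comp (place k B (n + 1) (Fin.last _))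
        commutes' := fun a => Ideal.Quotient.eq.mpr (place_last_sub_mem_ker_tensAct n a) }
      fun _ _ => Commute.all _ _
  have hΘ : ∀ b c, Θ (b ⊗ₜ c) =
      mk (place k B (n + 1) 0 b) * mk (place k B (n + 1) (Fin.last _) c) := fun _ _ => rfl
  have ht : Θ (Algebra.FormallyUnramified.elem A B) = mk (endsSum k T n) := by
    rw [hT, map_sum, endsSum, map_sum]
    exact Finset.sum_congr rfl fun i _ => (hΘ _ _).trans (map_mul _ _ _).symm
  have h := congrArg Θ (Algebra.FormallyUnramified.one_tmul_mul_elem (R := A) b)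
  rw [map_mul, map_mul, ht, hΘ, hΘ, map_one, map_one, map_one, map_one, one_mul, mul_one] at h
  rw [← Ideal.Quotient.eq_zero_iff_mem, map_mul, map_sub, sub_mul, sub_eq_zero]
  exact h

variable (φ : Localization.Away f →ₐ[k] E)
  (hφ : ∀ a, φ (algebraMap A _ a) = algebraMap B E (algebraMap A B a))

variable (k f B) in
/-- The identification of the last point with the base point. -/
def tensToId (n : ℕ) : tens (barAlg k A B) (phhMod k f) n →+
    (barAlg k A B).obj n ⊗[(barPt k A).obj n] PHHRing k f n :=
  let σ : (barPt k A).obj (n + 1) →+* (barPt k A).obj n :=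
    barMap (n := n + 1) (m := n) wrap (AlgHom.id k A)
  let s : (barAlg k A B).obj (n + 1) →ₛₗ[σ] (barAlg k A B).obj n :=
    { toFun := barMap (n := n + 1) (m := n) wrap (AlgHom.id k B)
      map_add' := map_add (barMap wrap (AlgHom.id k B))
      map_smul' := fun v x => by
        refine (map_mul (barMap wrap (AlgHom.id k B)) _ _).trans ?_
        refine congrArg (· * barMap (n := n + 1) (m := n) wrap (AlgHom.id k B) x) ?_
        exact (barMap_barMap id wrap (IsScalarTower.toAlgHom k A B) (AlgHom.id k B) v).trans
          (barMap_barMap wrap id (AlgHom.id k A) (IsScalarTower.toAlgHom k A B) v).symm }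
  let i : (phhMod k f).obj n →ₛₗ[σ] PHHRing k f n :=
    { toFun := fun x => x
      map_add' := fun _ _ => rfl
      map_smul' := fun _ _ => rfl }
  (TensorProduct.map s i).toAddMonoidHom

lemma tensToId_tmul (n : ℕ) (v : (barAlg k A B).obj (n + 1)) (x : (phhMod k f).obj n) :
    tensToId k B f n (v ⊗ₜ x) =
      (show (barAlg k A B).obj n from barMap (n := n + 1) (m := n) wrap (AlgHom.id k B) v) ⊗ₜ
        (show PHHRing k f n from x) := rfl

variable (k f B) in
/-- The addition of a new last point. -/
def idToTens (n : ℕ) : (barAlg k A B).obj n ⊗[(barPt k A).obj n] PHHRing k f n →+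
    tens (barAlg k A B) (phhMod k f) n :=
  let σ : (barPt k A).obj n →+* (barPt k A).obj (n + 1) :=
    barMap (n := n) (m := n + 1) Fin.castSucc (AlgHom.id k A)
  let s : (barAlg k A B).obj n →ₛₗ[σ] (barAlg k A B).obj (n + 1) :=
    (barAlg k A B).mapₛₗ Fin.castSucc Fin.castSucc_zero
  let i : PHHRing k f n →ₛₗ[σ] (phhMod k f).obj n :=
    { toFun := fun x => x
      map_add' := fun _ _ => rfl
      map_smul' := fun v x => by
        refine congrArg (fun w => barToPHH k f n w * x) ?_
        refine Eq.trans ?_ (barMap_barMap Fin.castSucc wrap (AlgHom.id k A) (AlgHom.id k A) v).symm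
        rw [show wrap ∘ Fin.castSucc = (id : Fin (n + 1) → _) from funext wrap_castSucc,
          AlgHom.id_comp, barMap_id]
        rfl }
  (TensorProduct.map s i).toAddMonoidHom

lemma idToTens_tmul (n : ℕ) (v : (barAlg k A B).obj n) (x : PHHRing k f n) :
    idToTens k B f n (v ⊗ₜ x) =
      (show (barAlg k A B).obj (n + 1) from
        barMap (n := n) (m := n + 1) Fin.castSucc (AlgHom.id k B) v) ⊗ₜ
        (show (phhMod k f).obj n from x) := rfl

lemma idTens_tensToId (n : ℕ) (y : tens (barAlg k A B) (phhMod k f) n) :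
    idTens φ hφ n (tensToId k B f n y) = wrapTens φ hφ n y := by
  induction y using TensorProduct.induction_on with
  | zero => simp
  | add x y hx hy => simp only [map_add, hx, hy]
  | tmul v x =>
    rw [wrapTens_tmul, tensToId_tmul]
    refine congrArg (· * phhTo φ n x) ?_
    exact barMap_barMap (n := n + 1) wrap id (AlgHom.id k B) (IsScalarTower.toAlgHom k B E) v

/-- In the presence of the idempotent, a factor at the last place may be moved to the place `0`, and
this is the only effect of `tensToId` followed by `idToTens`. -/
lemma tensAct_endsSum_idToTens [Algebra.FormallyUnramified A B] [Algebra.EssFiniteType A B]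
    {T : Finset (B × B)} (hT : Algebra.FormallyUnramified.elem A B = ∑ i ∈ T, i.1 ⊗ₜ i.2) (n : ℕ)
    (y : tens (barAlg k A B) (phhMod k f) n) :
    tensAct k A B f n (endsSum k T n) (idToTens k B f n (tensToId k B f n y)) =
      tensAct k A B f n (endsSum k T n) y := by
  -- `J` consists of the `v` such that `v` times the idempotent acts as zero. As it is an ideal, the
  -- comparison modulo `J` may be made on elements of single places, and only the last place needs
  -- the idempotent.
  let J : Ideal (CyclicBar k B (n + 1)) := Submodule.comap
    (LinearMap.mulRight (CyclicBar k B (n + 1)) (endsSum k T n))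
    (RingHom.ker (tensAct k A B f n))
  have hJ : (Ideal.Quotient.mk J).comp ((barMap Fin.castSucc (AlgHom.id k B)).comp
      (barMap wrap (AlgHom.id k B))) = Ideal.Quotient.mk J := by
    refine bar_ringHom_ext fun i b => ?_
    rw [RingHom.comp_apply, RingHom.comp_apply, barMap_place, barMap_place]
    induction i using Fin.lastCases with
    | last =>
      rw [wrap_last]
      exact (Ideal.Quotient.eq.mpr (place_last_sub_mul_endsSum_mem (k := k) (f := f) hT n b)).symm
    | cast i => rw [wrap_castSucc]; rfl
  induction y using TensorProduct.induction_on with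
  | zero => simp only [map_zero]
  | add x y hx hy => simp only [map_add, hx, hy]
  | tmul v x =>
    have h : tensAct k A B f n ((barMap Fin.castSucc (AlgHom.id k B) (barMap wrap (AlgHom.id k B)
        (show CyclicBar k B (n + 1) from v)) - (show CyclicBar k B (n + 1) from v)) *
          endsSum k T n) = 0 :=
      RingHom.mem_ker.mp (Ideal.Quotient.eq.mp congr($hJ v))
    rw [mul_comm, mul_sub, map_sub, sub_eq_zero] at h
    have h1 := congr($h ((1 : (barAlg k A B).obj (n + 1)) ⊗ₜ x))
    rw [tensToId_tmul, idToTens_tmul, tensAct_tmul, tensAct_tmul]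
    rw [tensAct_tmul, tensAct_tmul] at h1
    refine Eq.trans ?_ (h1.trans ?_)
    · exact congrArg (· ⊗ₜ x) (mul_one (M := CyclicBar k B (n + 1)) _).symm
    · exact congrArg (· ⊗ₜ x) (mul_one (M := CyclicBar k B (n + 1)) _)

/-- `wrapTens` is `tensToId` followed by the injection `idTens`, so `tensToId` already kills `y`;
and the action of the idempotent on `y` factors through `tensToId`. -/
lemma tensAct_endsSum_eq_zero [Module.Flat A B] [Algebra.FormallyUnramified A B]
    [Algebra.EssFiniteType A B] [IsLocalization.Away (algebraMap A B f) E]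
    {T : Finset (B × B)} (hT : Algebra.FormallyUnramified.elem A B = ∑ i ∈ T, i.1 ⊗ₜ i.2) (n : ℕ)
    {y : tens (barAlg k A B) (phhMod k f) n} (hy : wrapTens φ hφ n y = 0) :
    tensAct k A B f n (endsSum k T n) y = 0 := by
  rw [← tensAct_endsSum_idToTens hT, idTens_injective φ hφ n
    ((idTens_tensToId φ hφ n y).trans (hy.trans (map_zero _).symm)), map_zero, map_zero]

/-- The kernel of `wrapTens` is exact. -/
lemma exists_tensD_eq_of_wrapTens_eq_zero [Module.Flat A B] [Algebra.FormallyUnramified A B]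
    [Algebra.EssFiniteType A B] [IsLocalization.Away (algebraMap A B f) E] (n : ℕ)
    (y : tens (barAlg k A B) (phhMod k f) n)
    (hy : IsCycle (tensD (barAlg k A B) (phhMod k f)) n y) (hy' : wrapTens φ hφ n y = 0) :
    ∃ z, wrapTens φ hφ (n + 1) z = 0 ∧ tensD (barAlg k A B) (phhMod k f) n z = y := by
  obtain ⟨T, hT⟩ := TensorProduct.exists_finset (Algebra.FormallyUnramified.elem A B)
  have hT' : ∑ i ∈ T, i.1 * i.2 = 1 := by
    rw [← Algebra.FormallyUnramified.lmul_elem (R := A) (S := B), hT, map_sum]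
    simp
  have := barAlg_flat (k := k) (A := A) (B := B)
  -- The complement of the idempotent: it is the identity on the kernel of `wrapTens`, and zero on
  -- homology.
  let δ : ∀ n, (barAlg k A B).obj (n + 1) := fun n =>
    (1 - endsSum k T n : CyclicBar k B (n + 1))
  have hδ : ∀ n (i : Fin (n + 2)),
      (barAlg k A B).map i.predAbove (predAbove_zero' i) (δ (n + 1)) = δ n := fun n i => by
    change barMap _ _ (1 - endsSum k T (n + 1)) = 1 - endsSum k T n
    rw [map_sub, map_one, barMap_endsSum _ _ (predAbove_zero' i) (predAbove_last' i)]
  -- The first face of `w` multiplies the two components of the idempotent and gives `1`; the second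
  -- moves the right component to the end and gives `endsSum k T 0`.
  let w : CyclicBar k B 2 := ∑ i ∈ T, place k B 2 0 i.1 * place k B 2 1 i.2
  obtain ⟨z, hz⟩ := exists_tensD_eq_smul (barAlg k A B) (phhMod k f) hδ w (by
    change 1 - endsSum k T 0 = barMap (Fin.predAbove (0 : Fin 2)) (AlgHom.id k B) w -
      barMap (Fin.predAbove (1 : Fin 2)) (AlgHom.id k B) w
    simp only [w, endsSum, map_sum, map_mul, barMap_place]
    refine congrArg₂ (· - ·) ?_ rfl
    have : ∀ i ∈ T, place k B 1 (Fin.predAbove (0 : Fin 2) 0) (AlgHom.id k B i.1) *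
        place k B 1 (Fin.predAbove (0 : Fin 2) 1) (AlgHom.id k B i.2) =
        place k B 1 0 (i.1 * i.2) := fun i _ => by
      rw [map_mul]
      rfl
    rw [Finset.sum_congr rfl this, ← map_sum, hT', map_one]) n y hy
  have hδy : δ n • y = y := by
    refine (sub_smul (1 : (barAlg k A B).obj (n + 1))
      (show (barAlg k A B).obj (n + 1) from endsSum k T n) y).trans ?_
    rw [one_smul]
    exact (congrArg (y - ·) (tensAct_endsSum_eq_zero φ hφ hT n hy')).trans (sub_zero y)
  -- The element `z` itself need not be in the kernel of `wrapTens`. Multiplication by `δ` puts it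
  -- there and does not change its boundary, since `δ y = y`.
  refine ⟨δ (n + 1) • z, ?_, ?_⟩
  · rw [wrapTens_smul]
    have : barMap wrap (IsScalarTower.toAlgHom k B E) (1 - endsSum k T (n + 1)) = 0 := by
      rw [map_sub, map_one, barMap_wrap_endsSum T hT', sub_self]
    exact (congrArg (· * wrapTens φ hφ (n + 1) z) this).trans (zero_mul _)
  · rw [tensD_smul _ _ hδ, hz, hδy, hδy]

end Etale

/-! ### Flat and unramified base change of `P̲HH` -/

section Etale

variable {k A : Type u} [CommRing k] [CommRing A] [Algebra k A]

variable (k) in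
/-- The faces of `P̲HH(A, f)`. -/
def phhFace (f : A) (n : ℕ) (i : Fin (n + 2)) : PHHRing k f (n + 1) →ₐ[A] PHHRing k f n :=
  PHHMap (circ i.predAbove) (circ_zero (predAbove_zero' i)) (AlgHom.id k (Localization.Away f))
    fun _ => rfl

variable (k) in
/-- The differential of `B ⊗ P̲HH(A, f)`. -/
def phhD (f : A) (B : Type u) [CommRing B] [Algebra A B] (n : ℕ) :
    B ⊗[A] PHHRing k f (n + 1) →+ B ⊗[A] PHHRing k f n :=
  altSum fun i : Fin (n + 2) =>
    ((phhFace k f n i).toLinearMap.lTensor B).toAddMonoidHom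

variable {B : Type u} [CommRing B] [Algebra A B] {f : A}

instance (n : ℕ) : Module (CyclicBar k A (n + 1)) (PHHRing k f n) :=
  ((barToPHH k f n).comp (barMap wrap (AlgHom.id k A))).toAlgebra.toModule

instance (n : ℕ) : IsScalarTower A (CyclicBar k A (n + 1)) (PHHRing k f n) :=
  IsScalarTower.of_algebraMap_smul fun a x => by
    rw [Algebra.smul_def a x]
    refine congrArg (· * x) (Subtype.ext ?_)
    change barMap id _ (barMap wrap _ (place k A (n + 1) 0 a)) =
      place k _ n 0 (algebraMap A _ a)
    rw [barMap_place, barMap_place, wrap_zero]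
    rfl

variable (k A B f) in
/-- The base change of `P̲HH(A, f)` to the tensor powers of `A` with the first factor extended to
`B`. -/
def pointEquiv (n : ℕ) : B ⊗[A] PHHRing k f n ≃+ tens (pointAlg k A B) (phhMod k f) n :=
  (cancelEquiv A (CyclicBar k A (n + 1)) B (PHHRing k f n)).symm

lemma pointEquiv_tmul (n : ℕ) (b : B) (x : PHHRing k f n) :
    pointEquiv k A B f n (b ⊗ₜ x) =
      (show (pointAlg k A B).obj (n + 1) from ((1 : CyclicBar k A (n + 1)) ⊗ₜ[A] b)) ⊗ₜ
        (show (phhMod k f).obj n from x) :=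
  cancelEquiv_symm_tmul b x

variable {E : Type u} [CommRing E] [Algebra k B] [IsScalarTower k A B] [Algebra k E] [Algebra B E]
  [IsScalarTower k B E]

variable (k E) in
/-- The differential of the tensor powers. -/
def barD (n : ℕ) : CyclicBar k E (n + 1) →+ CyclicBar k E n :=
  altSum fun i : Fin (n + 2) => (barMap (circ i.predAbove) (AlgHom.id k E)).toAddMonoidHom

lemma barD_wrapTens (φ : Localization.Away f →ₐ[k] E)
    (hφ : ∀ a, φ (algebraMap A _ a) = algebraMap B E (algebraMap A B a)) (n : ℕ)
    (y : tens (barAlg k A B) (phhMod k f) (n + 1)) :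
    barD k E n (wrapTens φ hφ (n + 1) y) =
      wrapTens φ hφ n (tensD (barAlg k A B) (phhMod k f) n y) :=
  altSum_natural (d := tensFace (barAlg k A B) (phhMod k f) n) (wrapTens φ hφ (n + 1))
    (wrapTens φ hφ n) (fun _ y => (wrapTens_tensMap φ hφ _ _ _ y).symm) y

/-- Étale base change of `P̲HH(A, f)`, up to replacing `P̲HH(B, f)` by the subgroup which is
generated by the images of `B^{⊗ n+1}` and `P̲HH(A, f)`. -/
theorem coneExactAt_of_formallyUnramified [Module.Flat A B] [Algebra.FormallyUnramified A B]
    [Algebra.EssFiniteType A B] [IsLocalization.Away (algebraMap A B f) E]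
    (φ : Localization.Away f →ₐ[k] E)
    (hφ : ∀ a, φ (algebraMap A _ a) = algebraMap B E (algebraMap A B a))
    {D : ∀ n, AddSubgroup (CyclicBar k E n)} (hD : ∀ n, D n = (wrapTens φ hφ n).range)
    (dD : ∀ n, D (n + 1) →+ D n) (hdD : ∀ n y, (dD n y : CyclicBar k E n) = barD k E n y)
    (ψ : ∀ n, B ⊗[A] PHHRing k f n →+ D n)
    (hψ : ∀ n b x, (ψ n (b ⊗ₜ x) : CyclicBar k E n) =
      place k E n 0 (algebraMap B E b) * phhTo φ n x) (n : ℕ) :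
    ConeExactAt (phhD k f B) dD ψ n := by
  have := barAlg_flat (k := k) (A := A) (B := B)
  have := pointAlg_flat (k := k) (A := A) (B := B)
  let π : ∀ n, tens (barAlg k A B) (phhMod k f) n →+ D n := fun n =>
    (wrapTens φ hφ n).codRestrict (D n) fun y => by rw [hD]; exact ⟨y, rfl⟩
  -- Enlarging `A^{⊗ n+2} ⊗_A B` to `B^{⊗ n+2}` does not change homology, nor does dividing by the
  -- acyclic kernel of `wrapTens`; the quotient is `D`.
  have h := ConeExactAt.comp_surjective
    (tensD_tensD (barAlg k A B) (phhMod k f))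
    (tensHom_tensD (phhMod k f) (pointHom k A B)) (dE := dD) (π := π)
    (fun n y => Subtype.ext (by rw [hdD]; exact (barD_wrapTens φ hφ n y).symm))
    (fun n y => by
      obtain ⟨x, hx⟩ : (y : CyclicBar k E n) ∈ (wrapTens φ hφ n).range := by
        rw [← hD]; exact y.2
      exact ⟨x, Subtype.ext hx⟩)
    (fun n y hy hy' => by
      obtain ⟨z, hz, hz'⟩ := exists_tensD_eq_of_wrapTens_eq_zero φ hφ n y hy congr(($hy' : _))
      exact ⟨z, Subtype.ext hz, hz'⟩)
    (coneExactAt_tensHom (phhMod k f) (pointHom k A B) pointHom_app_zero_bijective) n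
  refine h.congr_source (pointEquiv k A B f) ?_ ?_
  · intro n x
    refine (altSum_natural (d' := tensFace (pointAlg k A B) (phhMod k f) n)
      (pointEquiv k A B f (n + 1)).toAddMonoidHom (pointEquiv k A B f n).toAddMonoidHom
      (fun i x => ?_) x).symm
    induction x using TensorProduct.induction_on with
    | zero => simp
    | add x y hx hy => simp only [map_add, hx, hy]
    | tmul b x =>
      refine (congrArg (tensFace _ _ n i) (pointEquiv_tmul (n + 1) b x)).trans ?_
      refine Eq.trans ?_ (pointEquiv_tmul n b (phhFace k f n i x)).symm
      refine congrArg (fun v : CyclicBar k A (n + 1) => (show (pointAlg k A B).obj (n + 1) from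
        (v ⊗ₜ[A] b)) ⊗ₜ (show (phhMod k f).obj n from phhFace k f n i x)) ?_
      exact map_one (barMap i.predAbove (AlgHom.id k A))
  · intro n x
    induction x using TensorProduct.induction_on with
    | zero => simp
    | add x y hx hy => simp only [map_add, hx, hy]
    | tmul b x =>
      refine Subtype.ext ((hψ n b x).trans ?_).symm
      rw [pointEquiv_tmul]
      refine congrArg (· * phhTo φ n x) ?_
      have h1 : (pointHom k A B).app (n + 1) ((1 : CyclicBar k A (n + 1)) ⊗ₜ[A] b) =
          place k B (n + 1) 0 b :=
        (pointHomApp_tmul (n + 1) 1 b).trans (by rw [map_one, one_mul])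
      refine Eq.trans ?_ (congrArg (barMap wrap (IsScalarTower.toAlgHom k B E)) h1).symm
      rw [barMap_place, wrap_zero]
      rfl

end Etale

/-! ### The subring generated by the tensor powers and `P̲HH` -/

section WrapSubring

variable {k A B E : Type u} [CommRing k] [CommRing A] [CommRing B] [CommRing E] [Algebra k A]
  [Algebra k B] [Algebra A B] [IsScalarTower k A B] [Algebra k E] [Algebra B E]
  [IsScalarTower k B E] {f : A} (φ : Localization.Away f →ₐ[k] E)
  (hφ : ∀ a, φ (algebraMap A _ a) = algebraMap B E (algebraMap A B a))

lemma phhTo_mul (n : ℕ) (x y : PHHRing k f n) : phhTo φ n (x * y) = phhTo φ n x * phhTo φ n y :=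
  map_mul (barMap id φ) x.1 y.1

/-- The image of `wrapTens`. -/
def wrapSubring (n : ℕ) : Subring (CyclicBar k E n) where
  __ := (wrapTens φ hφ n).range
  one_mem' := ⟨(1 : CyclicBar k B (n + 1)) ⊗ₜ (1 : PHHRing k f n), by
    refine (wrapTens_tmul φ hφ n _ _).trans ?_
    exact (congrArg₂ (· * ·) (map_one (barMap _ _)) (map_one (barMap id φ))).trans (one_mul 1)⟩
  mul_mem' := by
    rintro _ _ ⟨x, rfl⟩ ⟨y, rfl⟩
    change _ ∈ (wrapTens φ hφ n).range
    induction x using TensorProduct.induction_on with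
    | zero => rw [map_zero, zero_mul]; exact zero_mem _
    | add x x' hx hx' => rw [map_add, add_mul]; exact add_mem hx hx'
    | tmul v x =>
      induction y using TensorProduct.induction_on with
      | zero => rw [map_zero, mul_zero]; exact zero_mem _
      | add y y' hy hy' => rw [map_add, mul_add]; exact add_mem hy hy'
      | tmul w y =>
        refine ⟨(v * w) ⊗ₜ ((show PHHRing k f n from x) * (show PHHRing k f n from y) :
          PHHRing k f n), ?_⟩
        rw [wrapTens_tmul φ hφ n v, wrapTens_tmul φ hφ n w, mul_mul_mul_comm]
        exact congrArg₂ (· * ·)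
          (map_mul (barMap (n := n + 1) wrap (IsScalarTower.toAlgHom k B E)) v w)
          (phhTo_mul φ n x y)

lemma place_mem_wrapSubring (n : ℕ) (i : Fin (n + 1)) (b : B) :
    place k E n i (algebraMap B E b) ∈ wrapSubring φ hφ n := by
  refine ⟨(place k B (n + 1) i.castSucc b : CyclicBar k B (n + 1)) ⊗ₜ (1 : PHHRing k f n), ?_⟩
  refine (wrapTens_tmul φ hφ n _ _).trans ?_
  refine (congrArg₂ (· * ·) (barMap_place _ _ _ _) (map_one (barMap id φ))).trans ?_
  rw [mul_one, wrap_castSucc]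
  rfl

lemma phhTo_mem_wrapSubring (n : ℕ) (x : PHHRing k f n) :
    phhTo φ n x ∈ wrapSubring φ hφ n := by
  refine ⟨(1 : CyclicBar k B (n + 1)) ⊗ₜ x, ?_⟩
  refine (wrapTens_tmul φ hφ n _ _).trans ?_
  exact (congrArg (· * phhTo φ n x) (map_one (barMap _ _))).trans (one_mul _)

/-- With the two preceding memberships this characterizes `wrapSubring` as the subring generated by
`B` at all places and by `P̲HH(A, f)`. -/
lemma wrapSubring_le {n : ℕ} {S : Subring (CyclicBar k E n)}
    (h : ∀ i b, place k E n i (algebraMap B E b) ∈ S) (h' : ∀ x, phhTo φ n x ∈ S) :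
    wrapSubring φ hφ n ≤ S := by
  rintro _ ⟨y, rfl⟩
  change wrapTens φ hφ n y ∈ S
  induction y using TensorProduct.induction_on with
  | zero => rw [map_zero]; exact zero_mem _
  | add x x' hx hx' => rw [map_add]; exact add_mem hx hx'
  | tmul v x =>
    rw [wrapTens_tmul]
    refine mul_mem ?_ (h' x)
    exact bar_subring_eq_top (S := S.comap (barMap wrap (IsScalarTower.toAlgHom k B E)))
      (fun i b => by rw [Subring.mem_comap, barMap_place]; exact h _ _) v

/-- The element is `u` at the place `i` times `u⁻¹` at the place `j`. It is in `P̲HH(A, f)`, because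
the product of all its factors is `1`, even if `u` and `u⁻¹` are not both in `A`. -/
lemma exists_mem_wrapSubring_mul_place (n : ℕ) (i j : Fin (n + 1)) (u : (Localization.Away f)ˣ) :
    ∃ e ∈ wrapSubring φ hφ n, e * place k E n j (φ (u : Localization.Away f)) =
      place k E n i (φ (u : Localization.Away f)) := by
  have hx : place k _ n i (u : Localization.Away f) * place k _ n j ((u⁻¹ : (Localization.Away f)ˣ) : Localization.Away f) ∈
      PHHRing k f n := by
    refine AddSubmonoid.subset_closure ⟨1, Pi.mulSingle i u * Pi.mulSingle j u⁻¹, ⟨1, ?_⟩, ?_⟩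
    · rw [← Units.coe_prod, Pi.mul_def, Finset.prod_mul_distrib, Finset.prod_pi_mulSingle',
        Finset.prod_pi_mulSingle']
      simp
    · rw [place_eq_pureTensor, place_eq_pureTensor, pureTensor_mul]
      congr 1
      ext l
      simp only [Pi.mul_apply, Pi.one_apply, map_one, one_mul, Units.val_mul]
      congr 1 <;> simp only [Pi.mulSingle, Function.update_apply] <;> split_ifs <;> rfl
  refine ⟨_, phhTo_mem_wrapSubring φ hφ n ⟨_, hx⟩, ?_⟩
  rw [phhTo_apply]
  dsimp only
  rw [map_mul, barMap_place, barMap_place, mul_assoc, id_eq, id_eq, ← map_mul, ← map_mul,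
    Units.inv_mul, map_one, map_one, mul_one]

end WrapSubring

/-! ### Cancelling denominators at different tensor places -/

section Fractions

variable {k R E : Type u} [CommRing k] [CommRing R] [CommRing E] [Algebra k E]

/-- A tensor product of fractions lies in a subring, if the product of the denominators is a product
of primes which divides the product of the numerators, and if the primes can be moved between the
factors. -/
lemma mem_of_prod_dvd {n : ℕ} {S : Subring (CyclicBar k E n)} (α : R →+* E)
    (hS : ∀ i r, place k E n i (α r) ∈ S) (M : Multiset (Fin (n + 1) × R))
    (hM : ∀ x ∈ M, Prime x.2 ∧ x.2 ∈ nonZeroDivisors R ∧ IsUnit (α x.2) ∧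
      ∀ i j, ∃ e ∈ S, e * place k E n j (α x.2) = place k E n i (α x.2)) (c : Fin (n + 1) → R)
    (hc : (M.map Prod.snd).prod ∣ ∏ i, c i) {z : CyclicBar k E n}
    (hz : z * (M.map fun x => place k E n x.1 (α x.2)).prod = ∏ i, place k E n i (α (c i))) :
    z ∈ S := by
  induction M using Multiset.induction_on generalizing c z with
  | empty =>
    rw [Multiset.map_zero, Multiset.prod_zero, mul_one] at hz
    rw [hz]
    exact prod_mem fun i _ => hS i _
  | cons x M ih =>
    obtain ⟨⟨hp, hnz, hu, hx⟩, hM'⟩ := Multiset.forall_mem_cons.mp hM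
    obtain ⟨j, q⟩ := x
    dsimp only at hp hnz hu hx
    simp only [Multiset.map_cons, Multiset.prod_cons] at hc hz
    -- The denominator `q` stands at the place `j`, but the numerator that it divides may stand at
    -- another place `i`.
    obtain ⟨i, -, c', hc'⟩ := (Prime.dvd_finsetProd_iff hp _).mp ((dvd_mul_right _ _).trans hc)
    have hprod : ∀ {N : Type u} [CommMonoid N] (F : Fin (n + 1) → R → N) (q' : N),
        F i (c i) = q' * F i c' →
        ∏ l, F l (c l) = q' * ∏ l, F l (Function.update c i c' l) := by
      intro N _ F q' h
      rw [← Finset.mul_prod_erase _ _ (Finset.mem_univ i), h, mul_assoc]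
      rw [← Finset.mul_prod_erase _ _ (Finset.mem_univ i), Function.update_self]
      congr 2
      refine Finset.prod_congr rfl fun l hl => ?_
      rw [Function.update_of_ne (Finset.ne_of_mem_erase hl)]
    obtain ⟨e, he, he'⟩ := hx i j
    obtain ⟨vi, hvi⟩ := hu.map (place k E n i)
    have hj := hu.map (place k E n j)
    -- Multiplying `z` by `q` at `j` and dividing by `q` at `i` removes one denominator and cancels
    -- `q` from the numerator at `i`. The element `e` undoes this inside `S`.
    have hz' := ih hM' (Function.update c i c') (z := z * place k E n j (α q) * ↑vi⁻¹) (by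
        obtain ⟨r, hr⟩ := hc
        refine ⟨r, ?_⟩
        rw [hprod (fun _ r => r) q hc', mul_assoc] at hr
        exact (mul_cancel_left_mem_nonZeroDivisors hnz).mp hr) (by
        rw [hprod (fun l r => place k E n l (α r)) (place k E n i (α q))
          (by rw [hc', map_mul, map_mul]), ← hvi] at hz
        rw [mul_right_comm, mul_assoc z, hz, mul_comm, ← mul_assoc, Units.inv_mul, one_mul])
    have : z = e * (z * place k E n j (α q) * ↑vi⁻¹) := by
      refine hj.mul_right_cancel ?_
      rw [mul_right_comm, he', ← hvi, mul_comm (z * _), ← mul_assoc, Units.mul_inv, one_mul]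
    rw [this]
    exact mul_mem he hz'

end Fractions

/-! ### The subrings generated from `A` and from `B` -/

section Compare

variable {k A B C E : Type u} [CommRing k] [CommRing A] [CommRing B] [CommRing C] [CommRing E]
  [Algebra k A] [Algebra k B] [Algebra k E] [Algebra A B] [Algebra A C] [Algebra B C]
  [Algebra C E] {f : A}
  (φ : Localization.Away f →ₐ[k] E) (φ' : Localization.Away (algebraMap A B f) →ₐ[k] E)

lemma comp_awayMap [IsScalarTower k A B] [IsScalarTower A B C]
    (hφ : ∀ a, φ (algebraMap A _ a) = algebraMap C E (algebraMap A C a))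
    (hφ' : ∀ b, φ' (algebraMap B _ b) = algebraMap C E (algebraMap B C b)) : φ'.comp (awayMap k f B) = φ := by
  refine AlgHom.coe_ringHom_injective (IsLocalization.ringHom_ext (Submonoid.powers f) ?_)
  ext a
  change φ' (awayMap k f B (algebraMap A _ a)) = φ (algebraMap A _ a)
  rw [awayMap_algebraMap, hφ, hφ', ← IsScalarTower.algebraMap_apply A B C]

lemma phhTo_PHHMap [IsScalarTower k A B] [IsScalarTower A B C]
    (hφ : ∀ a, φ (algebraMap A _ a) = algebraMap C E (algebraMap A C a))
    (hφ' : ∀ b, φ' (algebraMap B _ b) = algebraMap C E (algebraMap B C b)) (n : ℕ) (x : PHHRing k f n) :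
    phhTo φ' n (PHHMap id rfl (awayMap k f B) (awayMap_algebraMap k f B) x) = phhTo φ n x := by
  refine (barMap_barMap id id (awayMap k f B) φ' x.1).trans ?_
  rw [comp_awayMap φ φ' hφ hφ']
  rfl

variable [Algebra k C] [IsScalarTower k A C] [IsScalarTower k B C] [IsScalarTower k C E]
  (hφ : ∀ a, φ (algebraMap A _ a) = algebraMap C E (algebraMap A C a))
  (hφ' : ∀ b, φ' (algebraMap B _ b) = algebraMap C E (algebraMap B C b))

lemma wrapSubring_le_of_tower [IsScalarTower k A B] [IsScalarTower A B C]
    (n : ℕ) : wrapSubring φ hφ n ≤ wrapSubring φ' hφ' n :=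
  wrapSubring_le φ hφ (place_mem_wrapSubring φ' hφ' n) fun x => by
    rw [← phhTo_PHHMap φ φ' hφ hφ']
    exact phhTo_mem_wrapSubring φ' hφ' n _


/-- `P̲HH(B, f)` is locally generated by `P̲HH(A, f)` and the tensor powers, if the prime factors of
`f` in `B` can be moved between the factors. -/
lemma wrapSubring_le_of_primes (hf : algebraMap A B f ∈ nonZeroDivisors B) {s : Multiset B}
    (hs : ∀ q ∈ s, Prime q) (hsf : Associated s.prod (algebraMap A B f)) (n : ℕ)
    (hr : ∀ q ∈ s, ∀ i j, ∃ e ∈ wrapSubring φ hφ n,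
      e * place k E n j (algebraMap C E (algebraMap B C q)) =
        place k E n i (algebraMap C E (algebraMap B C q))) :
    wrapSubring φ' hφ' n ≤ wrapSubring φ hφ n := by
  refine wrapSubring_le φ' hφ' (place_mem_wrapSubring φ hφ n) ?_
  rintro ⟨x, hx⟩
  rw [phhTo_apply]
  dsimp only
  change x ∈ AddSubmonoid.closure (generators k (algebraMap A B f) n) at hx
  induction hx using AddSubmonoid.closure_induction with
  | zero => rw [map_zero]; exact zero_mem _
  | add u v _ _ hu hv => rw [map_add]; exact add_mem hu hv
  | mem u hu =>
    obtain ⟨a, m, ⟨b, hb⟩, rfl⟩ := hu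
    -- A common denominator `f ^ N` for all `m i`. As `f` times the unit `w` is `s.prod`, the
    -- denominator becomes `s.prod ^ N` once the numerators are multiplied by `w ^ N`.
    obtain ⟨⟨_, N, rfl⟩, hN⟩ := IsLocalization.exist_integer_multiples_of_finite
      (Submonoid.powers (algebraMap A B f)) fun i => (m i : Localization.Away (algebraMap A B f))
    choose c hc using hN
    obtain ⟨w, hw⟩ := hsf.symm
    have hm : ∀ i, (m i : Localization.Away (algebraMap A B f)) *
        algebraMap B _ (s.prod ^ N) = algebraMap B _ (c i * w ^ N) := fun i => by
      rw [map_mul, hc, ← hw, mul_pow, map_mul, Algebra.smul_def]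
      ring
    let α : B →+* E := (algebraMap C E).comp (algebraMap B C)
    have hα : ∀ b, φ' (algebraMap B _ b) = α b := hφ'
    have hs_unit : IsUnit (α s.prod) := by
      have h := ((IsLocalization.Away.algebraMap_isUnit
        (S := Localization.Away (algebraMap A B f)) (algebraMap A B f)).map φ')
      rw [hα] at h
      rw [← hw, map_mul]
      exact h.mul (w.isUnit.map α)
    rw [barMap_pureTensor_eq_prod]
    simp only [id_eq, map_mul, Finset.prod_mul_distrib]
    refine mul_mem (prod_mem fun i _ => ?_) ?_
    · rw [hα]
      exact place_mem_wrapSubring φ hφ n _ _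
    -- The denominators: at every place, each prime factor of `f` repeated `N` times.
    let M : Multiset (Fin (n + 1) × B) := ∑ j, (N • s).map (Prod.mk j)
    have hMprod : ∀ {X : Type u} [CommMonoid X] (F : Fin (n + 1) → B →* X),
        (M.map fun x => F x.1 x.2).prod = ∏ j, F j (s.prod ^ N) := by
      intro X _ F
      have h := map_sum (Multiset.mapAddMonoidHom fun x : Fin (n + 1) × B => F x.1 x.2)
        (fun j => (N • s).map (Prod.mk j)) Finset.univ
      rw [Multiset.coe_mapAddMonoidHom] at h
      rw [h, Multiset.prod_sum]
      refine Finset.prod_congr rfl fun j _ => ?_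
      rw [Multiset.map_map, Multiset.map_nsmul, Multiset.prod_nsmul, map_pow,
        map_multiset_prod]
      rfl
    refine mem_of_prod_dvd α (fun i b => place_mem_wrapSubring φ hφ n _ _) M (fun x hx => ?_)
      (fun i => c i * w ^ N) ?_ ?_
    · obtain ⟨j, -, hj⟩ := Multiset.mem_sum.mp hx
      obtain ⟨q, hq, rfl⟩ := Multiset.mem_map.mp hj
      replace hq := Multiset.mem_of_mem_nsmul hq
      have hqs := Multiset.dvd_prod hq
      refine ⟨hs q hq, ?_, isUnit_of_dvd_unit (map_dvd α hqs) hs_unit, hr q hq⟩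
      obtain ⟨r, hr⟩ := hqs.trans hsf.dvd
      rw [hr] at hf
      exact (mul_mem_nonZeroDivisors.mp hf).1
    · rw [show M.map Prod.snd = M.map fun x => MonoidHom.id B x.2 from rfl,
        hMprod fun _ => MonoidHom.id B]
      -- This is where `m₀ ⋯ mₙ ∈ B` is used: the quotient of the product of the numerators by that
      -- of the denominators is `b`. The equality may be checked in `B[1/f]`, since `f` is a
      -- nonzerodivisor.
      refine ⟨b, ?_⟩
      refine IsLocalization.injective (Localization.Away (algebraMap A B f))
        (M := Submonoid.powers (algebraMap A B f)) (Submonoid.powers_le.mpr hf) ?_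
      rw [map_prod, map_mul, hb, ← Finset.prod_congr rfl fun i _ => hm i,
        Finset.prod_mul_distrib, map_prod, mul_comm]
      rfl
    · refine (congrArg (_ * ·) (hMprod fun j =>
        ((place k E n j).comp α : B →+* CyclicBar k E n).toMonoidHom)).trans ?_
      rw [← Finset.prod_mul_distrib]
      refine Finset.prod_congr rfl fun i _ => ?_
      change _ * place k E n i (α _) = place k E n i (α _)
      rw [← map_mul, ← hα, ← hα, ← map_mul, hm]

end Compare

/-! ### Prime factors of `f` at a prime of `B` -/

section Primes

variable {k A B C E : Type u} [CommRing k] [CommRing A] [CommRing B] [CommRing C] [CommRing E]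
  [Algebra k A] [Algebra k C] [Algebra k E] [Algebra A B] [Algebra A C] [Algebra B C]
  [Algebra C E] [IsScalarTower k A C] [IsScalarTower k C E] [IsScalarTower A B C] {f : A}
  (φ : Localization.Away f →ₐ[k] E)
  (hφ : ∀ a, φ (algebraMap A _ a) = algebraMap C E (algebraMap A C a))

/-- The prime factors of `f` in `B` can be moved between the factors of the tensor powers, locally
on `B`. -/
lemma IsStrictNormalCrossing.exists_mul_place_eq (h : IsStrictNormalCrossing k f)
    [Algebra.Etale A B] (hA : IsProductOfPrimes f) (Q : Ideal B) [Q.IsPrime]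
    (hC : ∀ b ∉ Q, IsUnit (algebraMap B C b)) {q : B} (hq : Prime q) (hqf : q ∣ algebraMap A B f)
    {n : ℕ} (i j : Fin (n + 1)) : ∃ e ∈ wrapSubring φ hφ n,
      e * place k E n j (algebraMap C E (algebraMap B C q)) =
        place k E n i (algebraMap C E (algebraMap B C q)) := by
  have hunit : ∀ b ∉ Q, ∃ c, algebraMap B C b * c = 1 := fun b hb => (hC b hb).exists_right_inv
  -- If `q ∈ Q`, then `q` divides a prime factor `p = q w` of `f` in `A`, and `w` is invertible in
  -- `C`; so `q` moves because `p` moves within `P̲HH(A, f)`. If `q ∉ Q`, it is itself invertible in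
  -- `C` and moves by means of `C` alone.
  by_cases hqQ : q ∈ Q
  · obtain ⟨s, hs, hsf⟩ := hA
    have hqs : q ∣ (s.map (algebraMap A B)).prod := by
      rw [← map_multiset_prod]
      exact hqf.trans (map_dvd (algebraMap A B) hsf.symm.dvd)
    obtain ⟨p, hp, w, hw⟩ := hq.exists_mem_multiset_map_dvd hqs
    have hpf : p ∣ f := (Multiset.dvd_prod hp).trans hsf.dvd
    have hwQ := h.notMem_of_mul_eq (hs p hp) hpf Q hqQ hw
    obtain ⟨c, hc⟩ := hunit w hwQ
    have hpu : IsUnit (algebraMap A (Localization.Away f) p) :=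
      isUnit_of_dvd_unit (map_dvd _ hpf) (IsLocalization.Away.algebraMap_isUnit f)
    obtain ⟨e, he, hep⟩ := exists_mem_wrapSubring_mul_place φ hφ n i j hpu.unit
    have hφp : φ (hpu.unit : Localization.Away f) =
        algebraMap C E (algebraMap B C q) * algebraMap C E (algebraMap B C w) := by
      rw [IsUnit.unit_spec, hφ, IsScalarTower.algebraMap_apply A B C, hw, map_mul, map_mul]
    have hc' : ∀ l, place k E n l (algebraMap C E (algebraMap B C w)) *
        place k E n l (algebraMap C E c) = 1 := fun l => by
      rw [← map_mul, ← map_mul, hc, map_one, map_one]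
    rw [hφp, map_mul, map_mul] at hep
    refine ⟨e * place k E n i (algebraMap C E c) *
      place k E n j (algebraMap C E (algebraMap B C w)), mul_mem (mul_mem he
        (place_mem_wrapSubring φ hφ n i c)) (place_mem_wrapSubring φ hφ n j _), ?_⟩
    linear_combination place k E n i (algebraMap C E c) * hep +
      place k E n i (algebraMap C E (algebraMap B C q)) * hc' i
  · obtain ⟨c, hc⟩ := hunit q hqQ
    refine ⟨place k E n i (algebraMap C E (algebraMap B C q)) * place k E n j (algebraMap C E c),
      mul_mem (place_mem_wrapSubring φ hφ n i _) (place_mem_wrapSubring φ hφ n j c), ?_⟩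
    rw [mul_assoc, ← map_mul, ← map_mul, mul_comm c, hc, map_one, map_one, mul_one]

end Primes

/-! ### Comparison maps after extension of scalars to `C` -/

section Tower

variable {k A B C : Type u} [CommRing k] [CommRing A] [CommRing B] [CommRing C]
  [Algebra k A] [Algebra k B] [Algebra A B] [Algebra A C] [Algebra B C] [IsScalarTower k A B]
  [IsScalarTower A B C] {f : A}

variable (k A B C f) in
/-- The canonical map `C ⊗ P̲HH(A, f) → C ⊗ P̲HH(B, f)`. -/
def phhTower (n : ℕ) : C ⊗[A] PHHRing k f n →+ C ⊗[B] PHHRing k (algebraMap A B f) n :=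
  let i : C →ₛₗ[algebraMap A B] C :=
    { toFun := id
      map_add' := fun _ _ => rfl
      map_smul' := fun a c => (algebraMap_smul B a c).symm }
  let j : PHHRing k f n →ₛₗ[algebraMap A B] PHHRing k (algebraMap A B f) n :=
    { toFun := PHHMap id rfl (awayMap k f B) (awayMap_algebraMap k f B)
      map_add' := map_add _
      map_smul' := fun a x => by rw [map_smul, algebraMap_smul] }
  (TensorProduct.map i j).toAddMonoidHom

lemma phhTower_tmul (n : ℕ) (c : C) (x : PHHRing k f n) :
    phhTower k A B C f n (c ⊗ₜ x) =
      c ⊗ₜ PHHMap id rfl (awayMap k f B) (awayMap_algebraMap k f B) x := rfl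

lemma PHHMap_phhFace (n : ℕ) (i : Fin (n + 2)) (x : PHHRing k f (n + 1)) :
    PHHMap id rfl (awayMap k f B) (awayMap_algebraMap k f B) (phhFace k f n i x) =
      phhFace k (algebraMap A B f) n i
        (PHHMap id rfl (awayMap k f B) (awayMap_algebraMap k f B) x) :=
  Subtype.ext ((barMap_barMap (circ i.predAbove) id (AlgHom.id k _) (awayMap k f B) x.1).trans
    (barMap_barMap id (circ i.predAbove) (awayMap k f B) (AlgHom.id k _) x.1).symm)

lemma phhTower_phhD (n : ℕ) (x : C ⊗[A] PHHRing k f (n + 1)) :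
    phhTower k A B C f n (phhD k f C n x) =
      phhD k (algebraMap A B f) C n (phhTower k A B C f (n + 1) x) := by
  refine (altSum_natural (phhTower k A B C f (n + 1)) (phhTower k A B C f n) (fun i x => ?_) x).symm
  induction x using TensorProduct.induction_on with
  | zero => simp
  | add x y hx hy => simp only [map_add, hx, hy]
  | tmul c x => exact congrArg (c ⊗ₜ[B] ·) (PHHMap_phhFace n i x).symm

end Tower

/-! ### The maps to the tensor powers of the localization -/

section Point

variable {k A C E : Type u} [CommRing k] [CommRing A] [CommRing C] [CommRing E]
  [Algebra k A] [Algebra k E] [Algebra A C] [Algebra C E] {f : A}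
  (φ : Localization.Away f →ₐ[k] E)
  (hφ : ∀ a, φ (algebraMap A _ a) = algebraMap C E (algebraMap A C a))

/-- The map `C ⊗ P̲HH(A, f) → E^{⊗ n+1}`. -/
def pointTens (n : ℕ) : C ⊗[A] PHHRing k f n →+ CyclicBar k E n :=
  mulTens ((place k E n 0).comp (algebraMap C E)) (phhTo φ n) fun a x => by
    rw [Algebra.smul_def, phhTo_mul]
    refine congrArg (· * phhTo φ n x) ?_
    refine (barMap_place id φ 0 _).trans ?_
    rw [hφ]
    rfl

lemma pointTens_phhD (n : ℕ) (x : C ⊗[A] PHHRing k f (n + 1)) :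
    pointTens φ hφ n (phhD k f C n x) = barD k E n (pointTens φ hφ (n + 1) x) := by
  refine (altSum_natural (pointTens φ hφ (n + 1)) (pointTens φ hφ n) (fun i x => ?_) x).symm
  induction x using TensorProduct.induction_on with
  | zero => simp
  | add x y hx hy => simp only [map_add, hx, hy]
  | tmul c x =>
    have h₁ : barMap (circ i.predAbove) (AlgHom.id k E) (place k E (n + 1) 0 (algebraMap C E c)) =
        place k E n 0 (algebraMap C E c) := by
      rw [barMap_place, circ_zero (predAbove_zero' i)]
      rfl
    have h₂ : barMap (circ i.predAbove) (AlgHom.id k E) (phhTo φ (n + 1) x) =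
        phhTo φ n (phhFace k f n i x) :=
      (barMap_barMap id (circ i.predAbove) φ (AlgHom.id k E) x.1).trans
        (barMap_barMap (circ i.predAbove) id (AlgHom.id k _) φ x.1).symm
    refine (map_mul (barMap (circ i.predAbove) (AlgHom.id k E))
      (place k E (n + 1) 0 (algebraMap C E c)) (phhTo φ (n + 1) x)).trans ?_
    rw [h₁, h₂]
    rfl

lemma pointTens_mem [Algebra k C] [IsScalarTower k A C] [IsScalarTower k C E] (n : ℕ) (x : C ⊗[A] PHHRing k f n) :
    pointTens φ hφ n x ∈ wrapSubring φ hφ n := by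
  induction x using TensorProduct.induction_on with
  | zero => rw [map_zero]; exact zero_mem _
  | add x y hx hy => rw [map_add]; exact add_mem hx hy
  | tmul c x => exact mul_mem (place_mem_wrapSubring φ hφ n 0 c) (phhTo_mem_wrapSubring φ hφ n x)

end Point

/-! ### Descent at a prime of `B` -/

section Local

variable {k A B C : Type u} [CommRing k] [CommRing A] [CommRing B] [CommRing C]
  [Algebra k A] [Algebra k B] [Algebra k C] [Algebra A B] [Algebra A C] [Algebra B C]
  [IsScalarTower k A B] [IsScalarTower k A C] [IsScalarTower k B C] [IsScalarTower A B C] {f : A}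

/-- Étale descent, locally on `B`. -/
theorem IsStrictNormalCrossing.coneExactAt_phhTower (h : IsStrictNormalCrossing k f)
    [Algebra.Etale A B] (hA : IsProductOfPrimes f) (hB : IsProductOfPrimes (algebraMap A B f))
    (Q : Ideal B) [Q.IsPrime] [IsLocalization.AtPrime C Q] (n : ℕ) :
    ConeExactAt (phhD k f C) (phhD k (algebraMap A B f) C) (phhTower k A B C f) n := by
  -- Both `B → C` and `A → C` are flat, formally unramified and essentially of finite type, so
  -- `coneExactAt_of_formallyUnramified` applies to each of them.
  have : Module.Flat B C := IsLocalization.flat C Q.primeCompl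
  have : Module.Flat A C := Module.Flat.trans A B C
  have : Algebra.FormallyUnramified B C :=
    Algebra.FormallyUnramified.of_isLocalization Q.primeCompl
  have : Algebra.FormallyUnramified A C := Algebra.FormallyUnramified.comp A B C
  have : Algebra.EssFiniteType B C := Algebra.EssFiniteType.of_isLocalization C Q.primeCompl
  have : Algebra.EssFiniteType A C := Algebra.EssFiniteType.comp A B C
  let E := Localization.Away (algebraMap A C f)
  let φ : Localization.Away f →ₐ[k] E := awayMap k f C
  have hφ := awayMap_algebraMap k f C
  have : IsLocalization.Away (algebraMap B C (algebraMap A B f)) E := by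
    rw [← IsScalarTower.algebraMap_apply]
    infer_instance
  let φ' : Localization.Away (algebraMap A B f) →ₐ[k] E :=
    IsLocalization.liftAlgHom (M := Submonoid.powers (algebraMap A B f))
      (f := (IsScalarTower.toAlgHom k C E).comp (IsScalarTower.toAlgHom k B C)) (by
        rintro ⟨_, n, rfl⟩
        simpa using (IsLocalization.Away.algebraMap_isUnit (S := E)
          (algebraMap B C (algebraMap A B f))).pow n)
  have hφ' : ∀ b, φ' (algebraMap B _ b) = algebraMap C E (algebraMap B C b) := fun b =>
    IsLocalization.lift_eq _ b
  have hf : algebraMap A B f ∈ nonZeroDivisors B :=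
    mem_nonZeroDivisors_iff_left.mpr fun b hb =>
      Module.Flat.isSMulRegular_of_nonZeroDivisors (M := B) h.mem_nonZeroDivisors (by
        dsimp only
        rw [smul_zero, Algebra.smul_def, hb])
  -- The two extensions of scalars thus have the same target, and two out of three can be applied.
  have hD : ∀ n, wrapSubring φ hφ n = wrapSubring φ' hφ' n := fun n => by
    refine le_antisymm (wrapSubring_le_of_tower φ φ' hφ hφ' n) ?_
    obtain ⟨s, hs, hsf⟩ := hB
    refine wrapSubring_le_of_primes φ φ' hφ hφ' hf hs hsf n fun q hq i j => ?_
    exact h.exists_mul_place_eq φ hφ hA Q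
      (fun b hb => IsLocalization.map_units C (⟨b, hb⟩ : Q.primeCompl)) (hs q hq)
      ((Multiset.dvd_prod hq).trans hsf.dvd) i j
  let D : ∀ n, AddSubgroup (CyclicBar k E n) := fun n => (wrapSubring φ' hφ' n).toAddSubgroup
  let dD : ∀ n, D (n + 1) →+ D n := fun n =>
    ((barD k E n).comp (D (n + 1)).subtype).codRestrict (D n) (by
      rintro ⟨_, y, rfl⟩
      exact ⟨_, (barD_wrapTens φ' hφ' n y).symm⟩)
  let ψ : ∀ n, C ⊗[B] PHHRing k (algebraMap A B f) n →+ D n := fun n =>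
    (pointTens φ' hφ' n).codRestrict (D n) (pointTens_mem φ' hφ' n)
  have hψ : ∀ n x, ψ n (phhD k (algebraMap A B f) C n x) = dD n (ψ (n + 1) x) := fun n x =>
    Subtype.ext (pointTens_phhD φ' hφ' n x)
  refine coneExactAt_of_comp (φ := phhTower k A B C f) phhTower_phhD hψ ?_ ?_ n
  · exact coneExactAt_of_formallyUnramified φ' hφ' (fun n => rfl) dD (fun _ _ => rfl) ψ
      fun _ _ _ => rfl
  · refine coneExactAt_of_formallyUnramified φ hφ
      (fun n => congrArg Subring.toAddSubgroup (hD n).symm) dD (fun _ _ => rfl) _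
      fun n c x => ?_
    refine (congrArg (fun y => pointTens φ' hφ' n y) (phhTower_tmul n c x)).trans ?_
    exact congrArg (place k E n 0 (algebraMap C E c) * ·) (phhTo_PHHMap φ φ' hφ hφ' n x)

end Local

/-! ### Exactness of cones is a local property -/

section LocalProperty

variable {R : Type*} [CommRing R] {C D C' D' : ℕ → Type*} [∀ n, AddCommGroup (C n)]
  [∀ n, AddCommGroup (D n)] [∀ n, AddCommGroup (C' n)] [∀ n, AddCommGroup (D' n)]
  [∀ n, Module R (C n)] [∀ n, Module R (D n)] [∀ n, Module R (C' n)] [∀ n, Module R (D' n)]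
  {dC : ∀ n, C (n + 1) →+ C n} {dD : ∀ n, D (n + 1) →+ D n} {φ : ∀ n, C n →+ D n}
  {dC' : ∀ n, C' (n + 1) →+ C' n} {dD' : ∀ n, D' (n + 1) →+ D' n} {φ' : ∀ n, C' n →+ D' n}

/-- The scalars which make an element of the cone a boundary, where `p` is the condition on the
first component. -/
def coneIdeal (hdD : ∀ n (r : R) x, dD n (r • x) = r • dD n x)
    (hφ : ∀ n (r : R) x, φ n (r • x) = r • φ n x) {n : ℕ} (p : R → C n → Prop) (p_zero : p 0 0)
    (p_add : ∀ r s x y, p r x → p s y → p (r + s) (x + y))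
    (p_smul : ∀ r s x, p s x → p (r * s) (r • x)) (y : D n) : Ideal R where
  carrier := {r | ∃ x' y', p r x' ∧ r • y = φ n x' + dD n y'}
  zero_mem' := ⟨0, 0, p_zero, by simp⟩
  add_mem' := by
    rintro r s ⟨x, z, hx, hz⟩ ⟨x', z', hx', hz'⟩
    refine ⟨x + x', z + z', p_add _ _ _ _ hx hx', ?_⟩
    rw [add_smul, hz, hz', map_add, map_add]
    abel
  smul_mem' := by
    rintro r s ⟨x, z, hx, hz⟩
    exact ⟨r • x, r • z, p_smul _ _ _ hx, by rw [smul_eq_mul, mul_smul, hz, smul_add, hφ, hdD]⟩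

/-- A relation in the cone over a localization comes from a relation in the cone. -/
lemma exists_smul_eq_of_localized (S : Submonoid R)
    (hdD : ∀ n (r : R) x, dD n (r • x) = r • dD n x)
    (hφ : ∀ n (r : R) x, φ n (r • x) = r • φ n x)
    (hdD' : ∀ n (r : R) x, dD' n (r • x) = r • dD' n x)
    (hφ' : ∀ n (r : R) x, φ' n (r • x) = r • φ' n x)
    (iC : ∀ n, C n →ₗ[R] C' n) (iD : ∀ n, D n →ₗ[R] D' n)
    [∀ n, IsLocalizedModule S (iC n)] [∀ n, IsLocalizedModule S (iD n)]
    (hiD : ∀ n x, iD n (dD n x) = dD' n (iD (n + 1) x))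
    (hiφ : ∀ n x, iD n (φ n x) = φ' n (iC n x)) {n : ℕ} {y : D n} {x' : C' n} {y' : D' (n + 1)}
    (h : iD n y = φ' n x' + dD' n y') :
    ∃ s ∈ S, ∃ x y₁, iC n x = s • x' ∧ s • y = φ n x + dD n y₁ := by
  obtain ⟨⟨x, s⟩, hx⟩ := IsLocalizedModule.surj S (iC n) x'
  obtain ⟨⟨z, t⟩, hz⟩ := IsLocalizedModule.surj S (iD (n + 1)) y'
  rw [Submonoid.smul_def] at hx hz
  dsimp only at hx hz
  -- After clearing the denominators `s` and `t`, the relation holds in the localization of `D n`; a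
  -- further factor `c` makes it hold in `D n`.
  obtain ⟨c, hc⟩ := IsLocalizedModule.exists_of_eq (S := S) (f := iD n)
    (x₁ := ((s : R) * t) • y) (x₂ := φ n ((t : R) • x) + dD n ((s : R) • z)) (by
      have hx₁ : iC n ((t : R) • x) = ((s : R) * t) • x' := by
        rw [map_smul, ← hx, smul_smul, mul_comm (t : R)]
      have hz₁ : iD (n + 1) ((s : R) • z) = ((s : R) * t) • y' := by
        rw [map_smul, ← hz, smul_smul]
      rw [map_smul, h, map_add, hiφ, hiD, hx₁, hz₁, smul_add, hφ', hdD'])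
  rw [Submonoid.smul_def, Submonoid.smul_def] at hc
  refine ⟨c * (s * t), mul_mem c.2 (mul_mem s.2 t.2), (c : R) • (t : R) • x,
    (c : R) • (s : R) • z, ?_, ?_⟩
  · rw [map_smul, map_smul, ← hx, smul_smul, smul_smul]
    congr 1
    ring
  · rw [hφ, hdD, ← smul_add, ← hc, smul_smul]

lemma ConeExactAt.exists_of_localized_zero (S : Submonoid R)
    (hdD : ∀ n (r : R) x, dD n (r • x) = r • dD n x)
    (hφ : ∀ n (r : R) x, φ n (r • x) = r • φ n x)
    (hdD' : ∀ n (r : R) x, dD' n (r • x) = r • dD' n x)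
    (hφ' : ∀ n (r : R) x, φ' n (r • x) = r • φ' n x)
    (iC : ∀ n, C n →ₗ[R] C' n) (iD : ∀ n, D n →ₗ[R] D' n)
    [∀ n, IsLocalizedModule S (iC n)] [∀ n, IsLocalizedModule S (iD n)]
    (hiD : ∀ n x, iD n (dD n x) = dD' n (iD (n + 1) x))
    (hiφ : ∀ n x, iD n (φ n x) = φ' n (iC n x)) (h : ConeExactAt dC' dD' φ' 0) (y : D 0) :
    ∃ s ∈ S, ∃ x y', s • y = φ 0 x + dD 0 y' := by
  obtain ⟨x', y', h⟩ := h (iD 0 y)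
  obtain ⟨s, hs, x, y₁, -, hy⟩ :=
    exists_smul_eq_of_localized S hdD hφ hdD' hφ' iC iD hiD hiφ h
  exact ⟨s, hs, x, y₁, hy⟩

lemma ConeExactAt.exists_of_localized_succ (S : Submonoid R)
    (hdC : ∀ n (r : R) x, dC n (r • x) = r • dC n x)
    (hdD : ∀ n (r : R) x, dD n (r • x) = r • dD n x)
    (hφ : ∀ n (r : R) x, φ n (r • x) = r • φ n x)
    (hdC' : ∀ n (r : R) x, dC' n (r • x) = r • dC' n x)
    (hdD' : ∀ n (r : R) x, dD' n (r • x) = r • dD' n x)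
    (hφ' : ∀ n (r : R) x, φ' n (r • x) = r • φ' n x)
    (iC : ∀ n, C n →ₗ[R] C' n) (iD : ∀ n, D n →ₗ[R] D' n)
    [∀ n, IsLocalizedModule S (iC n)] [∀ n, IsLocalizedModule S (iD n)]
    (hiC : ∀ n x, iC n (dC n x) = dC' n (iC (n + 1) x))
    (hiD : ∀ n x, iD n (dD n x) = dD' n (iD (n + 1) x))
    (hiφ : ∀ n x, iD n (φ n x) = φ' n (iC n x)) {n : ℕ} (h : ConeExactAt dC' dD' φ' (n + 1))
    {x : C n} {y : D (n + 1)} (hx : IsCycle dC n x) (hxy : φ n x = dD n y) :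
    ∃ s ∈ S, ∃ x' y', dC n x' = s • x ∧ s • y = φ (n + 1) x' + dD (n + 1) y' := by
  obtain ⟨x', y', hx', h⟩ := h (iC n x) (iD (n + 1) y) (hx.map (i := fun n => (iC n).toAddMonoidHom)
    hiC) (by rw [← hiφ, hxy, hiD])
  obtain ⟨s, hs, x₁, y₁, hx₁, hy⟩ :=
    exists_smul_eq_of_localized S hdD hφ hdD' hφ' iC iD hiD hiφ h
  -- The lift `x₁` satisfies the condition on the first component only after localization; a second
  -- multiplier repairs this.
  obtain ⟨c, hc⟩ := IsLocalizedModule.exists_of_eq (S := S) (f := iC n)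
    (x₁ := dC n x₁) (x₂ := s • x) (by rw [hiC, hx₁, hdC', hx', map_smul])
  rw [Submonoid.smul_def, Submonoid.smul_def] at hc
  refine ⟨c * s, mul_mem c.2 hs, (c : R) • x₁, (c : R) • y₁, ?_, ?_⟩
  · rw [hdC, hc, smul_smul]
  · rw [mul_smul, hy, smul_add, hφ, hdD]

/-- The scalars `r` for which `r • y` bounds form an ideal. It lies in no maximal ideal, so it
contains `1`. -/
lemma coneExactAt_zero_of_forall_isMaximal (hdD : ∀ n (r : R) x, dD n (r • x) = r • dD n x)
    (hφ : ∀ n (r : R) x, φ n (r • x) = r • φ n x)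
    (h : ∀ (Q : Ideal R) [Q.IsMaximal] (y : D 0), ∃ s ∉ Q, ∃ x y', s • y = φ 0 x + dD 0 y') :
    ConeExactAt dC dD φ 0 := by
  intro y
  let I := coneIdeal hdD hφ (n := 0) (fun _ _ => True) trivial (fun _ _ _ _ _ _ => trivial)
    (fun _ _ _ _ => trivial) y
  have hI : I = ⊤ := by
    by_contra hne
    obtain ⟨Q, hQ, hIQ⟩ := Ideal.exists_le_maximal I hne
    obtain ⟨s, hs, x, y', hy⟩ := h Q y
    exact hs (hIQ ⟨x, y', trivial, hy⟩)
  obtain ⟨x', y', -, hy⟩ : (1 : R) ∈ I := hI ▸ Submodule.mem_top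
  exact ⟨x', y', by rw [← hy, one_smul]⟩

lemma coneExactAt_succ_of_forall_isMaximal {n : ℕ} (hdC : ∀ n (r : R) x, dC n (r • x) = r • dC n x)
    (hdD : ∀ n (r : R) x, dD n (r • x) = r • dD n x)
    (hφ : ∀ n (r : R) x, φ n (r • x) = r • φ n x)
    (h : ∀ (Q : Ideal R) [Q.IsMaximal] x y, IsCycle dC n x → φ n x = dD n y → ∃ s ∉ Q, ∃ x' y',
      dC n x' = s • x ∧ s • y = φ (n + 1) x' + dD (n + 1) y') :
    ConeExactAt dC dD φ (n + 1) := by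
  intro x y hx hxy
  -- The predicate records the first component, so that the ideal consists of the scalars that make
  -- the pair `(x, y)` a boundary.
  let I := coneIdeal hdD hφ (n := n + 1) (fun r x' => dC n x' = r • x) (by simp)
    (fun r s x' y' hr hs => by rw [map_add, hr, hs, add_smul])
    (fun r s x' hs => by rw [hdC, hs, mul_smul]) y
  have hI : I = ⊤ := by
    by_contra hne
    obtain ⟨Q, hQ, hIQ⟩ := Ideal.exists_le_maximal I hne
    obtain ⟨s, hs, x', y', hx', hy⟩ := h Q x y hx hxy
    exact hs (hIQ ⟨x', y', hx', hy⟩)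
  obtain ⟨x', y', hx', hy⟩ : (1 : R) ∈ I := hI ▸ Submodule.mem_top
  exact ⟨x', y', by rw [hx', one_smul], by rw [← hy, one_smul]⟩

end LocalProperty

/-! ### Quasi-isomorphisms -/

/-- A morphism of chain complexes of modules whose cone is exact is a quasi-isomorphism. -/
lemma quasiIso_of_coneExactAt {R : Type u} [CommRing R] {K L : ChainComplex (ModuleCat.{u} R) ℕ}
    (φ : K ⟶ L) (h : ∀ n, ConeExactAt (fun n => (K.d (n + 1) n).hom.toAddMonoidHom)
      (fun n => (L.d (n + 1) n).hom.toAddMonoidHom) (fun n => (φ.f n).hom.toAddMonoidHom) n) :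
    QuasiIso φ := by
  -- Exactness gives preimages element by element, and their choice is not linear in the element. It
  -- becomes linear on the free module on the underlying set of `A`, whose surjection onto `A`
  -- serves as the refinement.
  have free : ∀ {A M N : ModuleCat.{u} R} (g : A → M) (s : M ⟶ N) (t : A ⟶ N),
      (∀ a, s (g a) = t a) →
      ModuleCat.ofHom (Finsupp.linearCombination R g) ≫ s =
        ModuleCat.ofHom (Finsupp.linearCombination R (id : A → A)) ≫ t := by
    intro A M N g s t h
    ext a
    simpa using h a
  have epi : ∀ A : ModuleCat.{u} R,
      Epi (ModuleCat.ofHom (Finsupp.linearCombination R (id : A → A))) := fun A =>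
    (ModuleCat.epi_iff_surjective _).mpr (Finsupp.linearCombination_id_surjective R A)
  have cyc : ∀ (K : ChainComplex (ModuleCat.{u} R) ℕ) (n : ℕ) (x : K.X n),
      K.d n ((ComplexShape.down ℕ).next n) x = 0 ↔
        IsCycle (C := fun n => K.X n) (fun n => (K.d (n + 1) n).hom.toAddMonoidHom) n x := by
    intro K n x
    cases n with
    | zero =>
      rw [K.shape _ _ (by simp)]
      simp [IsCycle]
    | succ n =>
      rw [ChainComplex.next_nat_succ]
      rfl
  refine ⟨fun n => ?_⟩
  rw [quasiIsoAt_iff_isIso_homologyMap]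
  -- Injectivity on homology is the first component of exactness at `n + 1`; surjectivity comes from
  -- exactness at `n`, applied to `(0, y)` in positive degrees.
  have hm : Mono (HomologicalComplex.homologyMap φ n) := by
    rw [HomologicalComplex.mono_homologyMap_iff_up_to_refinements φ (n + 1) n _
      (ChainComplex.prev ℕ n) rfl]
    intro A x hx y hxy
    have hex : ∀ a, ∃ x', K.d (n + 1) n x' = x a := fun a => by
      obtain ⟨x', y', hx', -⟩ := h (n + 1) (x a) (y a)
        ((cyc K n _).mp congr($hx a)) congr($hxy a)
      exact ⟨x', hx'⟩
    choose g hg using hex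
    exact ⟨_, _, epi A, _, (free g (K.d (n + 1) n) x hg).symm⟩
  have he : Epi (HomologicalComplex.homologyMap φ n) := by
    rw [HomologicalComplex.epi_homologyMap_iff_up_to_refinements φ (n + 1) n _
      (ChainComplex.prev ℕ n) rfl]
    intro A y hy
    have hex : ∀ a, ∃ x' y', K.d n ((ComplexShape.down ℕ).next n) x' = 0 ∧
        y a = φ.f n x' + L.d (n + 1) n y' := fun a => by
      have hya := (cyc L n _).mp congr($hy a)
      generalize y a = b at hya
      simp only [cyc]
      cases n with
      | zero =>
        obtain ⟨x', y', h⟩ := h 0 b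
        exact ⟨x', y', trivial, h⟩
      | succ n => exact h (n + 1) 0 b (by cases n <;> simp [IsCycle]) (by simpa using hya.symm)
    choose g g' hg hg' using hex
    refine ⟨_, _, epi A, ModuleCat.ofHom (Finsupp.linearCombination R g), ?_,
      ModuleCat.ofHom (Finsupp.linearCombination R g'), ?_⟩
    · rw [free g _ 0 hg, Limits.comp_zero]
    · ext a
      simpa using hg' a
  exact isIso_of_mono_of_epi _

/-! ### Descent from the localizations of `B` at its maximal ideals -/

section Global

variable {k A B C : Type u} [CommRing k] [CommRing A] [CommRing B] [CommRing C]
  [Algebra k A] [Algebra A B] [Algebra A C] {f : A}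

lemma phhD_smul (n : ℕ) (b : B) (x : B ⊗[A] PHHRing k f (n + 1)) :
    phhD k f B n (b • x) = b • phhD k f B n x := by
  refine altSum_natural (DistribSMul.toAddMonoidHom _ b) (DistribSMul.toAddMonoidHom _ b)
    (fun i x => ?_) x
  induction x using TensorProduct.induction_on with
  | zero => simp only [map_zero]
  | add x y hx hy => simp only [map_add, hx, hy]
  | tmul c x => rfl

variable (k f) in
/-- The differential of `P̲HH(A, f)`. -/
def phhChainD (n : ℕ) : PHHRing k f (n + 1) →+ PHHRing k f n :=
  altSum fun i : Fin (n + 2) => (phhFace k f n i).toLinearMap.toAddMonoidHom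

lemma phhChainD_smul (n : ℕ) (a : A) (x : PHHRing k f (n + 1)) :
    phhChainD k f n (a • x) = a • phhChainD k f n x :=
  altSum_natural (DistribSMul.toAddMonoidHom _ a) (DistribSMul.toAddMonoidHom _ a)
    (fun i x => map_smul (phhFace k f n i) a x) x

lemma tmul_phhChainD (n : ℕ) (x : PHHRing k f (n + 1)) :
    (1 : B) ⊗ₜ[A] phhChainD k f n x = phhD k f B n (1 ⊗ₜ x) :=
  (altSum_natural (d' := fun i : Fin (n + 2) =>
      ((phhFace k f n i).toLinearMap.lTensor B).toAddMonoidHom)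
    (TensorProduct.mk A B (PHHRing k f (n + 1)) 1).toAddMonoidHom
    (TensorProduct.mk A B (PHHRing k f n) 1).toAddMonoidHom (fun _ _ => rfl) x).symm

variable [Algebra B C] [IsScalarTower A B C]

/-- A localization of `B` gives a localization of `B ⊗ N`. -/
lemma isLocalizedModule_map_tensorProduct (S : Submonoid B) [IsLocalization S C] (N : Type u)
    [AddCommGroup N] [Module A N] :
    IsLocalizedModule S (TensorProduct.AlgebraTensorModule.map (Algebra.linearMap B C)
      (LinearMap.id : N →ₗ[A] N)) := by
  have h : IsLocalizedModule S (TensorProduct.mk B C (B ⊗[A] N) 1) :=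
    (isLocalizedModule_iff_isBaseChange S C _).mpr (TensorProduct.isBaseChange B _ C)
  have := IsLocalizedModule.of_linearEquiv S (TensorProduct.mk B C (B ⊗[A] N) 1)
    ((TensorProduct.AlgebraTensorModule.cancelBaseChange A B C C N).restrictScalars B)
  convert this
  ext x
  simp

lemma map_phhD (n : ℕ) (x : B ⊗[A] PHHRing k f (n + 1)) :
    TensorProduct.AlgebraTensorModule.map (Algebra.linearMap B C) LinearMap.id (phhD k f B n x) =
      phhD k f C n
        (TensorProduct.AlgebraTensorModule.map (Algebra.linearMap B C) LinearMap.id x) := by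
  refine (altSum_natural (d' := fun i : Fin (n + 2) =>
      ((phhFace k f n i).toLinearMap.lTensor C).toAddMonoidHom)
    (TensorProduct.AlgebraTensorModule.map (Algebra.linearMap B C)
      (LinearMap.id : PHHRing k f (n + 1) →ₗ[A] _)).toAddMonoidHom
    (TensorProduct.AlgebraTensorModule.map (Algebra.linearMap B C)
      (LinearMap.id : PHHRing k f n →ₗ[A] _)).toAddMonoidHom (fun i x => ?_) x).symm
  induction x using TensorProduct.induction_on with
  | zero => simp only [map_zero]
  | add x y hx hy => simp only [map_add, hx, hy]
  | tmul c x => rfl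

variable [Algebra k B] [IsScalarTower k A B]

lemma phhTower_smul (n : ℕ) (c : C) (x : C ⊗[A] PHHRing k f n) :
    phhTower k A B C f n (c • x) = c • phhTower k A B C f n x := by
  induction x using TensorProduct.induction_on with
  | zero => simp
  | add x y hx hy => simp only [map_add, smul_add, hx, hy]
  | tmul b x => rfl

/-- When `C` is a localization of `B`, this identifies `phhTower` as the localization of the
canonical map. -/
lemma tmul_comparisonRing (n : ℕ) (x : B ⊗[A] PHHRing k f n) :
    (1 : C) ⊗ₜ[B] comparisonRing k f B n x = phhTower k A B C f n
      (TensorProduct.AlgebraTensorModule.map (Algebra.linearMap B C) LinearMap.id x) := by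
  induction x using TensorProduct.induction_on with
  | zero => simp
  | add x y hx hy =>
    refine (congrArg ((1 : C) ⊗ₜ[B] ·) (map_add (comparisonRing k f B n) x y)).trans
      ((TensorProduct.tmul_add _ _ _).trans ((congrArg₂ (· + ·) hx hy).trans ?_))
    simp only [map_add]
  | tmul b x =>
    have h : comparisonRing k f B n (b ⊗ₜ x) =
        b • PHHMap id rfl (awayMap k f B) (awayMap_algebraMap k f B) x := by
      rw [Algebra.smul_def]
      rfl
    rw [h, ← TensorProduct.smul_tmul, ← Algebra.algebraMap_eq_smul_one]
    rfl

/-- Étale descent. -/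
theorem IsStrictNormalCrossing.coneExactAt_comparisonRing {k A B : Type u} [CommRing k]
    [CommRing A] [CommRing B] [Algebra k A] [Algebra k B] [Algebra A B] [IsScalarTower k A B]
    {f : A} (h : IsStrictNormalCrossing k f) [Algebra.Etale A B] (hA : IsProductOfPrimes f)
    (hB : IsProductOfPrimes (algebraMap A B f)) (n : ℕ) :
    ConeExactAt (phhD k f B) (phhChainD k (algebraMap A B f))
      (fun n => (comparisonRing k f B n).toLinearMap.toAddMonoidHom) n := by
  have hlocC : ∀ (Q : Ideal B) [Q.IsMaximal] (n : ℕ), IsLocalizedModule Q.primeCompl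
      (TensorProduct.AlgebraTensorModule.map (Algebra.linearMap B (Localization.AtPrime Q))
        (LinearMap.id : PHHRing k f n →ₗ[A] _)) :=
    fun Q _ n => isLocalizedModule_map_tensorProduct Q.primeCompl _
  have hlocD : ∀ (Q : Ideal B) [Q.IsMaximal] (n : ℕ), IsLocalizedModule Q.primeCompl
      (TensorProduct.mk B (Localization.AtPrime Q) (PHHRing k (algebraMap A B f) n) 1) :=
    fun Q _ n => (isLocalizedModule_iff_isBaseChange Q.primeCompl (Localization.AtPrime Q) _).mpr
      (TensorProduct.isBaseChange B _ _)
  have hcone : ∀ (Q : Ideal B) [Q.IsMaximal] (n : ℕ), ConeExactAt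
      (phhD k f (Localization.AtPrime Q)) (phhD k (algebraMap A B f) (Localization.AtPrime Q))
      (phhTower k A B (Localization.AtPrime Q) f) n :=
    fun Q _ n => h.coneExactAt_phhTower hA hB Q n
  have hsC : ∀ (Q : Ideal B) [Q.IsMaximal] (n : ℕ) (r : B)
      (x : Localization.AtPrime Q ⊗[A] PHHRing k f (n + 1)),
      phhD k f (Localization.AtPrime Q) n (r • x) = r • phhD k f (Localization.AtPrime Q) n x :=
    fun Q _ n r x => by
      rw [← algebraMap_smul (Localization.AtPrime Q) r x, phhD_smul, algebraMap_smul]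
  have hsD : ∀ (Q : Ideal B) [Q.IsMaximal] (n : ℕ) (r : B)
      (x : Localization.AtPrime Q ⊗[B] PHHRing k (algebraMap A B f) (n + 1)),
      phhD k (algebraMap A B f) (Localization.AtPrime Q) n (r • x) =
        r • phhD k (algebraMap A B f) (Localization.AtPrime Q) n x :=
    fun Q _ n r x => by
      rw [← algebraMap_smul (Localization.AtPrime Q) r x, phhD_smul, algebraMap_smul]
  have hsφ : ∀ (Q : Ideal B) [Q.IsMaximal] (n : ℕ) (r : B)
      (x : Localization.AtPrime Q ⊗[A] PHHRing k f n),
      phhTower k A B (Localization.AtPrime Q) f n (r • x) =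
        r • phhTower k A B (Localization.AtPrime Q) f n x :=
    fun Q _ n r x => by
      rw [← algebraMap_smul (Localization.AtPrime Q) r x, phhTower_smul, algebraMap_smul]
  have hφ : ∀ n (r : B) (x : B ⊗[A] PHHRing k f n),
      (comparisonRing k f B n).toLinearMap.toAddMonoidHom (r • x) =
        r • (comparisonRing k f B n).toLinearMap.toAddMonoidHom x :=
    fun n r x => map_smul (comparisonRing k f B n) r x
  cases n with
  | zero =>
    refine coneExactAt_zero_of_forall_isMaximal (R := B) phhChainD_smul hφ fun Q _ y => ?_
    exact (hcone Q 0).exists_of_localized_zero Q.primeCompl phhChainD_smul hφ (hsD Q) (hsφ Q)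
      (fun n => TensorProduct.AlgebraTensorModule.map
        (Algebra.linearMap B (Localization.AtPrime Q)) (LinearMap.id : PHHRing k f n →ₗ[A] _))
      (fun n => TensorProduct.mk B (Localization.AtPrime Q) (PHHRing k (algebraMap A B f) n) 1)
      tmul_phhChainD tmul_comparisonRing y
  | succ n =>
    refine coneExactAt_succ_of_forall_isMaximal (R := B) phhD_smul phhChainD_smul hφ
      fun Q _ x y hx hxy => ?_
    exact (hcone Q (n + 1)).exists_of_localized_succ Q.primeCompl phhD_smul phhChainD_smul hφ
      (hsC Q) (hsD Q) (hsφ Q)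
      (fun n => TensorProduct.AlgebraTensorModule.map
        (Algebra.linearMap B (Localization.AtPrime Q)) (LinearMap.id : PHHRing k f n →ₗ[A] _))
      (fun n => TensorProduct.mk B (Localization.AtPrime Q) (PHHRing k (algebraMap A B f) n) 1)
      map_phhD tmul_phhChainD tmul_comparisonRing hx hxy

end Global

/-! ### The faces of the simplicial circle -/

lemma coe_wrap {n : ℕ} (i : Fin (n + 2)) : (wrap i : ℕ) = (i : ℕ) % (n + 1) := by
  induction i using Fin.lastCases with
  | last => simp
  | cast i => rw [wrap_castSucc, Fin.val_castSucc, Nat.mod_eq_of_lt i.2]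

/-- A face of the circle merges two neighbours of the interval. The last face merges the place `n +
1` with the end point, which `wrap` reads as `0`. -/
lemma circleMap_eq_circ {n : ℕ} (i : Fin (n + 2)) :
    circleMap (Fin.succAboveOrderEmb i).toOrderHom = circ i.predAbove := by
  funext j
  apply Fin.ext
  rw [circleMap_face, circ, coe_wrap, coe_predAbove, Fin.val_castSucc]
  congr 1
  simp only [Fin.le_def]
  split_ifs <;> omega

lemma alternatingFaceMapComplex_d_apply {R : Type u} [CommRing R]
    (S : SimplicialObject (ModuleCat.{u} R)) (n : ℕ)
    (x : (AlgebraicTopology.AlternatingFaceMapComplex.obj S).X (n + 1)) :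
    ((AlgebraicTopology.AlternatingFaceMapComplex.obj S).d (n + 1) n).hom x =
      altSum (fun i : Fin (n + 2) => (S.δ i).hom.toAddMonoidHom) x := by
  rw [AlgebraicTopology.AlternatingFaceMapComplex.obj_d_eq, ModuleCat.hom_sum, altSum,
    AddMonoidHom.finsetSum_apply]
  exact LinearMap.sum_apply _ _ _

lemma chains_d_apply {R : Type u} [CommRing R] (Y : SimplicialObject (CommAlgCat.{u} R)) (n : ℕ)
    (x : ((chains R).obj Y).X (n + 1)) : (((chains R).obj Y).d (n + 1) n).hom x =
      altSum (fun i : Fin (n + 2) => (Y.δ i).hom.toLinearMap.toAddMonoidHom) x :=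
  alternatingFaceMapComplex_d_apply (((SimplicialObject.whiskering _ _).obj
    (forget₂ (CommAlgCat.{u} R) (AlgCat.{u} R) ⋙ forget₂ (AlgCat.{u} R) (ModuleCat.{u} R))).obj Y)
    n x

lemma PHHMap_circleMap {k A : Type u} [CommRing k] [CommRing A] [Algebra k A] {f : A} (n : ℕ)
    (i : Fin (n + 2)) : PHHMap (circleMap (Fin.succAboveOrderEmb i).toOrderHom) (circleMap_zero _)
      (AlgHom.id k (Localization.Away f)) (fun _ => rfl) = phhFace k f n i :=
  AlgHom.ext fun x => Subtype.ext
    congr(barMap $(circleMap_eq_circ i) (AlgHom.id k (Localization.Away f)) x.1)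

lemma ConeExactAt.congr_d {C D : ℕ → Type*} [∀ n, AddCommGroup (C n)] [∀ n, AddCommGroup (D n)]
    {dC dC' : ∀ n, C (n + 1) →+ C n} {dD dD' : ∀ n, D (n + 1) →+ D n} {φ : ∀ n, C n →+ D n} {n : ℕ}
    (h : ConeExactAt dC dD φ n) (hC : ∀ n x, dC' n x = dC n x) (hD : ∀ n x, dD' n x = dD n x) :
    ConeExactAt dC' dD' φ n := by
  obtain rfl : dC' = dC := funext fun n => AddMonoidHom.ext (hC n)
  obtain rfl : dD' = dD := funext fun n => AddMonoidHom.ext (hD n)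
  exact h

/-! ### The differentials of the two chain complexes in the theorem -/

section Chains

variable {k A B : Type u} [CommRing k] [CommRing A] [CommRing B] [Algebra k A] [Algebra A B] {f : A}

lemma chains_PHH_d (n : ℕ) (x : PHHRing k f (n + 1)) :
    (((chains A).obj (PHH k f)).d (n + 1) n).hom x = phhChainD k f n x := by
  refine (chains_d_apply (PHH k f) n x).trans ?_
  have : ∀ i : Fin (n + 2), ((PHH k f).δ i).hom = phhFace k f n i := PHHMap_circleMap n
  exact congrArg (fun d : Fin (n + 2) → PHHRing k f (n + 1) →ₐ[A] PHHRing k f n =>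
    altSum (fun i => (d i).toLinearMap.toAddMonoidHom) x) (funext this)

lemma phhD_apply (n : ℕ) (x : B ⊗[A] PHHRing k f (n + 1)) : phhD k f B n x =
    altSum (fun i : Fin (n + 2) => (Algebra.TensorProduct.map (AlgHom.id B B)
      (phhFace k f n i)).toLinearMap.toAddMonoidHom) x := by
  refine congrArg (fun d : Fin (n + 2) → B ⊗[A] PHHRing k f (n + 1) →+ B ⊗[A] PHHRing k f n =>
    altSum d x) (funext fun i => AddMonoidHom.ext fun y => ?_)
  induction y using TensorProduct.induction_on with
  | zero => simp only [map_zero]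
  | add x y hx hy => simp only [map_add, hx, hy]
  | tmul b x => rfl

lemma chains_baseChange_PHH_d (n : ℕ) (x : B ⊗[A] PHHRing k f (n + 1)) :
    (((chains B).obj (((SimplicialObject.whiskering _ _).obj (baseChange A B)).obj
      (PHH k f))).d (n + 1) n).hom x = phhD k f B n x := by
  refine (chains_d_apply (((SimplicialObject.whiskering _ _).obj (baseChange A B)).obj
    (PHH k f)) n x).trans (Eq.trans ?_ (phhD_apply n x).symm)
  have h : ∀ i : Fin (n + 2), ((PHH k f).δ i).hom = phhFace k f n i := PHHMap_circleMap n
  have h' : ∀ i : Fin (n + 2), ((((SimplicialObject.whiskering _ _).obj (baseChange A B)).obj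
      (PHH k f)).δ i).hom = Algebra.TensorProduct.map (AlgHom.id B B) (phhFace k f n i) :=
    fun i => congrArg (Algebra.TensorProduct.map (AlgHom.id B B)) (h i)
  exact congrArg (fun d : Fin (n + 2) → B ⊗[A] PHHRing k f (n + 1) →ₐ[B] B ⊗[A] PHHRing k f n =>
    altSum (fun i => (d i).toLinearMap.toAddMonoidHom) x) (funext h')

end Chains

end ModulusHochschild

end

theorem mainTheorem7 {k A B : Type u} [Field k] [CommRing A] [CommRing B]
    [Algebra k A] [Algebra k B] [Algebra A B] [IsScalarTower k A B] (f : A)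
    (hsnc : ModulusHochschild.IsStrictNormalCrossing k f) (hetale : Algebra.Etale A B)
    (hA : ModulusHochschild.IsProductOfPrimes f)
    (hB : ModulusHochschild.IsProductOfPrimes (algebraMap A B f)) :
    QuasiIso ((ModulusHochschild.chains B).map (ModulusHochschild.comparison k f B)) := by
  refine ModulusHochschild.quasiIso_of_coneExactAt _ fun n => ?_
  have h := hsnc.coneExactAt_comparisonRing hA hB n
  exact h.congr_d ModulusHochschild.chains_baseChange_PHH_d ModulusHochschild.chains_PHH_d
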